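/- **Setting.** Let $d\ge1$, let $\Omega\subset\mathbb R^d$ be a bounded Lipschitz domain with polyhedral boundary (it is triangulated by $\mathcal G$ below), $r>\frac{2d}{d+1}$, $\frac1r+\frac1{r'}=1$, $f\in L^{r'}(\Omega)^d$. Let $t,\tilde t$ be such that $\frac{2d}{d+1}<t<r$ and $\tilde t=\frac12\frac{dt}{d-t}$ if $r\le\frac{3d}{d+2}$, and $t=r$, $\tilde t=r'$ otherwise; $t',\tilde t'$ denote conjugate exponents. Let $S^n:\Omega\times\mathbb R^{d\times d}_{\rm sym}\to\mathbb R^{d\times d}_{\rm sym}$ ($n\in\mathbb N$) be measurable in $x$ and, for a.e. $x$, continuous and strictly monotone in $\delta$, with $|S^n(x,\delta)|\le c_1|\delta|^{r-1}+k(x)$ and $S^n(x,\delta):\delta\ge c_2|\delta|^r-m(x)$ for all $\delta$, a.e. $x$ and all $n$, with constants $c_1,c_2>0$ and nonnegative $m\in L^1(\Omega)$, $k\in L^{r'}(\Omega)$ independent of $n$. Let $\mathcal G$ be a conforming partition of $\Omega$ into closed simplices which is shape-regular with constant $\sigma$: for each $E\in\mathcal G$, the ratio of the diameter of $E$ to the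 diameter of its largest inscribed ball is at most $\sigma$. The mesh size is $h_{\mathcal G}(x)=\big|\bigcup\{E\in\mathcal G: x\in E\}\big|^{1/d}$. Let $\mathbb V\subseteq C(\bar\Omega)^d$ and $\mathbb Q\subseteq L^\infty(\Omega)$ be subspaces, $\mathbb P_1\subseteq\hat{\mathbb P}_{\mathbb V}\subseteq\mathbb P_\ell$ (vector-valued) and $\mathbb P_0\subseteq\hat{\mathbb P}_{\mathbb Q}\subseteq\mathbb P_\jmath$, $\jmath\le\ell$, spaces of polynomials on the reference simplex $\hat E$, and $F_E:E\to\hat E$ affine bijections. Set $$\mathbb V(\mathcal G)=\{V\in\mathbb V: V|_E\circ F_E^{-1}\in\hat{\mathbb P}_{\mathbb V}\ \forall E\in\mathcal G,\ V|_{\partial\Omega}=0\},\qquad \mathbb Q(\mathcal G)=\{Q\in\mathbb Q: Q|_E\circ F_E^{-1}\in\hat{\mathbb P}_{\mathbb Q}\ \forall E\in\mathcal G\},$$ where $\mathbb V$ contains all continuous vector fields that are affine on each $E\in\mathcal G$ and vanish on $\partial\Omega$ (so that $\mathbb V(\mathcal G)$ contains them too). Let $\Pi_{\mathcal G}:L^1(\Omega)^{d\times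 d}\to\mathbb P_{\ell-1}(\mathcal G)^{d\times d}$ be a linear projection onto the piecewise polynomials of degree at most $\ell-1$ which is locally $L^1$-stable: for some $c>0$, $\int_E|\Pi_{\mathcal G}S|\,dx\le c\int_{\mathcal U(E)}|S|\,dx$ for all $S$ and $E$, with $\mathcal U(E)$ the union of the elements meeting $E$. Let $B[v,v]_j=\frac12\sum_i\big(v_i\,\partial_iv_j+\partial_i(v_iv_j)\big)$ and let $D$ be the symmetric gradient. Fix $n$. A Galerkin approximation is a pair $(U,P)\in\mathbb V(\mathcal G)\times\mathbb Q(\mathcal G)$ with $\int_\Omega P\,dx=0$ and $$\int_\Omega S^n(\cdot,DU):DV+B[U,U]\cdot V-P\operatorname{div}V\,dx=\int_\Omega f\cdot V\,dx,\qquad \int_\Omega Q\operatorname{div}U\,dx=0$$ for all $V\in\mathbb V(\mathcal G)$, $Q\in\mathbb Q(\mathcal G)$. Its residuals are $$\langle\mathcal R^{\rm pde},w\rangle=\int_\Omega S^n(\cdot,DU):Dw+B[U,U]\cdot w-P\operatorname{div}w-f\cdot w\,dx\quad (w\in W^{1,\tilde t'}_0(\Omega)^d),\qquad \langle\mathcal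 R^{\rm ic},o\rangle=-\int_\Omega o\operatorname{div}U\,dx .$$ With $T=\Pi_{\mathcal G}S^n(\cdot,DU)$ put $\mathcal E^{\rm ic}=\|\operatorname{div}U\|_t^t$ and $$\mathcal E^{\rm pde}=\sum_{E\in\mathcal G}\Big(\big\|h_{\mathcal G}(-\operatorname{div}T+B[U,U]+\nabla P-f)\big\|_{\tilde t;E}^{\tilde t}+\big\|h_{\mathcal G}^{1/\tilde t}[\![T-P\,\mathrm{id}]\!]\big\|_{\tilde t;\partial E}^{\tilde t}+\|S^n(\cdot,DU)-T\|_{\tilde t;E}^{\tilde t}\Big),$$ where $\operatorname{div}T$ and $\nabla P$ are taken elementwise and $[\![\cdot]\!]$ is the normal jump across the interelement sides, $0$ on $\partial\Omega$. **Theorem.** There is a constant $C_1>0$ depending only on $\sigma$, $\tilde t$ and $d$ such that, for all data as above, every $n$ and every Galerkin approximation $(U,P)$, $\mathcal R^{\rm pde}$ is well defined on $W^{1,\tilde t'}_0(\Omega)^d$, $\mathcal E^{\rm pde}$ and $\mathcal E^{\rm ic}$ are finite, and $$\|\mathcal R^{\rm pde}\|_{W^{-1,\tilde t}(\Omega)}\le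 C_1\,(\mathcal E^{\rm pde})^{1/\tilde t},\qquad \sup_{o\in L^{t'}(\Omega)/\mathbb R}\Big\langle\mathcal R^{\rm ic},\frac{o}{\inf_{c\in\mathbb R}\|o-c\|_{t'}}\Big\rangle=(\mathcal E^{\rm ic})^{1/t}=\|\operatorname{div}U\|_t .$$ -/

import Mathlib

open MeasureTheory Set
open scoped ENNReal NNReal ContDiff

namespace PowerLawFEM

/-! ### Vectors and matrices -/

/-- Points and vectors of `ℝ^d`, with the Euclidean norm. -/
abbrev Vec (d : ℕ) := EuclideanSpace ℝ (Fin d)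

/-- Real `d × d` matrices; norm and inner product are the Frobenius norm `|A|` and `A : B`. -/
abbrev Mat (d : ℕ) := EuclideanSpace ℝ (Fin d × Fin d)

/-- Symmetric real `d × d` matrices. -/
def SymMat (d : ℕ) : Submodule ℝ (Mat d) where
  carrier := {A | ∀ i j, A (i, j) = A (j, i)}
  add_mem' := by
    intro A B hA hB i j
    simp only [PiLp.add_apply, hA i j, hB i j]
  zero_mem' := by
    intro i j
    simp
  smul_mem' := by
    intro c A hA i j
    simp only [PiLp.smul_apply, hA i j]

/-- The symmetric part `(A + Aᵀ) / 2`. -/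
noncomputable def symPart {d : ℕ} (A : Mat d) : SymMat d :=
  ⟨WithLp.toLp 2 fun ij => (A (ij.1, ij.2) + A (ij.2, ij.1)) / 2, by
    intro i j
    simp only [add_comm]⟩

/-! ### The domain -/

/-- Bounded Lipschitz domain: nonempty, open, connected, bounded, and near each boundary point, in
suitable Cartesian coordinates, the part of space strictly above the graph of a Lipschitz
function. -/
structure IsLipschitzDomain {d : ℕ} (Ω : Set (Vec d)) : Prop where
  isOpen : IsOpen Ω
  isConnected : IsConnected Ω
  isBounded : Bornology.IsBounded Ω
  boundary : ∀ x ∈ frontier Ω, ∃ e : Vec d, ‖e‖ = 1 ∧ ∃ ε : ℝ, 0 < ε ∧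
    ∃ (L : ℝ≥0) (g : Vec d → ℝ), LipschitzWith L g ∧
      ∀ y ∈ Metric.ball x ε, y ∈ Ω ↔ g (y - (inner ℝ e y : ℝ) • e) < inner ℝ e y

/-! ### Weak gradients and Sobolev spaces -/

/-- `G` is the weak gradient of the vector field `u` in `Ω`, with `G (i, j) = ∂_j u_i`. -/
def HasWeakGrad {d : ℕ} (Ω : Set (Vec d)) (u : Vec d → Vec d) (G : Vec d → Mat d) : Prop :=
  LocallyIntegrableOn u Ω volume ∧ LocallyIntegrableOn G Ω volume ∧
  ∀ φ : Vec d → ℝ, ContDiff ℝ ∞ φ → HasCompactSupport φ → tsupport φ ⊆ Ω → ∀ i j : Fin d,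
    ∫ x in Ω, u x i * fderiv ℝ φ x (EuclideanSpace.single j 1) = -∫ x in Ω, G x (i, j) * φ x

open Classical in
/-- The weak gradient of `u` in `Ω` (unique almost everywhere in `Ω`; zero if there is none). -/
noncomputable def weakGrad {d : ℕ} (Ω : Set (Vec d)) (u : Vec d → Vec d) : Vec d → Mat d :=
  if h : ∃ G, HasWeakGrad Ω u G then h.choose else 0

/-- The symmetric gradient `D u`. -/
noncomputable def symGrad {d : ℕ} (Ω : Set (Vec d)) (u : Vec d → Vec d) (x : Vec d) : SymMat d :=
  symPart (weakGrad Ω u x)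

/-- The divergence `div u`. -/
noncomputable def divergence {d : ℕ} (Ω : Set (Vec d)) (u : Vec d → Vec d) (x : Vec d) : ℝ :=
  ∑ i, weakGrad Ω u x (i, i)

/-- The norm of `W^{1,p}(Ω)^d`: `(‖u‖_p^p + ‖∇u‖_p^p)^{1/p}`. -/
noncomputable def sobolevNorm {d : ℕ} (Ω : Set (Vec d)) (p : ℝ) (u : Vec d → Vec d) : ℝ≥0∞ :=
  (eLpNorm u (ENNReal.ofReal p) (volume.restrict Ω) ^ p +
    eLpNorm (weakGrad Ω u) (ENNReal.ofReal p) (volume.restrict Ω) ^ p) ^ (1 / p)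

/-- `u ∈ W^{1,p}(Ω)^d`. -/
def MemSobolev {d : ℕ} (Ω : Set (Vec d)) (p : ℝ) (u : Vec d → Vec d) : Prop :=
  MemLp u (ENNReal.ofReal p) (volume.restrict Ω) ∧
  ∃ G, HasWeakGrad Ω u G ∧ MemLp G (ENNReal.ofReal p) (volume.restrict Ω)

/-- `u ∈ W^{1,p}_0(Ω)^d`, the closure of `C_0^∞(Ω)^d` in `W^{1,p}(Ω)^d`. -/
def MemSobolevZero {d : ℕ} (Ω : Set (Vec d)) (p : ℝ) (u : Vec d → Vec d) : Prop :=
  MemSobolev Ω p u ∧ ∀ ε : ℝ≥0∞, 0 < ε → ∃ φ : Vec d → Vec d,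
    ContDiff ℝ ∞ φ ∧ HasCompactSupport φ ∧ tsupport φ ⊆ Ω ∧ sobolevNorm Ω p (u - φ) < ε

/-- The norm, in the dual of `W^{1,p}_0(Ω)^d`, of a functional `R`: the supremum of
`R w / ‖w‖_{1,p}` over `w ∈ W^{1,p}_0(Ω)^d` (`w = 0` contributes `0 / 0 = 0` if `R 0 = 0`). -/
noncomputable def dualNorm {d : ℕ} (Ω : Set (Vec d)) (p : ℝ) (R : (Vec d → Vec d) → ℝ) : ℝ≥0∞ :=
  ⨆ (w : Vec d → Vec d) (_ : MemSobolevZero Ω p w), ENNReal.ofReal (R w) / sobolevNorm Ω p w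

/-! ### The exponents -/

/-- The relation between `r`, `t` and `t̃`. -/
def Exponents (d : ℕ) (r t tt : ℝ) : Prop :=
  2 * d / (d + 1) < r ∧
  ((r ≤ 3 * d / (d + 2) ∧ 2 * d / (d + 1) < t ∧ t < r ∧ tt = 1 / 2 * (d * t / (d - t))) ∨
    (3 * d / (d + 2) < r ∧ t = r ∧ tt = r.conjExponent))

/-! ### Approximation of the constitutive law -/

/-- The approximating stresses `S^n : Ω × Sym → Sym`: Carathéodory mappings, strictly monotone,
with `(r-1)`-growth and `r`-coercivity uniform in `n`. -/
structure IsStressApproximation {d : ℕ} (Ω : Set (Vec d)) (r : ℝ)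
    (S : ℕ → Vec d → SymMat d → SymMat d) : Prop where
  measurable : ∀ n δ, AEStronglyMeasurable (fun x => S n x δ) (volume.restrict Ω)
  continuous : ∀ n, ∀ᵐ x ∂(volume.restrict Ω), Continuous (S n x)
  strictMono : ∀ n, ∀ᵐ x ∂(volume.restrict Ω), ∀ δ₁ δ₂ : SymMat d, δ₁ ≠ δ₂ →
    0 < (inner ℝ (S n x δ₁ - S n x δ₂) (δ₁ - δ₂) : ℝ)
  growth : ∃ (c₁ c₂ : ℝ) (m k : Vec d → ℝ), 0 < c₁ ∧ 0 < c₂ ∧ (∀ x, 0 ≤ m x) ∧ (∀ x, 0 ≤ k x) ∧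
    MemLp m 1 (volume.restrict Ω) ∧
    MemLp k (ENNReal.ofReal r.conjExponent) (volume.restrict Ω) ∧
    ∀ n, ∀ᵐ x ∂(volume.restrict Ω), ∀ δ : SymMat d,
      ‖S n x δ‖ ≤ c₁ * ‖δ‖ ^ (r - 1) + k x ∧
      c₂ * ‖δ‖ ^ r - m x ≤ inner ℝ (S n x δ) δ

/-- The stress field `x ↦ S(x, D u(x))`. -/
noncomputable def stress {d : ℕ} (Ω : Set (Vec d)) (S : Vec d → SymMat d → SymMat d)
    (u : Vec d → Vec d) (x : Vec d) : Mat d :=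
  (S x (symGrad Ω u x) : Mat d)

/-! ### Simplicial meshes -/

/-- The closed simplex with vertex set `K`. -/
def simplex {d : ℕ} (K : Finset (Vec d)) : Set (Vec d) :=
  convexHull ℝ (K : Set (Vec d))

/-- A conforming partition of `Ω` into finitely many closed nondegenerate `d`-simplices, each
given by its vertex set. Two elements meet exactly in the simplex spanned by their common
vertices (which is empty if they have none). -/
structure Mesh {d : ℕ} (Ω : Set (Vec d)) where
  elems : Finset (Finset (Vec d))
  card_eq : ∀ K ∈ elems, K.card = d + 1
  affineIndependent : ∀ K ∈ elems, AffineIndependent ℝ ((↑) : K → Vec d)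
  cover : ⋃ K ∈ elems, simplex K = closure Ω
  conforming : ∀ K ∈ elems, ∀ L ∈ elems,
    simplex K ∩ simplex L = convexHull ℝ ((K : Set (Vec d)) ∩ L)

variable {d : ℕ} {Ω : Set (Vec d)}

/-- Shape regularity with constant `σ`: for each element the ratio of its diameter to the diameter
of its largest inscribed ball is at most `σ`. -/
def Mesh.ShapeRegular (𝒢 : Mesh Ω) (σ : ℝ) : Prop :=
  ∀ K ∈ 𝒢.elems, ∃ (x : Vec d) (ρ : ℝ), 0 < ρ ∧ Metric.closedBall x ρ ⊆ simplex K ∧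
    Metric.diam (simplex K) ≤ σ * (2 * ρ)

/-- The union of all elements that meet `A`. -/
def Mesh.patch (𝒢 : Mesh Ω) (A : Set (Vec d)) : Set (Vec d) :=
  ⋃ K ∈ 𝒢.elems, ⋃ (_ : (simplex K ∩ A).Nonempty), simplex K

/-- The mesh-size function: `h(x) = |patch {x}|^{1/d}`. -/
noncomputable def Mesh.h (𝒢 : Mesh Ω) (x : Vec d) : ℝ :=
  (volume (𝒢.patch {x})).toReal ^ (1 / (d : ℝ))

/-- The sides of the mesh: `(d-1)`-dimensional subsimplices of elements whose relative interior
lies inside `Ω`. -/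
def Mesh.IsSide (𝒢 : Mesh Ω) (F : Finset (Vec d)) : Prop :=
  (∃ K ∈ 𝒢.elems, F ⊆ K) ∧ F.card = d ∧ intrinsicInterior ℝ (simplex F) ⊆ Ω

/-- `ν` is the outer unit normal to the simplex `K` on its facet `F`. -/
def IsOuterNormal (K F : Finset (Vec d)) (ν : Vec d) : Prop :=
  ‖ν‖ = 1 ∧ ∀ x ∈ simplex F,
    (∀ y ∈ simplex F, (inner ℝ (y - x) ν : ℝ) = 0) ∧ ∀ y ∈ simplex K, (inner ℝ (y - x) ν : ℝ) ≤ 0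

open Classical in
/-- The outer unit normal to the simplex `K` on its facet `F`. -/
noncomputable def outerNormal (K F : Finset (Vec d)) : Vec d :=
  if h : ∃ ν, IsOuterNormal K F ν then h.choose else 0

/-! ### Piecewise polynomials -/

/-- `f` is (the function of) a real polynomial of degree at most `m`. -/
def IsPoly (m : ℕ) (f : Vec d → ℝ) : Prop :=
  ∃ p : MvPolynomial (Fin d) ℝ, p.totalDegree ≤ m ∧
    ∀ x, f x = MvPolynomial.eval (fun i => x i) p

/-- `f` agrees almost everywhere on each element with a polynomial of degree at most `m`. -/
def Mesh.IsPiecewisePoly (𝒢 : Mesh Ω) (m : ℕ) (f : Vec d → ℝ) : Prop :=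
  ∀ K ∈ 𝒢.elems, ∃ q, IsPoly m q ∧ f =ᵐ[volume.restrict (simplex K)] q

open Classical in
/-- The polynomial that agrees with `f` almost everywhere on the simplex `K` (zero if there is
none). It carries the elementwise derivatives of `f` and the traces of `f|_K` on `∂K`. -/
noncomputable def polyOn (K : Finset (Vec d)) (f : Vec d → ℝ) : Vec d → ℝ :=
  if h : ∃ q, (∃ m, IsPoly m q) ∧ f =ᵐ[volume.restrict (simplex K)] q then h.choose else 0

/-- The `j`-th partial derivative, on the element `K`, of the piecewise polynomial `f`. -/
noncomputable def partialOn (K : Finset (Vec d)) (j : Fin d) (f : Vec d → ℝ) (x : Vec d) : ℝ :=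
  fderiv ℝ (polyOn K f) x (EuclideanSpace.single j 1)

/-- The (row-wise) divergence, on the element `K`, of a piecewise polynomial matrix field. -/
noncomputable def divOn (K : Finset (Vec d)) (T : Vec d → Mat d) (x : Vec d) : Vec d :=
  WithLp.toLp 2 fun i => ∑ j, partialOn K j (fun y => T y (i, j)) x

/-- The gradient, on the element `K`, of a piecewise polynomial scalar field. -/
noncomputable def gradOn (K : Finset (Vec d)) (q : Vec d → ℝ) (x : Vec d) : Vec d :=
  WithLp.toLp 2 fun j => partialOn K j q x

/-! ### Finite element spaces -/

/-- The reference simplex, with vertices `0, e_1, …, e_d`. -/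
def refSimplex (d : ℕ) : Set (Vec d) :=
  convexHull ℝ (insert 0 (range fun i : Fin d => EuclideanSpace.single i (1 : ℝ)))

/-- The data from which the finite element spaces are built: subspaces `𝕍` of `C(Ω̄)^d` and
`ℚ` of `L^∞(Ω)`, polynomial spaces `P_1 ⊆ P̂_V ⊆ P_ℓ` (vector-valued) and `P_0 ⊆ P̂_Q ⊆ P_𝚓` on
the reference simplex, and an affine bijection of each element onto the reference simplex. Functions
on `Ω̄` are represented by functions on `ℝ^d`. As usual, `𝕍` imposes no restriction on continuous
piecewise affine fields that vanish on the boundary. -/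
structure FESpaces (𝒢 : Mesh Ω) (l j : ℕ) where
  degree_le : j ≤ l
  VV : Submodule ℝ (Vec d → Vec d)
  VV_continuous : ∀ V ∈ VV, ContinuousOn V (closure Ω)
  VV_affine : ∀ V : Vec d → Vec d, Continuous V → (∀ x ∉ Ω, V x = 0) →
    (∀ K ∈ 𝒢.elems, ∃ A : Vec d →ᵃ[ℝ] Vec d, EqOn V A (simplex K)) → V ∈ VV
  QQ : Submodule ℝ (Vec d → ℝ)
  QQ_bounded : ∀ Q ∈ QQ, MemLp Q ∞ (volume.restrict Ω)
  PV : Submodule ℝ (Vec d → Vec d)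
  PV_lower : ∀ p : Vec d → Vec d, (∀ i, IsPoly 1 (fun x => p x i)) → p ∈ PV
  PV_upper : ∀ p ∈ PV, ∀ i, IsPoly l (fun x => p x i)
  PQ : Submodule ℝ (Vec d → ℝ)
  PQ_lower : ∀ p : Vec d → ℝ, IsPoly 0 p → p ∈ PQ
  PQ_upper : ∀ p ∈ PQ, IsPoly j p
  F : Finset (Vec d) → Vec d ≃ᵃ[ℝ] Vec d
  F_image : ∀ K ∈ 𝒢.elems, F K '' simplex K = refSimplex d

/-- The discrete velocity space; its members are extended by zero outside `Ω`, which contains the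
boundary condition. -/
def FESpaces.velocity {𝒢 : Mesh Ω} {l j : ℕ} (X : FESpaces 𝒢 l j) : Set (Vec d → Vec d) :=
  {V | V ∈ X.VV ∧ (∀ K ∈ 𝒢.elems, ∃ p ∈ X.PV, ∀ x ∈ simplex K, V x = p (X.F K x)) ∧
    ∀ x ∉ Ω, V x = 0}

/-- The discrete pressure space. -/
def FESpaces.pressure {𝒢 : Mesh Ω} {l j : ℕ} (X : FESpaces 𝒢 l j) : Set (Vec d → ℝ) :=
  {Q | Q ∈ X.QQ ∧ ∀ K ∈ 𝒢.elems, ∃ p ∈ X.PQ,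
    ∀ᵐ x ∂(volume.restrict (simplex K)), Q x = p (X.F K x)}

/-! ### The stress projector -/

/-- `L^1(Ω)^{d×d}`. -/
noncomputable abbrev L1Mat (Ω : Set (Vec d)) := Lp (Mat d) 1 (volume.restrict Ω)

/-- A linear projection of `L^1(Ω)^{d×d}` onto the piecewise polynomials of degree at most `m`
that is locally `L^1`-stable. -/
structure IsStressProjector (𝒢 : Mesh Ω) (m : ℕ) (Pi : L1Mat Ω →ₗ[ℝ] L1Mat Ω) : Prop where
  range : ∀ T i j, 𝒢.IsPiecewisePoly m (fun x => Pi T x (i, j))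
  proj : ∀ T : L1Mat Ω, (∀ i j, 𝒢.IsPiecewisePoly m (fun x => T x (i, j))) → Pi T = T
  stable : ∃ c : ℝ, 0 < c ∧ ∀ T : L1Mat Ω, ∀ K ∈ 𝒢.elems,
    ∫ x in simplex K, ‖Pi T x‖ ≤ c * ∫ x in 𝒢.patch (simplex K), ‖T x‖

open Classical in
/-- The projector applied to an integrable matrix field. -/
noncomputable def project (Pi : L1Mat Ω →ₗ[ℝ] L1Mat Ω) (T : Vec d → Mat d) : Vec d → Mat d :=
  if h : MemLp T 1 (volume.restrict Ω) then Pi (h.toLp T) else 0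

/-! ### Convection, residual and Galerkin approximation -/

/-- The skew-symmetrized convective term: the vector field with
`∫ B[v,v]·w = ½ ∫ (v⊗w):∇v - (v⊗v):∇w`, that is
`B[v,v]_j = ½ ∑_i (v_i ∂_i v_j + ∂_i(v_i v_j))`. -/
noncomputable def convection (Ω : Set (Vec d)) (v : Vec d → Vec d) (x : Vec d) : Vec d :=
  WithLp.toLp 2 fun j => 1 / 2 * ∑ i,
    (v x i * weakGrad Ω v x (j, i) +
      (weakGrad Ω v x (i, i) * v x j + v x i * weakGrad Ω v x (j, i)))

/-- The integrand `T : D w + B[v,v]·w - q div w - f·w` of the residual of the momentum equation. -/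
noncomputable def resPdeIntegrand (Ω : Set (Vec d)) (f : Vec d → Vec d) (v : Vec d → Vec d)
    (q : Vec d → ℝ) (T : Vec d → Mat d) (w : Vec d → Vec d) (x : Vec d) : ℝ :=
  inner ℝ (T x) (symGrad Ω w x : Mat d) + inner ℝ (convection Ω v x) (w x)
    - q x * divergence Ω w x - inner ℝ (f x) (w x)

/-- The residual of the momentum equation. -/
noncomputable def resPde (Ω : Set (Vec d)) (f : Vec d → Vec d) (v : Vec d → Vec d)
    (q : Vec d → ℝ) (T : Vec d → Mat d) (w : Vec d → Vec d) : ℝ :=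
  ∫ x in Ω, resPdeIntegrand Ω f v q T w x

/-- The residual of the incompressibility equation. -/
noncomputable def resIc (Ω : Set (Vec d)) (v : Vec d → Vec d) (o : Vec d → ℝ) : ℝ :=
  -∫ x in Ω, o x * divergence Ω v x

/-- `(U, P)` is a Galerkin approximation for the stress law `S` and the force `f`. -/
structure IsGalerkin {𝒢 : Mesh Ω} {l j : ℕ} (X : FESpaces 𝒢 l j)
    (S : Vec d → SymMat d → SymMat d) (f : Vec d → Vec d)
    (U : Vec d → Vec d) (P : Vec d → ℝ) : Prop where
  velocity_mem : U ∈ X.velocity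
  pressure_mem : P ∈ X.pressure
  pressure_mean : ∫ x in Ω, P x = 0
  momentum : ∀ V ∈ X.velocity,
    ∫ x in Ω, (inner ℝ (stress Ω S U x) (symGrad Ω V x : Mat d)
      + inner ℝ (convection Ω U x) (V x) - P x * divergence Ω V x)
    = ∫ x in Ω, inner ℝ (f x) (V x)
  incompressible : ∀ Q ∈ X.pressure, ∫ x in Ω, Q x * divergence Ω U x = 0

/-! ### The estimator -/

/-- The normal trace `(T|_K - q|_K id) ν_K` on the facet `F` of the element `K`. -/
noncomputable def normalTrace (K F : Finset (Vec d)) (T : Vec d → Mat d) (q : Vec d → ℝ)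
    (x : Vec d) : Vec d :=
  WithLp.toLp 2 fun i =>
    ∑ j, (polyOn K (fun y => T y (i, j)) x - if i = j then polyOn K q x else 0)
      * outerNormal K F j

open Classical in
/-- The normal jump of `T - q id` on the facet `F`: on a side, the sum of the normal traces from
the elements that contain it; zero on the boundary of `Ω`. -/
noncomputable def Mesh.jump (𝒢 : Mesh Ω) (T : Vec d → Mat d) (q : Vec d → ℝ)
    (F : Finset (Vec d)) (x : Vec d) : Vec d :=
  if 𝒢.IsSide F then ∑ K ∈ 𝒢.elems with F ⊆ K, normalTrace K F T q x else 0

/-- The local indicator of the momentum equation on the element `K`, where `T` is the stress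
field and `PT` its projection: element residual, normal jumps over `∂K` (with respect to the
surface measure), and projection error of the stress. -/
noncomputable def Mesh.indicatorPde (𝒢 : Mesh Ω) (tt : ℝ) (f : Vec d → Vec d)
    (U : Vec d → Vec d) (P : Vec d → ℝ) (T PT : Vec d → Mat d) (K : Finset (Vec d)) : ℝ≥0∞ :=
  (∫⁻ x in simplex K,
    ‖𝒢.h x • (-divOn K PT x + convection Ω U x + gradOn K P x - f x)‖ₑ ^ tt)
  + (∑ F ∈ K.powersetCard d, ∫⁻ x in simplex F,
      ‖𝒢.h x ^ (1 / tt) • 𝒢.jump PT P F x‖ₑ ^ tt ∂(Measure.euclideanHausdorffMeasure (d - 1)))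
  + ∫⁻ x in simplex K, ‖T x - PT x‖ₑ ^ tt

/-- The estimator of the momentum equation: the sum of the local indicators. -/
noncomputable def Mesh.estimatorPde (𝒢 : Mesh Ω) (tt : ℝ) (f : Vec d → Vec d)
    (U : Vec d → Vec d) (P : Vec d → ℝ) (T PT : Vec d → Mat d) : ℝ≥0∞ :=
  ∑ K ∈ 𝒢.elems, 𝒢.indicatorPde tt f U P T PT K

/-- The estimator of the incompressibility equation: `‖div U‖_t^t` over the union of the
elements. -/
noncomputable def Mesh.estimatorIc (𝒢 : Mesh Ω) (t : ℝ) (U : Vec d → Vec d) : ℝ≥0∞ :=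
  eLpNorm (divergence Ω U) (ENNReal.ofReal t)
    (volume.restrict (⋃ K ∈ 𝒢.elems, simplex K)) ^ t

end PowerLawFEM

/-! Momentum residual. By the Galerkin equation the residual vanishes on all continuous piecewise
affine fields that are zero outside `Ω`. For a smooth compactly supported `φ` with quasi-interpolant
`V` of this kind, the residual of `φ` is therefore that of `φ - V`. Write the stress as its
projection `T` plus the projection error and integrate `T - P id` by parts on every element. There
remain the projection error paired with `∇(φ - V)`, the element residual paired with `φ - V`, and
normal traces paired with `φ - V` on facets. The traces add up to jumps on the sides, and `φ - V`
vanishes on every other facet. Hölder's inequality, with powers of the element diameter moved from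
one factor to the other, and the interpolation estimates give the bound by `(ℰ^pde)^{1/t̃}
‖∇φ‖_{t̃'}` (`Mesh.exists_residual_le`). Density of smooth fields in `W^{1,t̃'}_0` finishes the
argument: a crude data-dependent continuity bound suffices for the small remainder.

Quasi-interpolation. The constant may depend on `σ`, `t̃` and `d` only, so everything is derived on
simplices with explicit constants. A simplex is the cone over each of its facets; this yields the
divergence theorem and a trace inequality. Integrating along segments yields a Poincaré inequality
on each simplex. In dimension at least two, the Poincaré constants of elements sharing a facet are
compared through that facet, and the comparison is carried along walks inside a vertex star. Three
geometric facts make this uniform (`Mesh.star_poincare_of_two_le`): the number of elements in a star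
is bounded by volume packing; elements of a star are linked by facets, because a Lipschitz domain is
locally connected at its boundary and a generic path avoids the codimension-two skeleton; and a
vertex outside `Ω` lies in an element of its star having a whole facet outside `Ω`, where `φ`
vanishes, so that zero is an admissible nodal value there. In dimension one point values of `φ` are
used instead.

Incompressibility residual. `U` is Lipschitz and vanishes outside `Ω`, so `div U` has mean value
zero and constants may be subtracted from the test function at no cost. Hölder's inequality gives
one bound, and the test function `-|g|^{t-2} g` with `g = div U` attains it
(`iSup_integral_div_eq`). -/

namespace PowerLawFEM

open Filter Topology

variable {d : ℕ} {Ω : Set (Vec d)}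

/-! ### Barycentric coordinates -/

/-- The vertex set of a nondegenerate `d`-simplex. -/
structure IsSimplex (K : Finset (Vec d)) : Prop where
  card_eq : K.card = d + 1
  affineIndependent : AffineIndependent ℝ ((↑) : K → Vec d)

theorem Mesh.isSimplex (𝒢 : Mesh Ω) {K : Finset (Vec d)} (hK : K ∈ 𝒢.elems) : IsSimplex K :=
  ⟨𝒢.card_eq K hK, 𝒢.affineIndependent K hK⟩

/-- The vertices of a simplex as an affine basis. -/
noncomputable def IsSimplex.basis {K : Finset (Vec d)} (hK : IsSimplex K) :
    AffineBasis K ℝ (Vec d) :=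
  ⟨(↑), hK.affineIndependent, by
    rw [hK.affineIndependent.affineSpan_eq_top_iff_card_eq_finrank_add_one]
    simp [hK.card_eq]⟩

@[simp] theorem IsSimplex.basis_apply {K : Finset (Vec d)} (hK : IsSimplex K) (z : K) :
    hK.basis z = z := rfl

open Classical in
/-- The barycentric coordinate of the simplex `K` belonging to the vertex `z`. -/
noncomputable def bary (K : Finset (Vec d)) (z : Vec d) : Vec d →ᵃ[ℝ] ℝ :=
  if h : IsSimplex K ∧ z ∈ K then h.1.basis.coord ⟨z, h.2⟩ else 0

section bary
variable {K : Finset (Vec d)}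

theorem bary_eq_coord (hK : IsSimplex K) (z : K) : bary K z = hK.basis.coord z := by
  rw [bary, dif_pos ⟨hK, z.2⟩]

theorem bary_eq_of_combination (hK : IsSimplex K) {w : Vec d → ℝ} (hw : ∑ z ∈ K, w z = 1)
    {z : Vec d} (hz : z ∈ K) : bary K z (∑ y ∈ K, w y • y) = w z := by
  have h1 := bary_eq_coord hK ⟨z, hz⟩
  have h2 := hK.basis.coord_apply_combination_of_mem (s := Finset.univ)
    (i := ⟨z, hz⟩) (Finset.mem_univ _) (w := fun y : K => w y)
    (by rw [Finset.sum_coe_sort K w]; exact hw)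
  rw [Finset.univ.affineCombination_eq_linear_combination _ _
    (by rw [Finset.sum_coe_sort K w]; exact hw)] at h2
  rw [h1, ← h2, ← Finset.sum_coe_sort K (fun y => w y • y)]
  rfl

theorem sum_bary (hK : IsSimplex K) (x : Vec d) : ∑ z ∈ K, bary K z x = 1 := by
  rw [← Finset.sum_coe_sort K (fun z => bary K z x), ← hK.basis.sum_coord_apply_eq_one x]
  exact Finset.sum_congr rfl fun z _ => by rw [bary_eq_coord hK]

theorem sum_bary_smul (hK : IsSimplex K) (x : Vec d) : ∑ z ∈ K, bary K z x • z = x := by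
  conv_rhs => rw [← hK.basis.linear_combination_coord_eq_self x]
  rw [← Finset.sum_coe_sort K (fun z => bary K z x • z)]
  exact Finset.sum_congr rfl fun z _ => by rw [bary_eq_coord hK]; rfl

theorem bary_self (hK : IsSimplex K) {z : Vec d} (hz : z ∈ K) : bary K z z = 1 := by
  rw [bary_eq_coord hK ⟨z, hz⟩]; exact hK.basis.coord_apply_eq ⟨z, hz⟩

theorem bary_of_ne (hK : IsSimplex K) {z w : Vec d} (hw : w ∈ K) (h : z ≠ w) :
    bary K z w = 0 := by
  by_cases hz : z ∈ K
  · rw [bary_eq_coord hK ⟨z, hz⟩]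
    exact hK.basis.coord_apply_ne (i := ⟨z, hz⟩) (j := ⟨w, hw⟩) (by simpa using h)
  · rw [bary, dif_neg (by tauto)]; rfl

theorem mem_simplex_iff (hK : IsSimplex K) {x : Vec d} :
    x ∈ simplex K ↔ ∀ z ∈ K, 0 ≤ bary K z x := by
  have h := hK.basis.convexHull_eq_nonneg_coord
  have hr : range hK.basis = (K : Set (Vec d)) := by
    ext y; simp [IsSimplex.basis_apply]
  rw [hr] at h
  rw [simplex, h, mem_ofPred_eq]
  constructor
  · intro hx z hz
    rw [bary_eq_coord hK ⟨z, hz⟩]; exact hx _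
  · intro hx z
    rw [← bary_eq_coord hK]; exact hx z z.2

theorem interior_simplex (hK : IsSimplex K) :
    interior (simplex K) = {x | ∀ z ∈ K, 0 < bary K z x} := by
  have h := hK.basis.interior_convexHull
  have hr : range hK.basis = (K : Set (Vec d)) := by
    ext y; simp [IsSimplex.basis_apply]
  rw [hr] at h
  rw [simplex, h]
  ext x
  constructor
  · intro hx z hz
    rw [bary_eq_coord hK ⟨z, hz⟩]; exact hx _
  · intro hx z
    rw [← bary_eq_coord hK]; exact hx z z.2

theorem bary_nonneg (hK : IsSimplex K) {x : Vec d} (hx : x ∈ simplex K) (z : Vec d) :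
    0 ≤ bary K z x := by
  by_cases hz : z ∈ K
  · exact (mem_simplex_iff hK).1 hx z hz
  · rw [bary, dif_neg (by tauto)]; rfl

theorem bary_le_one (hK : IsSimplex K) {x : Vec d} (hx : x ∈ simplex K) (z : Vec d) :
    bary K z x ≤ 1 := by
  by_cases hz : z ∈ K
  · rw [← sum_bary hK x]
    exact Finset.single_le_sum (f := fun z => bary K z x) (fun z _ => bary_nonneg hK hx z) hz
  · rw [bary, dif_neg (by tauto)]; exact zero_le_one

/-- Barycentric coordinates are compatible with passing to a subset of the vertices. -/
theorem exists_weights_of_mem_convexHull {G : Finset (Vec d)} {x : Vec d}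
    (hx : x ∈ convexHull ℝ (G : Set (Vec d))) :
    ∃ w : Vec d → ℝ, (∀ z, 0 ≤ w z) ∧ (∀ z ∉ G, w z = 0) ∧ ∑ z ∈ G, w z = 1 ∧
      ∑ z ∈ G, w z • z = x := by
  classical
  rw [Finset.mem_convexHull'] at hx
  obtain ⟨w, h0, h1, h2⟩ := hx
  refine ⟨fun z => if z ∈ G then w z else 0, fun z => ?_, fun z hz => by simp [hz], ?_, ?_⟩
  · by_cases hz : z ∈ G <;> simp [hz, h0]
  · rw [← h1]; exact Finset.sum_congr rfl fun z hz => by simp [hz]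
  · rw [← h2]; exact Finset.sum_congr rfl fun z hz => by simp [hz]

theorem bary_eq_weights (hK : IsSimplex K) {G : Finset (Vec d)} (hG : G ⊆ K) {w : Vec d → ℝ}
    (h0 : ∀ z ∉ G, w z = 0) (h1 : ∑ z ∈ G, w z = 1) {z : Vec d} (hz : z ∈ K) :
    bary K z (∑ y ∈ G, w y • y) = w z := by
  have e1 : ∑ y ∈ G, w y • y = ∑ y ∈ K, w y • y :=
    Finset.sum_subset hG fun y _ hy => by rw [h0 y hy, zero_smul]
  have e2 : ∑ y ∈ K, w y = 1 := by
    rw [← h1]; exact (Finset.sum_subset hG fun y _ hy => h0 y hy).symm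
  rw [e1, bary_eq_of_combination hK e2 hz]

/-- Uniqueness of barycentric coordinates: convex weights on `G`, extended by zero, are the
coordinates with respect to `K`. Conformity of the mesh is used through this criterion. -/
theorem mem_face_iff (hK : IsSimplex K) {G : Finset (Vec d)} (hG : G ⊆ K) {x : Vec d} :
    x ∈ convexHull ℝ (G : Set (Vec d)) ↔ x ∈ simplex K ∧ ∀ z ∈ K, z ∉ G → bary K z x = 0 := by
  constructor
  · intro hx
    refine ⟨convexHull_mono (by exact_mod_cast hG) hx, fun z hz hzG => ?_⟩
    obtain ⟨w, -, h0, h1, rfl⟩ := exists_weights_of_mem_convexHull hx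
    rw [bary_eq_weights hK hG h0 h1 hz, h0 z hzG]
  · rintro ⟨hx, h⟩
    rw [Finset.mem_convexHull']
    refine ⟨fun z => bary K z x, fun z _ => bary_nonneg hK hx z, ?_, ?_⟩
    · rw [← sum_bary hK x]
      exact Finset.sum_subset hG fun z hz hzG => h z hz hzG
    · conv_rhs => rw [← sum_bary_smul hK x]
      exact Finset.sum_subset hG fun z hz hzG => by beta_reduce; rw [h z hz hzG, zero_smul]

/-- Both sides are the convex weight of `z` in a representation of `x` by the common vertices `G`.
This makes nodal interpolation single-valued across elements. -/
theorem bary_eq_bary {L : Finset (Vec d)} (hK : IsSimplex K) (hL : IsSimplex L)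
    {G : Finset (Vec d)} (hGK : G ⊆ K) (hGL : G ⊆ L) {x : Vec d}
    (hx : x ∈ convexHull ℝ (G : Set (Vec d))) {z : Vec d} (hzK : z ∈ K) (hzL : z ∈ L) :
    bary K z x = bary L z x := by
  obtain ⟨w, -, h0, h1, rfl⟩ := exists_weights_of_mem_convexHull hx
  rw [bary_eq_weights hK hGK h0 h1 hzK, bary_eq_weights hL hGL h0 h1 hzL]

theorem continuous_bary (K : Finset (Vec d)) (z : Vec d) : Continuous (bary K z) :=
  (bary K z).continuous_of_finiteDimensional

/-- The gradient of a barycentric coordinate. -/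
noncomputable def baryGrad (K : Finset (Vec d)) (z : Vec d) : Vec d :=
  (InnerProductSpace.toDual ℝ (Vec d)).symm (LinearMap.toContinuousLinearMap (bary K z).linear)

theorem inner_baryGrad (K : Finset (Vec d)) (z e : Vec d) :
    inner ℝ (baryGrad K z) e = (bary K z).linear e := by
  rw [baryGrad, InnerProductSpace.toDual_symm_apply]; rfl

theorem bary_add (K : Finset (Vec d)) (z x e : Vec d) :
    bary K z (x + e) = bary K z x + inner ℝ (baryGrad K z) e := by
  rw [inner_baryGrad, add_comm x e, ← vadd_eq_add, AffineMap.map_vadd, vadd_eq_add, add_comm]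

theorem bary_sub_bary (K : Finset (Vec d)) (z x y : Vec d) :
    bary K z x - bary K z y = inner ℝ (baryGrad K z) (x - y) := by
  rw [inner_baryGrad, ← vsub_eq_sub x y, AffineMap.linearMap_vsub, vsub_eq_sub]

theorem bary_homothety (K : Finset (Vec d)) (z x y : Vec d) (s : ℝ) :
    bary K z (x + s • (y - x)) = (1 - s) * bary K z x + s * bary K z y := by
  rw [bary_add, inner_smul_right, ← bary_sub_bary]; ring

theorem sum_baryGrad (hK : IsSimplex K) : ∑ z ∈ K, baryGrad K z = 0 := by
  refine ext_inner_right ℝ fun e => ?_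
  rw [sum_inner, inner_zero_left]
  have h := sum_bary hK (0 + e)
  simp only [bary_add, Finset.sum_add_distrib, sum_bary hK] at h
  linarith

theorem sum_inner_baryGrad_smul (hK : IsSimplex K) (e : Vec d) :
    ∑ z ∈ K, (inner ℝ (baryGrad K z) e : ℝ) • z = e := by
  have h := sum_bary_smul hK (0 + e)
  simp only [bary_add, add_smul, Finset.sum_add_distrib, sum_bary_smul hK] at h
  simpa using h

/-- Between the ends of the diameter of the ball parallel to the gradient, the coordinate changes by
`2ρ` times the norm of the gradient, yet it stays in `[0, 1]` on the simplex. -/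
theorem norm_baryGrad_le (hK : IsSimplex K) {c : Vec d} {ρ : ℝ} (hρ : 0 < ρ)
    (hb : Metric.closedBall c ρ ⊆ simplex K) (z : Vec d) : ‖baryGrad K z‖ ≤ 1 / (2 * ρ) := by
  set g := baryGrad K z
  by_cases hg : g = 0
  · rw [hg, norm_zero]; positivity
  have hgn : 0 < ‖g‖ := norm_pos_iff.2 hg
  have hn : ‖(ρ / ‖g‖) • g‖ = ρ := by
    rw [norm_smul, Real.norm_of_nonneg (by positivity)]; field_simp
  have h1 : c + (ρ / ‖g‖) • g ∈ simplex K := hb (by simp [hn])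
  have h2 : c - (ρ / ‖g‖) • g ∈ simplex K := hb (by simp [hn])
  have h3 := bary_le_one hK h1 z
  have h4 := bary_nonneg hK h2 z
  have h5 := bary_sub_bary K z (c + (ρ / ‖g‖) • g) (c - (ρ / ‖g‖) • g)
  have h6 : c + (ρ / ‖g‖) • g - (c - (ρ / ‖g‖) • g) = (2 * (ρ / ‖g‖)) • g := by module
  rw [h6, inner_smul_right, real_inner_self_eq_norm_sq] at h5
  have h7 : 2 * (ρ / ‖g‖) * ‖g‖ ^ 2 = 2 * ρ * ‖g‖ := by field_simp
  rw [le_div_iff₀ (by positivity)]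
  nlinarith

theorem baryGrad_ne_zero (hd : 1 ≤ d) (hK : IsSimplex K) {z : Vec d} (hz : z ∈ K) :
    baryGrad K z ≠ 0 := by
  intro h
  have hc : 1 < K.card := by rw [hK.card_eq]; omega
  obtain ⟨w, hw, hwz⟩ := Finset.exists_mem_ne hc z
  have := bary_sub_bary K z z w
  rw [bary_self hK hz, bary_of_ne hK hw hwz.symm, h, inner_zero_left] at this
  norm_num at this

theorem isCompact_simplex (K : Finset (Vec d)) : IsCompact (simplex K) :=
  K.finite_toSet.isCompact_convexHull ℝ

theorem convex_simplex (K : Finset (Vec d)) : Convex ℝ (simplex K) := convex_convexHull ℝ _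

theorem isClosed_simplex (K : Finset (Vec d)) : IsClosed (simplex K) := (isCompact_simplex K).isClosed

theorem mem_simplex_of_mem {z : Vec d} (hz : z ∈ K) : z ∈ simplex K := subset_convexHull ℝ _ hz

theorem simplex_mono {F : Finset (Vec d)} (h : F ⊆ K) : simplex F ⊆ simplex K :=
  convexHull_mono (by exact_mod_cast h)

theorem measurableSet_simplex (K : Finset (Vec d)) : MeasurableSet (simplex K) :=
  (isClosed_simplex K).measurableSet

theorem norm_sub_le_diam {x y : Vec d} (hx : x ∈ simplex K) (hy : y ∈ simplex K) :
    ‖x - y‖ ≤ Metric.diam (simplex K) := by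
  rw [← dist_eq_norm]; exact Metric.dist_le_diam_of_mem (isCompact_simplex K).isBounded hx hy

theorem interior_simplex_nonempty (hK : IsSimplex K) : (interior (simplex K)).Nonempty := by
  have h := hK.basis.centroid_mem_interior_convexHull
  have hr : range hK.basis = (K : Set (Vec d)) := by
    ext y; simp [IsSimplex.basis_apply]
  rw [hr] at h
  exact ⟨_, h⟩

theorem volume_frontier_simplex (K : Finset (Vec d)) : volume (frontier (simplex K)) = 0 :=
  (convex_simplex K).addHaar_frontier _

theorem volume_simplex_lt_top (K : Finset (Vec d)) : volume (simplex K) < ⊤ :=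
  (isCompact_simplex K).measure_lt_top

theorem volume_simplex_pos (hK : IsSimplex K) : 0 < volume (simplex K) :=
  Measure.measure_pos_of_nonempty_interior _ (interior_simplex_nonempty hK)

theorem two_mul_le_diam (hd : 1 ≤ d) {c : Vec d} {ρ : ℝ} (hρ : 0 < ρ)
    (hb : Metric.closedBall c ρ ⊆ simplex K) : 2 * ρ ≤ Metric.diam (simplex K) := by
  let e : Vec d := EuclideanSpace.single ⟨0, hd⟩ 1
  have he : ‖ρ • e‖ = ρ := by simp [e, norm_smul, abs_of_pos hρ]
  have h1 : c + ρ • e ∈ simplex K := hb (by simp [he])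
  have h2 : c - ρ • e ∈ simplex K := hb (by simp [he])
  have h3 := norm_sub_le_diam h1 h2
  have h6 : c + ρ • e - (c - ρ • e) = (2 : ℝ) • (ρ • e) := by module
  rw [h6, norm_smul, he] at h3
  simpa using h3

/-- Distinct vertices of a simplex are at least an inscribed diameter apart. -/
theorem two_mul_le_norm_sub (hK : IsSimplex K) {c : Vec d} {ρ : ℝ} (hρ : 0 < ρ)
    (hb : Metric.closedBall c ρ ⊆ simplex K) {z w : Vec d} (hz : z ∈ K) (hw : w ∈ K)
    (h : z ≠ w) : 2 * ρ ≤ ‖z - w‖ := by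
  have h1 := bary_sub_bary K z z w
  rw [bary_self hK hz, bary_of_ne hK hw h, sub_zero] at h1
  have h2 := real_inner_le_norm (baryGrad K z) (z - w)
  have h3 := norm_baryGrad_le hK hρ hb z
  have h4 : 1 ≤ 1 / (2 * ρ) * ‖z - w‖ :=
    (h1.le.trans h2).trans (mul_le_mul_of_nonneg_right h3 (norm_nonneg _))
  rw [one_div, inv_mul_eq_div, le_div_iff₀ (by positivity)] at h4
  linarith

end bary

/-! ### Facets: the cone formula -/

section cone
variable {K : Finset (Vec d)} {v : Vec d}

open Classical in
theorem mem_facet_iff (hK : IsSimplex K) {x : Vec d} (hv : v ∈ K) :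
    x ∈ simplex (K.erase v) ↔ x ∈ simplex K ∧ bary K v x = 0 := by
  rw [simplex, mem_face_iff hK (K.erase_subset v)]
  refine and_congr_right fun _ => ⟨fun h => h v hv (by simp), fun h z hz hzv => ?_⟩
  have : z = v := by simpa [hz] using hzv
  rw [this, h]

open Classical in
-- The homothety with centre `v` and ratio `x` multiplies all other coordinates by `x` and raises
-- that of `v` from `0` to `1 - x`, so slices parallel to a facet are scaled copies of it. The set
-- `t` is carried along in order to identify measures later.
theorem slice_eq_homothety_image (hK : IsSimplex K) (hv : v ∈ K) {x : ℝ} (hx0 : 0 < x)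
    (hx1 : x ≤ 1) (t : Set (Vec d)) :
    t ∩ simplex K ∩ {y | bary K v y = 1 - x} =
      AffineMap.homothety v x '' (simplex (K.erase v) ∩ {y | v + x • (y - v) ∈ t}) := by
  ext y
  simp only [mem_inter_iff, mem_ofPred_eq, mem_image, AffineMap.homothety_apply, vsub_eq_sub,
    vadd_eq_add]
  constructor
  · rintro ⟨⟨hyt, hyK⟩, hy⟩
    have e1 : v + x • ((v + x⁻¹ • (y - v)) - v) = y := by
      rw [add_sub_cancel_left, smul_inv_smul₀ hx0.ne', add_sub_cancel]
    have e2 : bary K v (v + x⁻¹ • (y - v)) = 0 := by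
      rw [bary_homothety, bary_self hK hv, hy]; field_simp; ring
    refine ⟨v + x⁻¹ • (y - v), ⟨(mem_facet_iff hK hv).2 ⟨(mem_simplex_iff hK).2 fun z hz => ?_, e2⟩,
      by rw [e1]; exact hyt⟩, by rw [add_comm, e1]⟩
    by_cases hzv : z = v
    · rw [hzv, e2]
    · rw [bary_homothety, bary_of_ne hK hv hzv, mul_zero, zero_add]
      have := bary_nonneg hK hyK z
      positivity
  · rintro ⟨y', ⟨hy', hyt⟩, rfl⟩
    rw [add_comm]
    obtain ⟨h1, h2⟩ := (mem_facet_iff hK hv).1 hy'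
    refine ⟨⟨hyt, (mem_simplex_iff hK).2 fun z hz => ?_⟩, ?_⟩
    · rw [bary_homothety]
      have := bary_nonneg hK h1 z
      have := bary_nonneg hK (mem_simplex_of_mem hv) z
      have : 0 ≤ 1 - x := by linarith
      positivity
    · rw [bary_homothety, bary_self hK hv, h2]; ring

/-- The surface measure on a facet. -/
noncomputable abbrev facetMeasure (F : Finset (Vec d)) : Measure (Vec d) :=
  (Measure.euclideanHausdorffMeasure (d - 1)).restrict (simplex F)

open Classical in
-- Fubini in the direction normal to the facet opposite `v`: the slice at parameter `x` is the facet
-- scaled by `x`, which contributes `x ^ (d - 1)`, and `‖baryGrad K v‖⁻¹` is the height of the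
-- simplex over that facet.
theorem volume_inter_simplex (hd : 1 ≤ d) (hK : IsSimplex K) (hv : v ∈ K) {t : Set (Vec d)}
    (ht : MeasurableSet t) :
    volume (t ∩ simplex K) = ∫⁻ x in Ioc (0 : ℝ) 1,
      ENNReal.ofReal (‖baryGrad K v‖⁻¹ * x ^ (d - 1)) *
        facetMeasure (K.erase v) {y | v + x • (y - v) ∈ t} := by
  set g := baryGrad K v with hg
  have hg0 : g ≠ 0 := baryGrad_ne_zero hd hK hv
  have hgn : 0 < ‖g‖ := norm_pos_iff.2 hg0
  -- Normalised so that the coordinate of `v` falls by exactly one along `w`; its length is the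
  -- height.
  set w : Vec d := -((‖g‖ ^ 2)⁻¹ • g) with hw
  have hwg : inner ℝ g w = -1 := by
    rw [hw, inner_neg_right, inner_smul_right, real_inner_self_eq_norm_sq]; field_simp
  have hw0 : w ≠ 0 := by
    intro h; rw [h, inner_zero_right] at hwg; norm_num at hwg
  have hwn : ‖w‖ = ‖g‖⁻¹ := by
    rw [hw, norm_neg, norm_smul, Real.norm_of_nonneg (by positivity)]; field_simp
  have hslice : ∀ x : ℝ, (AffineSubspace.mk' (x • w +ᵥ v) (Submodule.span ℝ {w})ᗮ : Set (Vec d)) =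
      {y | bary K v y = 1 - x} := by
    intro x
    ext y
    rw [SetLike.mem_coe, AffineSubspace.mem_mk', Submodule.mem_orthogonal_singleton_iff_inner_right,
      mem_ofPred_eq, vsub_eq_sub, vadd_eq_add]
    have h1 := bary_sub_bary K v y v
    rw [bary_self hK hv, ← hg] at h1
    have h2 : inner ℝ w (y - (x • w + v)) = -(‖g‖ ^ 2)⁻¹ * (inner ℝ g (y - v) + x) := by
      have e : y - (x • w + v) = (y - v) - x • w := by abel
      rw [e]
      conv_lhs => rw [hw, inner_neg_left, real_inner_smul_left, ← hw, inner_sub_right,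
        inner_smul_right, hwg]
      ring
    rw [h2]
    have h3 : -(‖g‖ ^ 2)⁻¹ ≠ 0 := by simp [hg0]
    constructor
    · intro h
      have := (mul_eq_zero.1 h).resolve_left h3
      linarith
    · intro h
      rw [← h1, h]; ring
  have hvol := EuclideanGeometry.euclideanHausdorffMeasure_eq_lintegral v hw0
    (ht.inter (measurableSet_simplex K))
  rw [InnerProductSpace.euclideanHausdorffMeasure_eq_volume] at hvol
  simp only [finrank_euclideanSpace, Fintype.card_fin] at hvol
  rw [hvol, ← lintegral_const_mul' _ _ (by simp), ← lintegral_indicator measurableSet_Ioc]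
  refine lintegral_congr_ae ?_
  -- The homothety degenerates at ratio zero; that single parameter is negligible.
  have hne : ∀ᵐ x : ℝ, x ≠ 0 := by simp [ae_iff, measure_singleton]
  filter_upwards [hne] with x hx
  rw [hslice]
  by_cases hxI : x ∈ Ioc (0 : ℝ) 1
  · rw [indicator_of_mem hxI, slice_eq_homothety_image hK hv hxI.1 hxI.2,
      euclideanHausdorffMeasure_homothety_image _ _ hx, inter_comm, facetMeasure,
      Measure.restrict_apply' (measurableSet_simplex _), ENNReal.smul_def, smul_eq_mul, ← mul_assoc,
      ENNReal.ofReal_mul (by positivity), ← hwn, ofReal_norm]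
    congr 2
    push_cast
    rw [ENNReal.ofReal_pow hxI.1.le, ← Real.enorm_of_nonneg hxI.1.le]; rfl
  · rw [indicator_of_notMem hxI]
    have : simplex K ∩ {y | bary K v y = 1 - x} = ∅ := by
      ext y
      simp only [mem_inter_iff, mem_ofPred_eq, mem_empty_iff_false, iff_false, not_and]
      intro hy h
      have h0 := bary_nonneg hK hy v
      have h1 := bary_le_one hK hy v
      exact hxI ⟨lt_of_le_of_ne (by linarith) hx.symm, by linarith⟩
    rw [inter_assoc, this]; simp

open Classical in
-- The cone decomposition of the full simplex, with `∫₀¹ x ^ (d - 1) dx = 1 / d`.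
theorem volume_simplex_eq (hd : 1 ≤ d) (hK : IsSimplex K) (hv : v ∈ K) :
    volume (simplex K) = ENNReal.ofReal (‖baryGrad K v‖⁻¹ / d) *
      Measure.euclideanHausdorffMeasure (d - 1) (simplex (K.erase v)) := by
  have h := volume_inter_simplex hd hK hv MeasurableSet.univ
  simp only [univ_inter, mem_univ, ofPred_true, Measure.restrict_apply_univ] at h
  rw [h, lintegral_mul_const _ (by fun_prop)]
  congr 1
  have hint : IntegrableOn (fun x : ℝ => ‖baryGrad K v‖⁻¹ * x ^ (d - 1)) (Ioc 0 1) :=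
    (Continuous.integrableOn_Icc (by fun_prop)).mono_set Ioc_subset_Icc_self
  rw [← ofReal_integral_eq_lintegral_ofReal hint]
  · rw [← intervalIntegral.integral_of_le zero_le_one, intervalIntegral.integral_const_mul,
      integral_pow]
    congr 1
    have : ((d - 1 : ℕ) : ℝ) + 1 = d := by rw [Nat.cast_sub hd]; simp
    rw [this]
    simp [Nat.sub_add_cancel hd, show d ≠ 0 by omega]
    ring
  · filter_upwards [ae_restrict_mem measurableSet_Ioc] with x hx
    have := hx.1
    positivity

open Classical in
-- An infinite base with positive height would force infinite volume.
theorem facetMeasure_univ_lt_top (hd : 1 ≤ d) (hK : IsSimplex K) (hv : v ∈ K) :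
    facetMeasure (K.erase v) univ < ⊤ := by
  rw [Measure.restrict_apply_univ]
  have h := volume_simplex_eq hd hK hv
  have hg : 0 < ‖baryGrad K v‖ := norm_pos_iff.2 (baryGrad_ne_zero hd hK hv)
  by_contra htop
  rw [not_lt, top_le_iff] at htop
  rw [htop, ENNReal.mul_top (by
    rw [ne_eq, ENNReal.ofReal_eq_zero, not_le]
    have : (0 : ℝ) < d := by exact_mod_cast hd
    positivity)] at h
  exact (volume_simplex_lt_top K).ne h

theorem isFiniteMeasure_facetMeasure {F : Finset (Vec d)} (hd : 1 ≤ d) (hK : IsSimplex K)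
    (hFK : F ⊆ K) (hF : F.card = d) : IsFiniteMeasure (facetMeasure F) := by
  classical
  obtain ⟨v, hv⟩ : ∃ v, K \ F = {v} := by
    rw [← Finset.card_eq_one, Finset.card_sdiff_of_subset hFK, hK.card_eq, hF]; omega
  have hvK : v ∈ K := by
    have : v ∈ K \ F := by rw [hv]; simp
    exact (Finset.mem_sdiff.1 this).1
  have : F = K.erase v := by
    rw [Finset.erase_eq, ← hv, Finset.sdiff_sdiff_eq_self hFK]
  rw [this]
  exact ⟨facetMeasure_univ_lt_top hd hK hvK⟩

/-- The measure `τ^{d-1} H dτ` on `(0, 1]`, where `H` is the height over the facet opposite `v`. -/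
noncomputable def radialMeasure (K : Finset (Vec d)) (v : Vec d) : Measure ℝ :=
  (volume.restrict (Ioc (0 : ℝ) 1)).withDensity
    fun x => ENNReal.ofReal (‖baryGrad K v‖⁻¹ * x ^ (d - 1))

instance (K : Finset (Vec d)) (v : Vec d) : SFinite (radialMeasure K v) := by
  unfold radialMeasure; infer_instance

open Classical in
/-- The cone formula: a simplex is the cone over a facet with apex the opposite vertex. -/
theorem restrict_simplex_eq_map (hd : 1 ≤ d) (hK : IsSimplex K) (hv : v ∈ K) :
    volume.restrict (simplex K) = Measure.map (fun q : ℝ × Vec d => v + q.1 • (q.2 - v))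
      ((radialMeasure K v).prod (facetMeasure (K.erase v))) := by
  have : IsFiniteMeasure (facetMeasure (K.erase v)) := ⟨facetMeasure_univ_lt_top hd hK hv⟩
  ext t ht
  have hm : Measurable fun q : ℝ × Vec d => v + q.1 • (q.2 - v) := by fun_prop
  rw [Measure.restrict_apply ht, Measure.map_apply hm ht, Measure.prod_apply (hm ht),
    volume_inter_simplex hd hK hv ht, radialMeasure,
    lintegral_withDensity_eq_lintegral_mul _ (by fun_prop)
      (measurable_measure_prodMk_left (hm ht))]
  rfl

open Classical in
theorem lintegral_simplex_eq (hd : 1 ≤ d) (hK : IsSimplex K) (hv : v ∈ K) {G : Vec d → ℝ≥0∞}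
    (hG : Measurable G) :
    ∫⁻ x in simplex K, G x = ∫⁻ y, (∫⁻ τ in Ioc (0 : ℝ) 1,
      ENNReal.ofReal (‖baryGrad K v‖⁻¹ * τ ^ (d - 1)) * G (v + τ • (y - v)))
        ∂facetMeasure (K.erase v) := by
  have : IsFiniteMeasure (facetMeasure (K.erase v)) := ⟨facetMeasure_univ_lt_top hd hK hv⟩
  have hm : Measurable fun q : ℝ × Vec d => v + q.1 • (q.2 - v) := by fun_prop
  rw [restrict_simplex_eq_map hd hK hv, lintegral_map hG hm,
    lintegral_prod_symm' (fun q : ℝ × Vec d => G (v + q.1 • (q.2 - v))) (hG.comp hm)]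
  refine lintegral_congr fun y => ?_
  have h : Measurable fun τ : ℝ => G (v + τ • (y - v)) := hG.comp (by fun_prop)
  exact lintegral_withDensity_eq_lintegral_mul _ (by fun_prop) h

open Classical in
/-- The divergence theorem on a simplex for the field `ψ(x) (x - v)`. -/
theorem integral_radial (hd : 1 ≤ d) (hK : IsSimplex K) (hv : v ∈ K) {ψ : Vec d → ℝ}
    (hψ : ContDiff ℝ 1 ψ) :
    ∫ x in simplex K, (d * ψ x + fderiv ℝ ψ x (x - v)) =
      ‖baryGrad K v‖⁻¹ * ∫ y, ψ y ∂facetMeasure (K.erase v) := by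
  have : IsFiniteMeasure (facetMeasure (K.erase v)) := ⟨facetMeasure_univ_lt_top hd hK hv⟩
  have hm : Measurable fun q : ℝ × Vec d => v + q.1 • (q.2 - v) := by fun_prop
  have hψ' : Continuous fun x => fderiv ℝ ψ x := hψ.continuous_fderiv one_ne_zero
  have hψd : Differentiable ℝ ψ := hψ.differentiable one_ne_zero
  have hc : Continuous fun x => d * ψ x + fderiv ℝ ψ x (x - v) := by
    have := hψ.continuous
    fun_prop
  have hint : IntegrableOn (fun x => d * ψ x + fderiv ℝ ψ x (x - v)) (simplex K) :=
    hc.continuousOn.integrableOn_compact (isCompact_simplex K)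
  rw [IntegrableOn, restrict_simplex_eq_map hd hK hv, integrable_map_measure
    hc.aestronglyMeasurable hm.aemeasurable] at hint
  rw [restrict_simplex_eq_map hd hK hv, integral_map hm.aemeasurable hc.aestronglyMeasurable]
  have := integral_prod_symm _ hint
  simp only [Function.comp_def] at this
  rw [this, ← integral_const_mul]
  refine integral_congr_ae (Filter.Eventually.of_forall fun y => ?_)
  beta_reduce
  rw [radialMeasure, integral_withDensity_eq_integral_toReal_smul (by fun_prop)
    (Filter.Eventually.of_forall fun _ => ENNReal.ofReal_lt_top),
    ← intervalIntegral.integral_of_le zero_le_one]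
  -- On each ray the weighted integrand is the derivative of a multiple of `τ ^ d * ψ (v + τ • (y -
  -- v))`. Only the value at `τ = 1` survives, since `d ≥ 1` kills the one at `τ = 0`.
  have hder : ∀ τ ∈ uIcc (0 : ℝ) 1, HasDerivAt
      (fun τ : ℝ => ‖baryGrad K v‖⁻¹ * (τ ^ d * ψ (v + τ • (y - v))))
      ((ENNReal.ofReal (‖baryGrad K v‖⁻¹ * τ ^ (d - 1))).toReal •
        (d * ψ (v + τ • (y - v)) + fderiv ℝ ψ (v + τ • (y - v)) (v + τ • (y - v) - v))) τ := by
    intro τ hτ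
    rw [uIcc_of_le zero_le_one] at hτ
    have h0 := hτ.1
    have h1 : HasDerivAt (fun τ : ℝ => v + τ • (y - v)) (y - v) τ := by
      simpa using ((hasDerivAt_id τ).smul_const (y - v)).const_add v
    have h2 := (hψd (v + τ • (y - v))).hasFDerivAt.comp_hasDerivAt τ h1
    have h3 := ((hasDerivAt_pow d τ).mul h2).const_mul (‖baryGrad K v‖⁻¹)
    refine h3.congr_deriv ?_
    rw [ENNReal.toReal_ofReal (by positivity), add_sub_cancel_left, map_smul, smul_eq_mul,
      smul_eq_mul]
    have hp : τ ^ d = τ ^ (d - 1) * τ := by rw [← pow_succ, Nat.sub_add_cancel hd]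
    simp only [Function.comp_apply]
    rw [hp]; ring
  rw [intervalIntegral.integral_eq_sub_of_hasDerivAt hder]
  · simp [show d ≠ 0 by omega]
  · have hψc := hψ.continuous
    have : Continuous fun τ : ℝ => (ENNReal.ofReal (‖baryGrad K v‖⁻¹ * τ ^ (d - 1))).toReal •
        (d * ψ (v + τ • (y - v)) + fderiv ℝ ψ (v + τ • (y - v)) (v + τ • (y - v) - v)) := by
      have e : ∀ τ : ℝ, (ENNReal.ofReal (‖baryGrad K v‖⁻¹ * τ ^ (d - 1))).toReal =
        max (‖baryGrad K v‖⁻¹ * τ ^ (d - 1)) 0 := fun τ => ENNReal.toReal_ofReal' 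
      simp only [e]
      fun_prop
    exact this.intervalIntegrable _ _

/-- The coordinate of `v` is zero on the opposite facet and nonnegative on the simplex, so its
gradient points inwards. -/
theorem isOuterNormal_neg_baryGrad (hd : 1 ≤ d) (hK : IsSimplex K) (hv : v ∈ K) [DecidableEq (Vec d)] :
    IsOuterNormal K (K.erase v) (-(‖baryGrad K v‖⁻¹ • baryGrad K v)) := by
  have hg : 0 < ‖baryGrad K v‖ := norm_pos_iff.2 (baryGrad_ne_zero hd hK hv)
  have key : ∀ x y : Vec d, inner ℝ (y - x) (-(‖baryGrad K v‖⁻¹ • baryGrad K v)) =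
      ‖baryGrad K v‖⁻¹ * (bary K v x - bary K v y) := by
    intro x y
    rw [inner_neg_right, inner_smul_right, real_inner_comm, ← bary_sub_bary]; ring
  refine ⟨by rw [norm_neg, norm_smul, norm_inv, norm_norm]; field_simp, fun x hx => ⟨fun y hy => ?_,
    fun y hy => ?_⟩⟩
  · rw [key]
    have h1 := ((mem_facet_iff hK hv).1 (by convert hx)).2
    have h2 := ((mem_facet_iff hK hv).1 (by convert hy)).2
    rw [h1, h2]; simp
  · rw [key]
    have h1 := ((mem_facet_iff hK hv).1 (by convert hx)).2
    have h2 := bary_nonneg hK hy v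
    rw [h1]
    have : 0 ≤ ‖baryGrad K v‖⁻¹ := by positivity
    nlinarith

/-- `outerNormal` is a choice, so uniqueness is needed. A normal `ν` is determined by its products
with the edges from a facet vertex; these vanish except towards `v`, so `ν` is a nonpositive
multiple of `baryGrad K v`, and its length is one. -/
theorem outerNormal_eq (hd : 1 ≤ d) (hK : IsSimplex K) (hv : v ∈ K) [DecidableEq (Vec d)] :
    outerNormal K (K.erase v) = -(‖baryGrad K v‖⁻¹ • baryGrad K v) := by
  have hg : 0 < ‖baryGrad K v‖ := norm_pos_iff.2 (baryGrad_ne_zero hd hK hv)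
  have hex : ∃ ν, IsOuterNormal K (K.erase v) ν := ⟨_, isOuterNormal_neg_baryGrad hd hK hv⟩
  rw [outerNormal, dif_pos hex]
  obtain ⟨hn, hF⟩ := hex.choose_spec
  set ν := hex.choose
  obtain ⟨x, hx⟩ : (K.erase v).Nonempty := by
    rw [← Finset.card_pos, Finset.card_erase_of_mem hv, hK.card_eq]; omega
  obtain ⟨h1, h2⟩ := hF x (mem_simplex_of_mem hx)
  set c : ℝ := inner ℝ (v - x) ν with hc
  have hc0 : c ≤ 0 := h2 v (mem_simplex_of_mem hv)
  have hval : ∀ z ∈ K, (inner ℝ (z - x) ν : ℝ) = c * bary K v z := by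
    intro z hz
    by_cases hzv : z = v
    · rw [hzv, bary_self hK hv, mul_one]
    · rw [h1 z (mem_simplex_of_mem (Finset.mem_erase.2 ⟨hzv, hz⟩)),
        bary_of_ne hK hz (Ne.symm hzv), mul_zero]
  have hν : ν = c • baryGrad K v := by
    refine ext_inner_right ℝ fun e => ?_
    have he : ∑ z ∈ K, (inner ℝ (baryGrad K z) e : ℝ) • (z - x) = e := by
      simp only [smul_sub, Finset.sum_sub_distrib, sum_inner_baryGrad_smul hK, ← Finset.sum_smul,
        ← sum_inner, sum_baryGrad hK, inner_zero_left, zero_smul, sub_zero]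
    have h3 : (inner ℝ e ν : ℝ) = c * inner ℝ (baryGrad K v) e := by
      conv_lhs => rw [← he, sum_inner]
      have h4 : ∀ z ∈ K, inner ℝ ((inner ℝ (baryGrad K z) e : ℝ) • (z - x)) ν =
          if z = v then c * inner ℝ (baryGrad K v) e else 0 := by
        intro z hz
        rw [real_inner_smul_left, hval z hz]
        split_ifs with hzv
        · rw [hzv, bary_self hK hv]; ring
        · rw [bary_of_ne hK hz (Ne.symm hzv)]; ring
      rw [Finset.sum_congr rfl h4, Finset.sum_ite_eq' K v, if_pos hv]
    rw [real_inner_comm, h3, real_inner_smul_left]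
  have hcn : -c * ‖baryGrad K v‖ = 1 := by
    rw [← hn, hν, norm_smul, Real.norm_of_nonpos hc0]
  have : c = -‖baryGrad K v‖⁻¹ := by field_simp; linarith
  rw [hν, this, neg_smul]

open Classical in
/-- The divergence theorem on a simplex. -/
theorem integral_fderiv_simplex (hd : 1 ≤ d) (hK : IsSimplex K) {ψ : Vec d → ℝ}
    (hψ : ContDiff ℝ 1 ψ) (e : Vec d) :
    ∫ x in simplex K, fderiv ℝ ψ x e =
      ∑ v ∈ K, inner ℝ (outerNormal K (K.erase v)) e * ∫ y, ψ y ∂facetMeasure (K.erase v) := by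
  have hψ' : Continuous fun x => fderiv ℝ ψ x := hψ.continuous_fderiv one_ne_zero
  have hψc := hψ.continuous
  -- The radial identities of all vertices are combined with weights `-∇λ_v · e`, `λ_v` being the
  -- coordinate of `v`. The weights sum to zero, which removes `d * ψ`, and `∑ (∇λ_v · e) (x - v) =
  -- -e` leaves the derivative in direction `e`.
  have h1 : ∀ v ∈ K, inner ℝ (outerNormal K (K.erase v)) e * ∫ y, ψ y ∂facetMeasure (K.erase v) =
      ∫ x in simplex K, -(inner ℝ (baryGrad K v) e * (d * ψ x + fderiv ℝ ψ x (x - v))) := by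
    intro v hv
    rw [integral_neg, integral_const_mul, integral_radial hd hK hv hψ, outerNormal_eq hd hK hv,
      inner_neg_left, real_inner_smul_left]
    ring
  rw [Finset.sum_congr rfl h1, ← integral_finsetSum]
  · refine integral_congr_ae (Filter.Eventually.of_forall fun x => ?_)
    beta_reduce
    have h2 : ∑ v ∈ K, (inner ℝ (baryGrad K v) e : ℝ) = 0 := by
      rw [← sum_inner, sum_baryGrad hK, inner_zero_left]
    have h3 : ∑ v ∈ K, (inner ℝ (baryGrad K v) e : ℝ) • (x - v) = -e := by
      simp only [smul_sub, Finset.sum_sub_distrib, sum_inner_baryGrad_smul hK, ← Finset.sum_smul,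
        h2, zero_smul, zero_sub]
    rw [Finset.sum_neg_distrib]
    simp only [mul_add, Finset.sum_add_distrib, ← Finset.sum_mul, h2, zero_mul, zero_add]
    have h4 : ∑ v ∈ K, (inner ℝ (baryGrad K v) e : ℝ) * fderiv ℝ ψ x (x - v) =
        fderiv ℝ ψ x (∑ v ∈ K, (inner ℝ (baryGrad K v) e : ℝ) • (x - v)) := by
      rw [map_sum]; simp
    rw [h4, h3, map_neg, neg_neg]
  · intro v _
    refine (Continuous.continuousOn ?_).integrableOn_compact (isCompact_simplex K)
    fun_prop

end cone

/-! ### Trace and Poincaré inequalities on simplices -/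

section inequalities
variable {E : Type*} [NormedAddCommGroup E] [NormedSpace ℝ E] [CompleteSpace E]

theorem enorm_sub_le_lintegral_segment {f : Vec d → E} (hf : ContDiff ℝ 1 f) (x e : Vec d)
    {a b : ℝ} (hab : a ≤ b) :
    ‖f (x + b • e) - f (x + a • e)‖ₑ ≤ ‖e‖ₑ * ∫⁻ s in Ioc a b, ‖fderiv ℝ f (x + s • e)‖ₑ := by
  have hf' : Continuous fun x => fderiv ℝ f x := hf.continuous_fderiv one_ne_zero
  have hfd : Differentiable ℝ f := hf.differentiable one_ne_zero
  have hder : ∀ s ∈ uIcc a b, HasDerivAt (fun s : ℝ => f (x + s • e))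
      (fderiv ℝ f (x + s • e) e) s := by
    intro s _
    have h1 : HasDerivAt (fun s : ℝ => x + s • e) e s := by
      simpa using ((hasDerivAt_id s).smul_const e).const_add x
    exact (hfd (x + s • e)).hasFDerivAt.comp_hasDerivAt s h1
  have hc : Continuous fun s : ℝ => fderiv ℝ f (x + s • e) e := by fun_prop
  rw [← intervalIntegral.integral_eq_sub_of_hasDerivAt hder (hc.intervalIntegrable _ _),
    intervalIntegral.integral_of_le hab, ← lintegral_const_mul' _ _ (by simp)]
  refine (enorm_integral_le_lintegral_enorm _).trans (lintegral_mono fun s => ?_)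
  rw [mul_comm]
  exact ContinuousLinearMap.le_opENorm _ _

/-- Hölder against the constant one; total mass at most one keeps the constant equal to one. -/
theorem rpow_lintegral_le {α : Type*} [MeasurableSpace α] {μ : Measure α} (hμ : μ univ ≤ 1) {p : ℝ}
    (hp : 1 < p) {g : α → ℝ≥0∞} (hg : AEMeasurable g μ) :
    (∫⁻ a, g a ∂μ) ^ p ≤ ∫⁻ a, g a ^ p ∂μ := by
  have h := ENNReal.lintegral_mul_le_Lp_mul_Lq μ (Real.HolderConjugate.conjExponent hp) hg
    (aemeasurable_const (b := (1 : ℝ≥0∞)))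
  simp only [Pi.mul_apply, mul_one, ENNReal.one_rpow, lintegral_const, one_mul] at h
  have hq : 0 < p.conjExponent := (Real.HolderConjugate.conjExponent hp).symm.pos
  have h2 : μ univ ^ (1 / p.conjExponent) ≤ 1 := by
    refine (ENNReal.rpow_le_rpow hμ (by positivity)).trans ?_
    simp
  have h3 : (∫⁻ a, g a ∂μ) ≤ (∫⁻ a, g a ^ p ∂μ) ^ (1 / p) :=
    h.trans (mul_le_of_le_one_right' h2)
  calc (∫⁻ a, g a ∂μ) ^ p ≤ ((∫⁻ a, g a ^ p ∂μ) ^ (1 / p)) ^ p :=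
        ENNReal.rpow_le_rpow h3 (by positivity)
    _ = _ := by rw [← ENNReal.rpow_mul, one_div_mul_cancel (by positivity), ENNReal.rpow_one]

/-- The value at `y` is compared with the value at each point of the outer half of the ray from `v`
to `y`, and the comparison is averaged. Staying away from the apex keeps the cone weight `τ ^ (d -
1)` bounded below. Averaging over length `1 / 2` costs a factor `2`, so the constant is `2 * 2 ^ (p
- 1)`. -/
theorem enorm_rpow_le_lintegral_ray {f : Vec d → E} (hf : ContDiff ℝ 1 f) {p : ℝ} (hp : 1 < p)
    (v y : Vec d) {h : ℝ≥0∞} (hh : ‖y - v‖ₑ ≤ h) :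
    ‖f y‖ₑ ^ p ≤ 2 ^ p * ∫⁻ τ in Ioc (1 / 2 : ℝ) 1,
      (‖f (v + τ • (y - v))‖ₑ ^ p + h ^ p * ‖fderiv ℝ f (v + τ • (y - v))‖ₑ ^ p) := by
  have hf' : Continuous fun x => fderiv ℝ f x := hf.continuous_fderiv one_ne_zero
  have hfc := hf.continuous
  set I : Set ℝ := Ioc (1 / 2 : ℝ) 1
  have hI : (volume.restrict I) univ = 1 / 2 := by
    simp only [I, Measure.restrict_apply_univ, Real.volume_Ioc]
    rw [show (1 : ℝ) - 1 / 2 = 1 / 2 by norm_num, ENNReal.ofReal_div_of_pos (by norm_num)]; simp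
  set J : ℝ≥0∞ := ∫⁻ τ in I, ‖fderiv ℝ f (v + τ • (y - v))‖ₑ ^ p
  have h1 : ∀ τ ∈ I, ‖f y‖ₑ ^ p ≤ 2 ^ (p - 1) * (‖f (v + τ • (y - v))‖ₑ ^ p + h ^ p * J) := by
    intro τ hτ
    have e1 : ‖f y‖ₑ ≤ ‖f (v + τ • (y - v))‖ₑ +
        h * ∫⁻ s in I, ‖fderiv ℝ f (v + s • (y - v))‖ₑ := by
      have e2 := enorm_sub_le_lintegral_segment hf v (y - v) hτ.2
      rw [one_smul, add_sub_cancel] at e2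
      calc ‖f y‖ₑ = ‖f (v + τ • (y - v)) + (f y - f (v + τ • (y - v)))‖ₑ := by
            rw [add_sub_cancel]
        _ ≤ ‖f (v + τ • (y - v))‖ₑ + ‖f y - f (v + τ • (y - v))‖ₑ := enorm_add_le _ _
        _ ≤ _ := by
          gcongr
          refine e2.trans ?_
          gcongr
          exact Ioc_subset_Ioc_left hτ.1.le
    calc ‖f y‖ₑ ^ p ≤ (‖f (v + τ • (y - v))‖ₑ +
          h * ∫⁻ s in I, ‖fderiv ℝ f (v + s • (y - v))‖ₑ) ^ p :=
          ENNReal.rpow_le_rpow e1 (by positivity)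
      _ ≤ 2 ^ (p - 1) * (‖f (v + τ • (y - v))‖ₑ ^ p +
          (h * ∫⁻ s in I, ‖fderiv ℝ f (v + s • (y - v))‖ₑ) ^ p) :=
          ENNReal.rpow_add_le_mul_rpow_add_rpow _ _ hp.le
      _ ≤ _ := by
        gcongr
        rw [ENNReal.mul_rpow_of_nonneg _ _ (by positivity)]
        gcongr
        refine rpow_lintegral_le ?_ hp ?_
        · rw [hI]; simp
        · exact Continuous.aemeasurable (by fun_prop)
  have h2 : ∫⁻ τ in I, ‖f y‖ₑ ^ p ≤
      ∫⁻ τ in I, 2 ^ (p - 1) * (‖f (v + τ • (y - v))‖ₑ ^ p + h ^ p * J) :=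
    setLIntegral_mono' measurableSet_Ioc h1
  rw [lintegral_const, hI, lintegral_const_mul' _ _ (by simp), lintegral_add_right _ (by fun_prop),
    lintegral_const, hI] at h2
  have hm : Measurable fun τ : ℝ => ‖fderiv ℝ f (v + τ • (y - v))‖ₑ ^ p := by
    have : Continuous fun τ : ℝ => ‖fderiv ℝ f (v + τ • (y - v))‖ₑ := by fun_prop
    exact this.measurable.pow_const _
  rw [lintegral_add_right _ (hm.const_mul _), lintegral_const_mul _ hm]
  calc ‖f y‖ₑ ^ p = 2 * (‖f y‖ₑ ^ p * (1 / 2)) := by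
        rw [mul_comm (‖f y‖ₑ ^ p), ← mul_assoc, one_div, ENNReal.mul_inv_cancel (by simp) (by simp),
          one_mul]
    _ ≤ 2 * (2 ^ (p - 1) * ((∫⁻ τ in I, ‖f (v + τ • (y - v))‖ₑ ^ p) + h ^ p * J * (1 / 2))) := by
        gcongr
    _ ≤ 2 * (2 ^ (p - 1) * ((∫⁻ τ in I, ‖f (v + τ • (y - v))‖ₑ ^ p) + h ^ p * J)) := by
        gcongr 2 * (2 ^ (p - 1) * (_ + ?_))
        exact mul_le_of_le_one_right' (by rw [one_div]; exact ENNReal.inv_le_one.2 (by norm_num))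
    _ = _ := by
        rw [← mul_assoc]
        congr 1
        conv_lhs => rw [← ENNReal.rpow_one 2, ← ENNReal.rpow_mul]
        rw [one_mul, ← ENNReal.rpow_add _ _ (by simp) (by simp)]
        congr 1; ring

variable {K : Finset (Vec d)} {v : Vec d}

theorem enorm_sub_le_ofReal_diam {x y : Vec d} (hx : x ∈ simplex K) (hy : y ∈ simplex K) :
    ‖x - y‖ₑ ≤ ENNReal.ofReal (Metric.diam (simplex K)) := by
  rw [← ofReal_norm]; exact ENNReal.ofReal_le_ofReal (norm_sub_le_diam hx hy)

open Classical in
/-- The trace inequality for a facet of a simplex. -/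
theorem lintegral_facet_le (hd : 1 ≤ d) (hK : IsSimplex K) (hv : v ∈ K) {f : Vec d → E}
    (hf : ContDiff ℝ 1 f) {p : ℝ} (hp : 1 < p) :
    ∫⁻ y, ‖f y‖ₑ ^ p ∂facetMeasure (K.erase v) ≤ 2 ^ p * 2 ^ d * ‖baryGrad K v‖ₑ *
      ((∫⁻ x in simplex K, ‖f x‖ₑ ^ p) + ENNReal.ofReal (Metric.diam (simplex K)) ^ p *
        ∫⁻ x in simplex K, ‖fderiv ℝ f x‖ₑ ^ p) := by
  have hf' : Continuous fun x => fderiv ℝ f x := hf.continuous_fderiv one_ne_zero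
  have hfc := hf.continuous
  have hg : 0 < ‖baryGrad K v‖ := norm_pos_iff.2 (baryGrad_ne_zero hd hK hv)
  set h := ENNReal.ofReal (Metric.diam (simplex K))
  set G : Vec d → ℝ≥0∞ := fun x => ‖f x‖ₑ ^ p + h ^ p * ‖fderiv ℝ f x‖ₑ ^ p with hG
  have hm1 : Measurable fun x => ‖f x‖ₑ ^ p :=
    (Continuous.measurable (by fun_prop : Continuous fun x => ‖f x‖ₑ)).pow_const _
  have hm2 : Measurable fun x => ‖fderiv ℝ f x‖ₑ ^ p :=
    (Continuous.measurable (by fun_prop : Continuous fun x => ‖fderiv ℝ f x‖ₑ)).pow_const _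
  have hGm : Measurable G := hm1.add (hm2.const_mul _)
  have hsum : (∫⁻ x in simplex K, ‖f x‖ₑ ^ p) + h ^ p * ∫⁻ x in simplex K, ‖fderiv ℝ f x‖ₑ ^ p =
      ∫⁻ x in simplex K, G x := by
    rw [hG, lintegral_add_left hm1, lintegral_const_mul _ hm2]
  rw [hsum, lintegral_simplex_eq hd hK hv hGm, ← lintegral_const_mul' _ _
    (by finiteness)]
  refine setLIntegral_mono_ae' (measurableSet_simplex _) (Filter.Eventually.of_forall fun y hy => ?_)
  have hyK := ((mem_facet_iff hK hv).1 hy).1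
  refine (enorm_rpow_le_lintegral_ray hf hp v y
    (enorm_sub_le_ofReal_diam hyK (mem_simplex_of_mem hv))).trans ?_
  rw [mul_assoc, mul_assoc]
  gcongr 2 ^ p * ?_
  rw [← mul_assoc, ← lintegral_const_mul' _ _ (by finiteness)]
  -- For `τ > 1 / 2` the inserted factor equals `2 * (2 * τ) ^ (d - 1)`, which is at least one.
  calc ∫⁻ τ in Ioc (1 / 2 : ℝ) 1, G (v + τ • (y - v))
      ≤ ∫⁻ τ in Ioc (1 / 2 : ℝ) 1, 2 ^ d * ‖baryGrad K v‖ₑ *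
        (ENNReal.ofReal (‖baryGrad K v‖⁻¹ * τ ^ (d - 1)) * G (v + τ • (y - v))) := by
        refine setLIntegral_mono' measurableSet_Ioc fun τ hτ => ?_
        rw [← mul_assoc]
        refine le_mul_of_one_le_left' ?_
        have h0 : (0 : ℝ) < τ := lt_trans (by norm_num) hτ.1
        have e2 : (2 : ℝ≥0∞) ^ d = ENNReal.ofReal (2 ^ d) := by
          rw [ENNReal.ofReal_pow (by norm_num)]; simp
        rw [← ofReal_norm, e2, ← ENNReal.ofReal_mul (by positivity),
          ← ENNReal.ofReal_mul (by positivity), ← ENNReal.ofReal_one]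
        refine ENNReal.ofReal_le_ofReal ?_
        have e : 2 ^ d * ‖baryGrad K v‖ * (‖baryGrad K v‖⁻¹ * τ ^ (d - 1)) = 2 ^ d * τ ^ (d - 1) := by
          field_simp
        rw [e]
        calc (1 : ℝ) ≤ 2 * (2 * τ) ^ (d - 1) := by
              have : (1 : ℝ) ≤ (2 * τ) ^ (d - 1) := one_le_pow₀ (by linarith [hτ.1])
              linarith
          _ = _ := by
              rw [mul_pow, ← mul_assoc, ← pow_succ', Nat.sub_add_cancel hd]
    _ ≤ _ := lintegral_mono_set (Ioc_subset_Ioc_left (by norm_num))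

theorem lintegral_comp_add_smul (F : Vec d → ℝ≥0∞) (hF : Measurable F) (a : Vec d) {t : ℝ}
    (ht : t ≠ 0) :
    ∫⁻ x, F (a + t • x) = ENNReal.ofReal |(t ^ d)⁻¹| * ∫⁻ x, F x := by
  have h1 : ∫⁻ x, F (a + t • x) = ∫⁻ x, F (a + x) ∂(Measure.map (t • ·) (volume : Measure (Vec d))) :=
    (lintegral_map (f := fun x => F (a + x)) (g := fun x => t • x) (hF.comp (by fun_prop))
      (by fun_prop)).symm
  rw [h1, Measure.map_addHaar_smul _ ht, lintegral_smul_measure,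
    lintegral_add_left_eq_self (fun x => F x) a]
  simp

/-- Contraction towards `y` maps the convex simplex into itself and has Jacobian `t ^ d ≥ 2⁻ᵈ`. -/
theorem lintegral_simplex_comp_le {g : Vec d → ℝ≥0∞} (hg : Measurable g) {y : Vec d}
    (hy : y ∈ simplex K) {t : ℝ} (ht : 1 / 2 ≤ t) (ht1 : t ≤ 1) :
    ∫⁻ x in simplex K, g (y + t • (x - y)) ≤ 2 ^ d * ∫⁻ x in simplex K, g x := by
  have ht0 : 0 < t := lt_of_lt_of_le (by norm_num) ht
  have hgm := hg.indicator (measurableSet_simplex K)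
  calc ∫⁻ x in simplex K, g (y + t • (x - y))
      ≤ ∫⁻ x in simplex K, (simplex K).indicator g ((y - t • y) + t • x) := by
        refine setLIntegral_mono' (measurableSet_simplex K) fun x hx => ?_
        have e : (y - t • y) + t • x = y + t • (x - y) := by module
        rw [e, indicator_of_mem]
        exact (convex_simplex K).add_smul_sub_mem hy hx ⟨ht0.le, ht1⟩
    _ ≤ ∫⁻ x, (simplex K).indicator g ((y - t • y) + t • x) := setLIntegral_le_lintegral _ _
    _ = ENNReal.ofReal |(t ^ d)⁻¹| * ∫⁻ x in simplex K, g x := by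
        rw [lintegral_comp_add_smul _ hgm _ ht0.ne', lintegral_indicator (measurableSet_simplex K)]
    _ ≤ _ := by
        gcongr
        rw [abs_of_pos (by positivity), ← inv_pow, ENNReal.ofReal_pow (by positivity)]
        gcongr
        rw [show (2 : ℝ≥0∞) = ENNReal.ofReal 2 by simp]
        refine ENNReal.ofReal_le_ofReal ?_
        rw [inv_le_comm₀ ht0 (by norm_num)]
        linarith

/-- The Poincaré inequality on a simplex. -/
theorem exists_poincare_const (hK : IsSimplex K) {f : Vec d → E} (hf : ContDiff ℝ 1 f) {p : ℝ}
    (hp : 1 < p) :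
    ∃ c : E, ∫⁻ x in simplex K, ‖f x - c‖ₑ ^ p ≤
      2 ^ d * ENNReal.ofReal (Metric.diam (simplex K)) ^ p *
        ∫⁻ x in simplex K, ‖fderiv ℝ f x‖ₑ ^ p := by
  have hf' : Continuous fun x => fderiv ℝ f x := hf.continuous_fderiv one_ne_zero
  have hfc := hf.continuous
  set h := ENNReal.ofReal (Metric.diam (simplex K))
  set g : Vec d → ℝ≥0∞ := fun x => ‖fderiv ℝ f x‖ₑ ^ p with hgdef
  have hg : Measurable g :=
    (Continuous.measurable (by fun_prop : Continuous fun x => ‖fderiv ℝ f x‖ₑ)).pow_const _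
  have hsm := measurableSet_simplex K
  have hgJ : Measurable fun q : (Vec d × Vec d) × ℝ => g (q.1.1 + q.2 • (q.1.2 - q.1.1)) :=
    hg.comp (by fun_prop)
  have h1 : ∀ y ∈ simplex K, ∀ x ∈ simplex K, ‖f x - f y‖ₑ ^ p ≤
      h ^ p * ∫⁻ t in Ioc (0 : ℝ) 1, g (y + t • (x - y)) := by
    intro y hy x hx
    have e2 := enorm_sub_le_lintegral_segment hf y (x - y) (zero_le_one (α := ℝ))
    rw [one_smul, zero_smul, add_zero, add_sub_cancel] at e2
    calc ‖f x - f y‖ₑ ^ p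
        ≤ (h * ∫⁻ s in Ioc (0 : ℝ) 1, ‖fderiv ℝ f (y + s • (x - y))‖ₑ) ^ p := by
          refine ENNReal.rpow_le_rpow (e2.trans ?_) (by positivity)
          gcongr
          exact enorm_sub_le_ofReal_diam hx hy
      _ ≤ _ := by
          rw [ENNReal.mul_rpow_of_nonneg _ _ (by positivity)]
          gcongr
          refine rpow_lintegral_le (by simp) hp ?_
          exact Continuous.aemeasurable (by fun_prop)
  set A := ∫⁻ x in simplex K, g x
  have hdouble : ∫⁻ y in simplex K, ∫⁻ x in simplex K, ∫⁻ t in Ioc (0 : ℝ) 1, g (y + t • (x - y)) ≤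
      2 ^ d * A * volume (simplex K) := by
    have s1 : ∀ t ∈ Ioc (0 : ℝ) 1,
        ∫⁻ y in simplex K, ∫⁻ x in simplex K, g (y + t • (x - y)) ≤
          2 ^ d * A * volume (simplex K) := by
      intro t ht
      -- The point on the segment is a contraction with ratio `t` in `x` and with ratio `1 - t` in
      -- `y`. One ratio is at least `1 / 2`, and that variable is integrated first.
      by_cases ht2 : 1 / 2 ≤ t
      · calc _ ≤ ∫⁻ y in simplex K, 2 ^ d * A :=
              setLIntegral_mono' hsm fun y hy => lintegral_simplex_comp_le hg hy ht2 ht.2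
          _ = _ := by rw [setLIntegral_const]
      · rw [lintegral_lintegral_swap]
        · calc _ ≤ ∫⁻ y in simplex K, 2 ^ d * A := by
                refine setLIntegral_mono' hsm fun x hx => ?_
                have := lintegral_simplex_comp_le hg hx (t := 1 - t) (by linarith)
                  (by linarith [ht.1])
                refine le_trans (le_of_eq (lintegral_congr fun y => ?_)) this
                congr 1; module
            _ = _ := by rw [setLIntegral_const]
        · exact Measurable.aemeasurable (hg.comp (by fun_prop))
    have s2 : ∀ y : Vec d, ∫⁻ x in simplex K, ∫⁻ t in Ioc (0 : ℝ) 1, g (y + t • (x - y)) =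
        ∫⁻ t in Ioc (0 : ℝ) 1, ∫⁻ x in simplex K, g (y + t • (x - y)) := by
      intro y
      rw [lintegral_lintegral_swap]
      exact Measurable.aemeasurable (hg.comp (by fun_prop))
    simp only [s2]
    rw [lintegral_lintegral_swap]
    · calc _ ≤ ∫⁻ t in Ioc (0 : ℝ) 1, 2 ^ d * A * volume (simplex K) :=
            setLIntegral_mono' measurableSet_Ioc s1
        _ = _ := by rw [setLIntegral_const]; simp
    · refine Measurable.aemeasurable ?_
      have : Measurable fun q : (Vec d × ℝ) × Vec d => g (q.1.1 + q.1.2 • (q.2 - q.1.1)) :=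
        hg.comp (by fun_prop)
      exact this.lintegral_prod_right'
  set Φ : Vec d → ℝ≥0∞ := fun y => ∫⁻ x in simplex K, ∫⁻ t in Ioc (0 : ℝ) 1, g (y + t • (x - y))
  have hΦ : Measurable Φ := by
    have e1 : Measurable fun q : Vec d × Vec d => ∫⁻ t in Ioc (0 : ℝ) 1, g (q.1 + t • (q.2 - q.1)) :=
      hgJ.lintegral_prod_right'
    exact e1.lintegral_prod_right'
  -- Some `y` does no worse than the average of `Φ`. Taking `f y` as the constant avoids mean values
  -- of `f`.
  obtain ⟨y, hy, hyΦ⟩ := exists_le_setLAverage (μ := volume) (s := simplex K) (f := Φ)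
    (volume_simplex_pos hK).ne' (volume_simplex_lt_top K).ne hΦ.aemeasurable
  refine ⟨f y, ?_⟩
  have hmt : Measurable fun x => ∫⁻ t in Ioc (0 : ℝ) 1, g (y + t • (x - y)) := by
    have : Measurable fun q : Vec d × ℝ => g (y + q.2 • (q.1 - y)) := hg.comp (by fun_prop)
    exact this.lintegral_prod_right'
  calc ∫⁻ x in simplex K, ‖f x - f y‖ₑ ^ p
      ≤ ∫⁻ x in simplex K, h ^ p * ∫⁻ t in Ioc (0 : ℝ) 1, g (y + t • (x - y)) :=
        setLIntegral_mono' hsm fun x hx => h1 y hy x hx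
    _ = h ^ p * Φ y := by rw [lintegral_const_mul _ hmt]
    _ ≤ h ^ p * (2 ^ d * A) := by
        gcongr
        refine hyΦ.trans ?_
        rw [setLAverage_eq]
        refine ENNReal.div_le_of_le_mul ?_
        exact hdouble
    _ = _ := by ring

open Classical in
/-- The volume of a simplex is at most its diameter times the area of a facet. -/
theorem volume_simplex_le (hd : 1 ≤ d) (hK : IsSimplex K) (hv : v ∈ K) :
    volume (simplex K) ≤ ENNReal.ofReal (Metric.diam (simplex K)) *
      facetMeasure (K.erase v) univ := by
  rw [volume_simplex_eq hd hK hv, Measure.restrict_apply_univ]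
  gcongr
  have hg : 0 < ‖baryGrad K v‖ := norm_pos_iff.2 (baryGrad_ne_zero hd hK hv)
  have hd1 : (1 : ℝ) ≤ d := by exact_mod_cast hd
  refine (div_le_self (by positivity) hd1).trans ?_
  have hc : 1 < K.card := by rw [hK.card_eq]; omega
  obtain ⟨w, hw, hwv⟩ := Finset.exists_mem_ne hc v
  -- Along an edge at `v` the coordinate drops by one, so the height `‖baryGrad K v‖⁻¹` is at most
  -- the diameter.
  have h1 := bary_sub_bary K v v w
  rw [bary_self hK hv, bary_of_ne hK hw hwv.symm, sub_zero] at h1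
  have h2 := real_inner_le_norm (baryGrad K v) (v - w)
  have h3 := norm_sub_le_diam (mem_simplex_of_mem hv) (mem_simplex_of_mem hw)
  rw [inv_le_iff_one_le_mul₀ hg, mul_comm]
  calc (1 : ℝ) ≤ ‖baryGrad K v‖ * ‖v - w‖ := h1.le.trans h2
    _ ≤ _ := by gcongr

end inequalities

/-! ### Lipschitz domains and meshes -/


/-- Points strictly below the local graph form an open set disjoint from `Ω`, hence avoid the
closure as well; moving from `x` in direction `-e` enters it. -/
theorem IsLipschitzDomain.exists_exterior (hΩ : IsLipschitzDomain Ω) {x : Vec d}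
    (hx : x ∈ closure Ω) (hxΩ : x ∉ Ω) {δ : ℝ} (hδ : 0 < δ) :
    ∃ y ∈ Metric.ball x δ, y ∉ closure Ω := by
  have hf : x ∈ frontier Ω := by rw [hΩ.isOpen.frontier_eq]; exact ⟨hx, hxΩ⟩
  obtain ⟨e, he, ε, hε, L, g, hg, hgr⟩ := hΩ.boundary x hf
  set W : Set (Vec d) := Metric.ball x ε ∩ {y | inner ℝ e y < g (y - (inner ℝ e y : ℝ) • e)}
  have hW : IsOpen W := by
    refine Metric.isOpen_ball.inter (isOpen_lt (by fun_prop) ?_)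
    have := hg.continuous
    fun_prop
  have hWΩ : Disjoint W Ω := by
    rw [Set.disjoint_left]
    rintro y ⟨hy1, hy2⟩ hy3
    exact lt_asymm ((hgr y hy1).1 hy3) hy2
  have hee : inner ℝ e e = (1 : ℝ) := by rw [real_inner_self_eq_norm_sq, he]; norm_num
  set τ := min ε δ / 2
  have hτ : 0 < τ := by positivity
  have hτ1 : τ < ε := by
    have := min_le_left ε δ
    have : 0 < min ε δ := lt_min hε hδ
    simp only [τ]; linarith
  have hτ2 : τ < δ := by
    have := min_le_right ε δ
    have : 0 < min ε δ := lt_min hε hδ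
    simp only [τ]; linarith
  have hd : dist (x - τ • e) x = τ := by
    simp [norm_smul, he, abs_of_pos hτ]
  refine ⟨x - τ • e, by rw [Metric.mem_ball, hd]; exact hτ2, fun hcl => ?_⟩
  have hmem : x - τ • e ∈ W := by
    refine ⟨by rw [Metric.mem_ball, hd]; exact hτ1, ?_⟩
    have h1 : inner ℝ e (x - τ • e) = (inner ℝ e x : ℝ) - τ := by
      rw [inner_sub_right, inner_smul_right, hee, mul_one]
    have h2 : x - τ • e - ((inner ℝ e x : ℝ) - τ) • e = x - (inner ℝ e x : ℝ) • e := by module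
    rw [mem_ofPred_eq, h1, h2]
    have h3 : ¬ g (x - (inner ℝ e x : ℝ) • e) < inner ℝ e x :=
      fun h => hxΩ ((hgr x (Metric.mem_ball_self hε)).2 h)
    linarith
  exact (disjoint_left.1 (hWΩ.closure_right hW)) hmem hcl

/-- Exterior points accumulate at every boundary point, so there are no slits. Since the elements
cover only `closure Ω`, this is how the mesh can decide membership in `Ω`. -/
theorem IsLipschitzDomain.interior_closure (hΩ : IsLipschitzDomain Ω) :
    interior (closure Ω) = Ω := by
  refine Subset.antisymm (fun x hx => ?_) (hΩ.isOpen.subset_interior_iff.2 subset_closure)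
  by_contra hxΩ
  obtain ⟨δ, hδ, hb⟩ := Metric.isOpen_iff.1 isOpen_interior x hx
  obtain ⟨y, hy, hyc⟩ := hΩ.exists_exterior (interior_subset hx) hxΩ hδ
  exact hyc (interior_subset (hb hy))

namespace Mesh
variable (𝒢 : Mesh Ω)

theorem simplex_subset {K : Finset (Vec d)} (hK : K ∈ 𝒢.elems) : simplex K ⊆ closure Ω := by
  rw [← 𝒢.cover]; exact subset_biUnion_of_mem (u := fun K => simplex K) hK

theorem exists_mem_simplex {x : Vec d} (hx : x ∈ closure Ω) : ∃ K ∈ 𝒢.elems, x ∈ simplex K := by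
  rw [← 𝒢.cover] at hx; simpa using hx

theorem interior_subset (hΩ : IsLipschitzDomain Ω) {K : Finset (Vec d)} (hK : K ∈ 𝒢.elems) :
    interior (simplex K) ⊆ Ω := by
  conv_rhs => rw [← hΩ.interior_closure]
  exact interior_mono (𝒢.simplex_subset hK)

theorem eventually_mem_simplex (x : Vec d) :
    ∀ᶠ y in 𝓝 x, ∀ K ∈ 𝒢.elems, y ∈ simplex K → x ∈ simplex K := by
  rw [Filter.eventually_all_finset]
  intro K _
  by_cases hx : x ∈ simplex K
  · exact Eventually.of_forall fun _ _ => hx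
  · filter_upwards [(isClosed_simplex K).isOpen_compl.mem_nhds hx] with y hy hy'
    exact absurd hy' hy

open Classical in
theorem mem_convexHull_inter {K L : Finset (Vec d)} (hK : K ∈ 𝒢.elems) (hL : L ∈ 𝒢.elems)
    {x : Vec d} (hxK : x ∈ simplex K) (hxL : x ∈ simplex L) :
    x ∈ convexHull ℝ ((K ∩ L : Finset (Vec d)) : Set (Vec d)) := by
  rw [Finset.coe_inter, ← 𝒢.conforming K hK L hL]; exact ⟨hxK, hxL⟩

/-- There are no hanging nodes: the coordinate of `z` equals one at `z` but would vanish on the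
common face if `z` were not a common vertex. -/
theorem mem_of_mem_simplex {K L : Finset (Vec d)} (hK : K ∈ 𝒢.elems) (hL : L ∈ 𝒢.elems)
    {z : Vec d} (hz : z ∈ K) (hzL : z ∈ simplex L) : z ∈ L := by
  classical
  have h := 𝒢.mem_convexHull_inter hK hL (mem_simplex_of_mem hz) hzL
  rw [mem_face_iff (𝒢.isSimplex hK) Finset.inter_subset_left] at h
  by_contra hn
  have := h.2 z hz (by simp [hn])
  rw [bary_self (𝒢.isSimplex hK) hz] at this
  exact one_ne_zero this

/-- The mesh resolves the boundary: a point of an element lies in `Ω` as soon as some point of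
`Ω` in the same element is supported on a subset of its vertices. -/
theorem mem_of_support (hΩ : IsLipschitzDomain Ω) {K : Finset (Vec d)} (hK : K ∈ 𝒢.elems)
    {x₀ y : Vec d} (hx₀ : x₀ ∈ Ω) (hx₀K : x₀ ∈ simplex K) (hy : y ∈ simplex K)
    (hs : ∀ z ∈ K, bary K z y = 0 → bary K z x₀ = 0) : y ∈ Ω := by
  classical
  have hKs := 𝒢.isSimplex hK
  have hcont : Continuous fun s : ℝ => x₀ + s • (y - x₀) := by fun_prop
  have hev : ∀ᶠ s : ℝ in 𝓝[>] 0, x₀ + s • (y - x₀) ∈ Ω := by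
    refine nhdsWithin_le_nhds (hcont.continuousAt.preimage_mem_nhds ?_)
    simpa using hΩ.isOpen.mem_nhds hx₀
  obtain ⟨s, hsΩ, hs0, hs1⟩ := (hev.and (Ioo_mem_nhdsGT (zero_lt_one (α := ℝ)))).exists
  set ys := x₀ + s • (y - x₀)
  have hc2 : Continuous fun y' : Vec d => x₀ + s • (y' - x₀) := by fun_prop
  have hysK : ys ∈ simplex K := (convex_simplex K).add_smul_sub_mem hx₀K hy ⟨hs0.le, hs1.le⟩
  -- It suffices that points `y'` near `y` lie in `closure Ω`. Contract `y'` towards `x₀` into `Ω`,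
  -- take an element `L` containing the image, and show `y' ∈ L`. Coordinates positive at `y` remain
  -- positive nearby. Where `y` has coordinate zero so has `x₀`, and the coordinate of the image is
  -- then `s` times that of `y'`.
  rw [← hΩ.interior_closure, mem_interior_iff_mem_nhds]
  have e1 : ∀ᶠ y' in 𝓝 y, x₀ + s • (y' - x₀) ∈ Ω :=
    hc2.continuousAt.preimage_mem_nhds (hΩ.isOpen.mem_nhds hsΩ)
  have e2 : ∀ᶠ y' in 𝓝 y, ∀ L ∈ 𝒢.elems, x₀ + s • (y' - x₀) ∈ simplex L → ys ∈ simplex L :=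
    hc2.continuousAt.eventually (𝒢.eventually_mem_simplex ys)
  have e3 : ∀ᶠ y' in 𝓝 y, ∀ L ∈ 𝒢.elems, ∀ w ∈ L, 0 < bary L w y → 0 < bary L w y' := by
    rw [Filter.eventually_all_finset]
    intro L _
    rw [Filter.eventually_all_finset]
    intro w _
    by_cases h : 0 < bary L w y
    · filter_upwards [(continuous_bary L w).continuousAt.eventually (lt_mem_nhds h)] with y' h' _
      exact h'
    · exact Eventually.of_forall fun _ h' => absurd h' h
  filter_upwards [e1, e2, e3] with y' h1 h2 h3
  obtain ⟨L, hL, hLy⟩ := 𝒢.exists_mem_simplex (subset_closure h1)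
  have hLs := 𝒢.isSimplex hL
  have hysL := h2 L hL hLy
  have hG := 𝒢.mem_convexHull_inter hK hL hysK hysL
  rw [mem_face_iff hKs Finset.inter_subset_left] at hG
  -- A vanishing coordinate of `ys` is a sum of two nonnegative terms, so it vanishes at `y`.
  have hz0 : ∀ z ∈ K, z ∉ K ∩ L → bary K z y = 0 := by
    intro z hz hzG
    have := hG.2 z hz hzG
    rw [bary_homothety] at this
    have a1 := bary_nonneg hKs hx₀K z
    have a2 := bary_nonneg hKs hy z
    have a3 : 0 ≤ (1 - s) * bary K z x₀ := mul_nonneg (by linarith) a1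
    have a4 : 0 ≤ s * bary K z y := mul_nonneg hs0.le a2
    have a5 : s * bary K z y = 0 := by linarith
    exact (mul_eq_zero.1 a5).resolve_left hs0.ne'
  have hyG : y ∈ convexHull ℝ ((K ∩ L : Finset (Vec d)) : Set (Vec d)) :=
    (mem_face_iff hKs Finset.inter_subset_left).2 ⟨hy, hz0⟩
  have hxG : x₀ ∈ convexHull ℝ ((K ∩ L : Finset (Vec d)) : Set (Vec d)) :=
    (mem_face_iff hKs Finset.inter_subset_left).2 ⟨hx₀K, fun z hz hzG => hs z hz (hz0 z hz hzG)⟩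
  have hyL := (mem_face_iff hLs Finset.inter_subset_right).1 hyG
  have hxL := (mem_face_iff hLs Finset.inter_subset_right).1 hxG
  refine 𝒢.simplex_subset hL ((mem_simplex_iff hLs).2 fun w hw => ?_)
  rcases (bary_nonneg hLs hyL.1 w).lt_or_eq with hpos | hzero
  · exact (h3 L hL w hw hpos).le
  · have hx0 : bary L w x₀ = 0 := by
      by_cases hwG : w ∈ K ∩ L
      · have hwK := (Finset.mem_inter.1 hwG).1
        rw [← bary_eq_bary hKs hLs Finset.inter_subset_left Finset.inter_subset_right hxG hwK hw]
        refine hs w hwK ?_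
        rw [bary_eq_bary hKs hLs Finset.inter_subset_left Finset.inter_subset_right hyG hwK hw,
          ← hzero]
      · exact hxL.2 w hw hwG
    have := bary_nonneg hLs hLy w
    rw [bary_homothety, hx0, mul_zero, zero_add] at this
    exact nonneg_of_mul_nonneg_right this hs0

/-- If `z` were in `Ω`, it would serve as the point of `Ω` in `mem_of_support`, its support being
just `{z}`. Hence at points outside `Ω` only vertices outside `Ω` are active. -/
theorem vertex_notMem (hΩ : IsLipschitzDomain Ω) {K : Finset (Vec d)} (hK : K ∈ 𝒢.elems)
    {x z : Vec d} (hx : x ∈ simplex K) (hxΩ : x ∉ Ω) (hz : z ∈ K) (h : bary K z x ≠ 0) :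
    z ∉ Ω := fun hzΩ => hxΩ <| 𝒢.mem_of_support hΩ hK hzΩ (mem_simplex_of_mem hz) hx
  fun w hw hwx => by
    by_cases hwz : w = z
    · rw [hwz] at hwx; exact absurd hwx h
    · exact bary_of_ne (𝒢.isSimplex hK) hz hwz

end Mesh

/-- If the coordinate were zero, a small step away from `z` inside the affine span would stay in the
face and make it negative. -/
theorem bary_pos_of_mem_intrinsicInterior {K F : Finset (Vec d)} (hK : IsSimplex K) (hF : F ⊆ K)
    {y z : Vec d} (hy : y ∈ intrinsicInterior ℝ (simplex F)) (hz : z ∈ F) : 0 < bary K z y := by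
  have hyF := intrinsicInterior_subset hy
  rw [mem_intrinsicInterior] at hy
  obtain ⟨y', hy', rfl⟩ := hy
  refine lt_of_le_of_ne (bary_nonneg hK (simplex_mono hF hyF) z) fun h0 => ?_
  have hzs : z ∈ affineSpan ℝ (simplex F) := subset_affineSpan ℝ _ (mem_simplex_of_mem hz)
  let z' : affineSpan ℝ (simplex F) := ⟨z, hzs⟩
  let γ : ℝ → affineSpan ℝ (simplex F) := fun t =>
    ⟨AffineMap.lineMap (y' : Vec d) z (-t), AffineMap.lineMap_mem _ y'.2 hzs⟩
  have hγ : Continuous γ := by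
    refine Continuous.subtype_mk ?_ _
    simp only [AffineMap.lineMap_apply]
    fun_prop
  have hγ0 : γ 0 = y' := by ext1; simp [γ]
  have hev : ∀ᶠ t : ℝ in 𝓝[>] 0, γ t ∈ interior ((↑) ⁻¹' simplex F : Set (affineSpan ℝ (simplex F))) :=
    nhdsWithin_le_nhds (hγ.continuousAt.preimage_mem_nhds
      (by rw [hγ0]; exact isOpen_interior.mem_nhds hy'))
  obtain ⟨t, ht, ht0⟩ := (hev.and self_mem_nhdsWithin).exists
  have h1 : (γ t : Vec d) ∈ simplex F := _root_.interior_subset 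
    (s := ((↑) ⁻¹' simplex F : Set (affineSpan ℝ (simplex F)))) ht
  have h2 := bary_nonneg hK (simplex_mono hF h1) z
  have h3 : (γ t : Vec d) = y' + (-t) • (z - y') := by
    simp [γ, AffineMap.lineMap_apply, add_comm]
  rw [h3, bary_homothety, ← h0, bary_self hK (hF hz)] at h2
  have : (0 : ℝ) < t := ht0
  linarith

namespace Mesh
variable (𝒢 : Mesh Ω)

/-- A facet of an element that is not a side does not meet `Ω`. -/
theorem disjoint_of_not_isSide (hΩ : IsLipschitzDomain Ω) {K F : Finset (Vec d)}
    (hK : K ∈ 𝒢.elems) (hF : F ⊆ K) (hcard : F.card = d) (hs : ¬ 𝒢.IsSide F) {x : Vec d}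
    (hx : x ∈ simplex F) : x ∉ Ω := by
  intro hxΩ
  refine hs ⟨⟨K, hK, hF⟩, hcard, fun y hy => ?_⟩
  -- Points of the intrinsic interior are supported on all of `F`, so a single point of `Ω` in the
  -- facet brings the whole interior into `Ω` and makes the facet a side.
  refine 𝒢.mem_of_support hΩ hK hxΩ (simplex_mono hF hx)
    (simplex_mono hF (intrinsicInterior_subset hy)) fun z hz hzy => ?_
  by_cases hzF : z ∈ F
  · exact absurd hzy (bary_pos_of_mem_intrinsicInterior (𝒢.isSimplex hK) hF hy hzF).ne'
  · exact ((mem_face_iff (𝒢.isSimplex hK) hF).1 hx).2 z hz hzF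

/-- The finite closed cover of `ℝ^d` by the elements and the complement of `Ω`. -/
def closedCover : Option 𝒢.elems → Set (Vec d)
  | none => Ωᶜ
  | some K => simplex K.1

theorem isClosed_closedCover (hΩ : IsLipschitzDomain Ω) (i : Option 𝒢.elems) :
    IsClosed (𝒢.closedCover i) := by
  cases i with
  | none => exact hΩ.isOpen.isClosed_compl
  | some K => exact isClosed_simplex _

theorem iUnion_closedCover : ⋃ i, 𝒢.closedCover i = univ := by
  refine eq_univ_of_forall fun x => ?_
  by_cases hx : x ∈ Ω
  · obtain ⟨K, hK, hxK⟩ := 𝒢.exists_mem_simplex (subset_closure hx)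
    exact mem_iUnion.2 ⟨some ⟨K, hK⟩, hxK⟩
  · exact mem_iUnion.2 ⟨none, hx⟩

/-- The affine formulas agree on common faces, where only common vertices are active. Outside `Ω`
every active nodal value is zero, so the extension by zero is consistent, and continuity follows by
gluing over a finite closed cover. -/
theorem exists_interpolant (hΩ : IsLipschitzDomain Ω) (c : Vec d → Vec d)
    (hc : ∀ z ∉ Ω, c z = 0) :
    ∃ V : Vec d → Vec d, Continuous V ∧ (∀ x ∉ Ω, V x = 0) ∧
      ∀ K ∈ 𝒢.elems, ∀ x ∈ simplex K, V x = ∑ z ∈ K, bary K z x • c z := by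
  classical
  let V : Vec d → Vec d := fun x =>
    if h : ∃ K ∈ 𝒢.elems, x ∈ simplex K then ∑ z ∈ h.choose, bary h.choose z x • c z else 0
  have hV : ∀ K ∈ 𝒢.elems, ∀ x ∈ simplex K, V x = ∑ z ∈ K, bary K z x • c z := by
    intro K hK x hx
    have h : ∃ K ∈ 𝒢.elems, x ∈ simplex K := ⟨K, hK, hx⟩
    simp only [V, dif_pos h]
    obtain ⟨hL, hxL⟩ := h.choose_spec
    set L := h.choose
    have hG := 𝒢.mem_convexHull_inter hK hL hx hxL
    have hKs := 𝒢.isSimplex hK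
    have hLs := 𝒢.isSimplex hL
    have hGK := (mem_face_iff hKs Finset.inter_subset_left).1 hG
    have hGL := (mem_face_iff hLs Finset.inter_subset_right).1 hG
    rw [← Finset.sum_subset (Finset.inter_subset_left (s₁ := K) (s₂ := L))
        (fun z hz hzG => by rw [hGK.2 z hz hzG, zero_smul]),
      ← Finset.sum_subset (Finset.inter_subset_right (s₁ := K) (s₂ := L))
        (fun z hz hzG => by rw [hGL.2 z hz hzG, zero_smul])]
    refine Finset.sum_congr rfl fun z hz => ?_
    rw [bary_eq_bary hKs hLs Finset.inter_subset_left Finset.inter_subset_right hG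
      (Finset.mem_inter.1 hz).1 (Finset.mem_inter.1 hz).2]
  have hV0 : ∀ x ∉ Ω, V x = 0 := by
    intro x hx
    by_cases h : ∃ K ∈ 𝒢.elems, x ∈ simplex K
    · obtain ⟨K, hK, hxK⟩ := h
      rw [hV K hK x hxK]
      refine Finset.sum_eq_zero fun z hz => ?_
      by_cases hb : bary K z x = 0
      · rw [hb, zero_smul]
      · rw [hc z (𝒢.vertex_notMem hΩ hK hxK hx hz hb), smul_zero]
    · simp only [V, dif_neg h]
  refine ⟨V, ?_, hV0, hV⟩
  refine (locallyFinite_of_finite 𝒢.closedCover).continuous 𝒢.iUnion_closedCover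
    (𝒢.isClosed_closedCover hΩ) fun i => ?_
  cases i with
  | none => exact continuousOn_const.congr (f := fun _ => (0 : Vec d)) fun x hx => hV0 x hx
  | some K =>
    refine ContinuousOn.congr (f := fun x => ∑ z ∈ K.1, bary K.1 z x • c z) ?_
      fun x hx => hV K.1 K.2 x hx
    refine Continuous.continuousOn (continuous_finsetSum _ fun z _ => ?_)
    exact (continuous_bary _ _).smul continuous_const

end Mesh

/-- A continuous function that is Lipschitz on each set of a finite closed cover is Lipschitz. -/
theorem lipschitzWith_of_closed_cover {ι : Type*} [Finite ι] {A : ι → Set (Vec d)}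
    (hA : ∀ i, IsClosed (A i)) (hcov : ⋃ i, A i = univ) {E : Type*} [NormedAddCommGroup E]
    [NormedSpace ℝ E] {f : Vec d → E} (hf : Continuous f) {M : ℝ≥0}
    (hM : ∀ i, LipschitzOnWith M f (A i)) : LipschitzWith M f := by
  refine LipschitzWith.of_dist_le_mul fun x y => ?_
  rw [dist_eq_norm, dist_eq_norm, ← norm_neg (x - y), neg_sub, ← norm_neg (f x - f y), neg_sub]
  set g : ℝ → E := fun t => f (x + t • (y - x)) - f x
  have hgc : Continuous g := by fun_prop
  -- Mean value inequality along the segment, in the version that requires a slope bound only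
  -- frequently to the right of each point.
  have key : ‖g 1‖ ≤ M * ‖y - x‖ * 1 := by
    refine image_le_of_liminf_slope_right_le_deriv_boundary (f := fun t => ‖g t‖) (a := 0) (b := 1)
      (B := fun t => M * ‖y - x‖ * t) (B' := fun _ => M * ‖y - x‖) hgc.norm.continuousOn (by simp [g])
      (by fun_prop) (fun t _ => ?_) (fun t ht r hr => ?_) ⟨zero_le_one, le_rfl⟩
    · simpa using ((hasDerivAt_id t).const_mul (M * ‖y - x‖ : ℝ)).hasDerivWithinAt
    -- Among finitely many pieces one contains points of the segment arbitrarily close to the right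
    -- of `t`; being closed it also contains the point at `t`, and its Lipschitz bound applies.
    · have hfreq : ∃ᶠ s in 𝓝[>] t, ∃ i, x + s • (y - x) ∈ A i :=
        Eventually.frequently (Eventually.of_forall fun s =>
          mem_iUnion.1 (by rw [hcov]; trivial))
      rw [Filter.frequently_exists] at hfreq
      obtain ⟨i, hi⟩ := hfreq
      have hγ : Continuous fun s : ℝ => x + s • (y - x) := by fun_prop
      have hti : x + t • (y - x) ∈ A i :=
        (hA i).mem_of_frequently_of_tendsto hi
          (hγ.continuousAt.tendsto.mono_left nhdsWithin_le_nhds)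
      refine (hi.and_eventually self_mem_nhdsWithin).mono fun s ⟨hs, hst⟩ => ?_
      have hst : 0 < s - t := sub_pos.2 hst
      have h1 := (hM i).dist_le_mul _ hs _ hti
      rw [dist_eq_norm, dist_eq_norm, add_sub_add_left_eq_sub, ← sub_smul, norm_smul,
        Real.norm_of_nonneg hst.le] at h1
      have h2 : ‖g s‖ - ‖g t‖ ≤ M * ((s - t) * ‖y - x‖) := by
        refine (norm_sub_norm_le _ _).trans ?_
        simpa [g] using h1
      rw [slope_def_field]
      refine lt_of_le_of_lt ?_ hr
      rw [div_le_iff₀ hst]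
      linarith
  simpa [g] using key

/-! ### Facet connectivity of vertex stars -/

/-- The affine hull of `G` and a further direction `u`, based at `g`. -/
noncomputable def extendedHull (G : Finset (Vec d)) (g u : Vec d) : AffineSubspace ℝ (Vec d) :=
  AffineSubspace.mk' g (vectorSpan ℝ (G : Set (Vec d)) ⊔ Submodule.span ℝ {u})

/-- The direction has dimension at most `(G.card - 1) + 1 < d`. -/
theorem extendedHull_ne_top {G : Finset (Vec d)} (hG : G.card < d) {g : Vec d} (hg : g ∈ G)
    (u : Vec d) : extendedHull G g u ≠ ⊤ := by
  intro h
  have h1 : (extendedHull G g u).direction = ⊤ := by rw [h]; exact AffineSubspace.direction_top ..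
  rw [extendedHull, AffineSubspace.direction_mk'] at h1
  have h2 := Submodule.finrank_add_le_finrank_add_finrank
    (vectorSpan ℝ (G : Set (Vec d))) (Submodule.span ℝ {u})
  rw [h1, finrank_top, finrank_euclideanSpace, Fintype.card_fin] at h2
  have h3 : Module.finrank ℝ (Submodule.span ℝ {u}) ≤ 1 := by
    simpa using finrank_span_le_card (R := ℝ) ({u} : Set (Vec d))
  have hpos : 0 < G.card := Finset.card_pos.2 ⟨g, hg⟩
  have h4 : Module.finrank ℝ (vectorSpan ℝ (G : Set (Vec d))) ≤ G.card - 1 := by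
    have h5 := finrank_vectorSpan_range_le ℝ (fun x : G => (x : Vec d)) (n := G.card - 1)
      (by rw [Fintype.card_coe]; omega)
    have h6 : range (fun x : G => (x : Vec d)) = (G : Set (Vec d)) := Subtype.range_coe
    rwa [h6] at h5
  omega

theorem mem_extendedHull_of_mem {G : Finset (Vec d)} {g : Vec d} (hg : g ∈ G) {u x : Vec d}
    (hx : x ∈ convexHull ℝ (G : Set (Vec d))) (t : ℝ) : x + t • u ∈ extendedHull G g u := by
  rw [extendedHull, AffineSubspace.mem_mk', vsub_eq_sub]
  have h1 : x - g ∈ vectorSpan ℝ (G : Set (Vec d)) := by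
    rw [← direction_affineSpan]
    exact AffineSubspace.vsub_mem_direction (convexHull_subset_affineSpan _ hx)
      (subset_affineSpan ℝ _ hg)
  have h2 : x + t • u - g = (x - g) + t • u := by abel
  rw [h2]
  exact add_mem (Submodule.mem_sup_left h1)
    (Submodule.mem_sup_right (Submodule.smul_mem _ _ (Submodule.mem_span_singleton_self u)))

/-- Solving the convex combination for `a` confines it to a proper subspace when `G` has fewer than
`d` points. Such bad endpoints are negligible. -/
theorem mem_extendedHull_of_mem_segment {G : Finset (Vec d)} {g : Vec d} (hg : g ∈ G)
    {a b x : Vec d} (hx : x ∈ convexHull ℝ (G : Set (Vec d))) (hxs : x ∈ segment ℝ a b)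
    (hxb : x ≠ b) : a ∈ extendedHull G g (b - g) := by
  obtain ⟨s, t, hs, ht, hst, rfl⟩ := hxs
  have hs0 : s ≠ 0 := by
    rintro rfl
    apply hxb
    rw [show t = 1 by linarith]; simp
  have h1 : s • a + t • b - g ∈ vectorSpan ℝ (G : Set (Vec d)) := by
    rw [← direction_affineSpan]
    exact AffineSubspace.vsub_mem_direction (convexHull_subset_affineSpan _ hx)
      (subset_affineSpan ℝ _ hg)
  rw [extendedHull, AffineSubspace.mem_mk', vsub_eq_sub]
  have h2 : a - g = s⁻¹ • (s • a + t • b - g) + (-(s⁻¹ * t)) • (b - g) := by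
    have : t = 1 - s := by linarith
    subst this
    have e : s⁻¹ • (s • a + (1 - s) • b - g) = a + (s⁻¹ * (1 - s)) • b - s⁻¹ • g := by
      rw [smul_sub, smul_add, smul_smul, smul_smul, inv_mul_cancel₀ hs0, one_smul]
    rw [e]
    have e2 : s⁻¹ * (1 - s) = s⁻¹ - 1 := by field_simp
    rw [e2]
    module
  rw [h2]
  exact add_mem (Submodule.mem_sup_left (Submodule.smul_mem _ _ h1))
    (Submodule.mem_sup_right (Submodule.smul_mem _ _ (Submodule.mem_span_singleton_self _)))

namespace Mesh
variable (𝒢 : Mesh Ω)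

/-- The faces of codimension at least two. -/
noncomputable def lowFaces : Finset (Finset (Vec d)) :=
  𝒢.elems.biUnion fun K => K.powerset.filter fun G => G.card < d

/-- The skeleton of codimension two. -/
def skeleton : Set (Vec d) := ⋃ G ∈ 𝒢.lowFaces, convexHull ℝ (G : Set (Vec d))

theorem mem_skeleton {K G : Finset (Vec d)} (hK : K ∈ 𝒢.elems) (hG : G ⊆ K) (hc : G.card < d)
    {x : Vec d} (hx : x ∈ convexHull ℝ (G : Set (Vec d))) : x ∈ 𝒢.skeleton := by
  refine mem_biUnion (x := G) ?_ hx
  simp only [lowFaces, Finset.coe_biUnion, mem_iUnion]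
  exact ⟨K, hK, by simp [hG, hc]⟩

theorem card_lt_of_mem_lowFaces {G : Finset (Vec d)} (hG : G ∈ 𝒢.lowFaces) : G.card < d := by
  simp only [lowFaces, Finset.mem_biUnion, Finset.mem_filter] at hG
  obtain ⟨_, _, _, h⟩ := hG
  exact h

/-- Points whose line in direction `u`, or whose segment to a point `w` off the skeleton, meets the
skeleton lie in finitely many proper affine subspaces, a null set; a nonempty open set is not null.
-/
theorem exists_generic {O : Set (Vec d)} (hO : IsOpen O) (hne : O.Nonempty)
    (u w : Vec d) : ∃ a ∈ O, (∀ t : ℝ, a + t • u ∉ 𝒢.skeleton) ∧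
      (w ∉ 𝒢.skeleton → ∀ x ∈ segment ℝ a w, x ∉ 𝒢.skeleton) := by
  classical
  set N : Set (Vec d) := ⋃ G ∈ 𝒢.lowFaces, ⋃ g ∈ G,
    ((extendedHull G g u : Set (Vec d)) ∪ (extendedHull G g (w - g) : Set (Vec d)))
  have hN : volume N = 0 := by
    refine (measure_biUnion_null_iff 𝒢.lowFaces.countable_toSet).2 fun G hG => ?_
    refine (measure_biUnion_null_iff G.countable_toSet).2 fun g hg => ?_
    have hc := 𝒢.card_lt_of_mem_lowFaces hG
    exact measure_union_null
      (Measure.addHaar_affineSubspace _ _ (extendedHull_ne_top hc hg _))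
      (Measure.addHaar_affineSubspace _ _ (extendedHull_ne_top hc hg _))
  have hpos : 0 < volume (O \ N) := by
    rw [measure_sdiff_null hN]; exact hO.measure_pos _ hne
  obtain ⟨a, haO, haN⟩ := nonempty_of_measure_ne_zero hpos.ne'
  have haN' : ∀ G ∈ 𝒢.lowFaces, ∀ g ∈ G, a ∉ extendedHull G g u ∧ a ∉ extendedHull G g (w - g) := by
    intro G hG g hg
    by_contra hcon
    apply haN
    refine mem_biUnion (x := G) hG (mem_biUnion (x := g) hg ?_)
    by_contra h
    exact hcon ⟨fun h1 => h (Or.inl h1), fun h1 => h (Or.inr h1)⟩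
  refine ⟨a, haO, fun t ht => ?_, fun hw x hx hxN => ?_⟩
  · simp only [skeleton, mem_iUnion] at ht
    obtain ⟨G, hG, htG⟩ := ht
    obtain ⟨g, hg⟩ := Finset.nonempty_iff_ne_empty.2 (fun h => by simp [h] at htG : G ≠ ∅)
    have := mem_extendedHull_of_mem hg (u := u) htG (-t)
    rw [add_assoc, ← add_smul, add_neg_cancel, zero_smul, add_zero] at this
    exact (haN' G hG g hg).1 this
  · have hxw : x ≠ w := fun h => hw (h ▸ hxN)
    simp only [skeleton, mem_iUnion] at hxN
    obtain ⟨G, hG, htG⟩ := hxN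
    obtain ⟨g, hg⟩ := Finset.nonempty_iff_ne_empty.2 (fun h => by simp [h] at htG : G ≠ ∅)
    exact (haN' G hG g hg).2 (mem_extendedHull_of_mem_segment hg htG hx hxw)

open Classical in
/-- The elements containing the vertex `z`. -/
noncomputable def star (z : Vec d) : Finset (Finset (Vec d)) := 𝒢.elems.filter (z ∈ ·)

theorem mem_star {z : Vec d} {K : Finset (Vec d)} : K ∈ 𝒢.star z ↔ K ∈ 𝒢.elems ∧ z ∈ K := by
  simp [star]

open Classical in
/-- The graph of the elements containing `z`, where elements sharing a facet are adjacent. -/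
def starGraph (z : Vec d) : SimpleGraph (𝒢.star z) where
  Adj K L := K ≠ L ∧ d ≤ (K.1 ∩ L.1).card
  symm := ⟨fun K L h => ⟨h.1.symm, by rw [Finset.inter_comm]; exact h.2⟩⟩
  loopless := ⟨fun K h => h.1 rfl⟩

/-- The elements reachable from `K` and the remaining ones cover `S` by two closed sets. By
connectedness these meet on `S`, at a point off the skeleton, so the two elements there share at
least `d` vertices and are equal or adjacent. -/
theorem reachable_of_isPreconnected {z : Vec d} {S : Set (Vec d)} (hS : IsPreconnected S)
    (hcov : ∀ x ∈ S, ∃ K ∈ 𝒢.star z, x ∈ simplex K) (hskel : ∀ x ∈ S, x ∉ 𝒢.skeleton)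
    {K L : 𝒢.star z} (hK : (S ∩ simplex K.1).Nonempty) (hL : (S ∩ simplex L.1).Nonempty) :
    (𝒢.starGraph z).Reachable K L := by
  classical
  by_contra hKL
  set A : Set (Vec d) := ⋃ M ∈ {M : 𝒢.star z | (𝒢.starGraph z).Reachable K M}, simplex M.1
  set B : Set (Vec d) := ⋃ M ∈ {M : 𝒢.star z | ¬ (𝒢.starGraph z).Reachable K M}, simplex M.1
  have hA : IsClosed A := (toFinite _).isClosed_biUnion fun M _ => isClosed_simplex _
  have hB : IsClosed B := (toFinite _).isClosed_biUnion fun M _ => isClosed_simplex _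
  have hSAB : S ⊆ A ∪ B := by
    intro x hx
    obtain ⟨M, hM, hxM⟩ := hcov x hx
    by_cases h : (𝒢.starGraph z).Reachable K ⟨M, hM⟩
    · exact Or.inl (mem_biUnion (x := (⟨M, hM⟩ : 𝒢.star z)) h hxM)
    · exact Or.inr (mem_biUnion (x := (⟨M, hM⟩ : 𝒢.star z)) h hxM)
  obtain ⟨x, hxS, hxA, hxB⟩ := isPreconnected_closed_iff.1 hS A B hA hB hSAB
    (hK.mono (inter_subset_inter_right _ (subset_biUnion_of_mem
      (u := fun M : 𝒢.star z => simplex M.1)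
      (show K ∈ {M : 𝒢.star z | (𝒢.starGraph z).Reachable K M} from SimpleGraph.Reachable.refl _))))
    (hL.mono (inter_subset_inter_right _ (subset_biUnion_of_mem
      (u := fun M : 𝒢.star z => simplex M.1)
      (show L ∈ {M : 𝒢.star z | ¬ (𝒢.starGraph z).Reachable K M} from hKL))))
  simp only [A, B, mem_iUnion] at hxA hxB
  obtain ⟨M, hM, hxM⟩ := hxA
  obtain ⟨M', hM', hxM'⟩ := hxB
  have hMe := (𝒢.mem_star.1 M.2).1
  have hMe' := (𝒢.mem_star.1 M'.2).1
  have hx := 𝒢.mem_convexHull_inter hMe hMe' hxM hxM'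
  by_cases hc : d ≤ (M.1 ∩ M'.1).card
  · refine hM' (hM.trans ?_)
    by_cases heq : M = M'
    · rw [heq]
    · exact SimpleGraph.Adj.reachable ⟨heq, hc⟩
  · exact hskel x hxS (𝒢.mem_skeleton hMe Finset.inter_subset_left (not_le.1 hc) hx)

end Mesh

/-- Points of a Lipschitz domain near a given point can be joined by polygons with three edges. -/
theorem IsLipschitzDomain.exists_local_path (hΩ : IsLipschitzDomain Ω) {z : Vec d}
    (hz : z ∈ closure Ω) {r : ℝ} (hr : 0 < r) :
    ∃ (u : Vec d) (δ : ℝ), 0 < δ ∧ δ ≤ r ∧ ∀ a ∈ Ω ∩ Metric.ball z δ,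
      segment ℝ a (a + u) ⊆ Ω ∩ Metric.ball z r ∧
      ∀ b ∈ Ω ∩ Metric.ball z δ, segment ℝ (a + u) (b + u) ⊆ Ω ∩ Metric.ball z r := by
  by_cases hzΩ : z ∈ Ω
  · obtain ⟨ε, hε, hb⟩ := Metric.isOpen_iff.1 hΩ.isOpen z hzΩ
    have hball : Metric.ball z (min r ε) ⊆ Ω ∩ Metric.ball z r := fun x hx =>
      ⟨hb (Metric.ball_subset_ball (min_le_right _ _) hx),
        Metric.ball_subset_ball (min_le_left _ _) hx⟩
    refine ⟨0, min r ε, lt_min hr hε, min_le_left _ _, fun a ha => ⟨?_, fun b hb' => ?_⟩⟩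
    · simpa using hball ha.2
    · simp only [add_zero]
      exact ((convex_ball z _).segment_subset ha.2 hb'.2).trans hball
  have hf : z ∈ frontier Ω := by rw [hΩ.isOpen.frontier_eq]; exact ⟨hz, hzΩ⟩
  obtain ⟨e, he, ε, hε, L, g, hg, hgr⟩ := hΩ.boundary z hf
  have hee : inner ℝ e e = (1 : ℝ) := by rw [real_inner_self_eq_norm_sq, he]; norm_num
  set pr : Vec d → Vec d := fun y => y - (inner ℝ e y : ℝ) • e with hpr
  have hprc : Continuous pr := by fun_prop
  have hgc : Continuous fun y => g (pr y) := hg.continuous.comp hprc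
  have hshift : ∀ (y : Vec d) (t : ℝ), pr (y + t • e) = pr y := by
    intro y t
    simp only [hpr, inner_add_right, inner_smul_right, hee]; module
  have hinn : ∀ (y : Vec d) (t : ℝ), inner ℝ e (y + t • e) = (inner ℝ e y : ℝ) + t := by
    intro y t
    simp only [inner_add_right, inner_smul_right, hee]; ring
  have hgz : g (pr z) ≤ inner ℝ e z := by
    have hcl : IsClosed {y | g (pr y) ≤ inner ℝ e y} := isClosed_le hgc (by fun_prop)
    have : z ∈ closure (Ω ∩ Metric.ball z ε) := by
      rw [mem_closure_iff_nhds]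
      intro t ht
      obtain ⟨y, hy1, hy2⟩ := mem_closure_iff_nhds.1 hz (t ∩ Metric.ball z ε)
        (inter_mem ht (Metric.ball_mem_nhds z hε))
      exact ⟨y, hy1.1, hy2, hy1.2⟩
    exact hcl.closure_subset_iff.2 (fun y hy => ((hgr y hy.2).1 hy.1).le) this
  -- nearby points lie above the graph once shifted upwards by `s`
  set ρ := min r ε
  have hρ : 0 < ρ := lt_min hr hε
  set δ₀ : ℝ := ρ / 4
  obtain ⟨η, hη, hηb⟩ : ∃ η > 0, ∀ y ∈ Metric.ball z η,
      g (pr y) < (inner ℝ e y : ℝ) + ρ / 4 := by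
    have hop : IsOpen {y | g (pr y) < (inner ℝ e y : ℝ) + ρ / 4} := isOpen_lt hgc (by fun_prop)
    exact Metric.isOpen_iff.1 hop z (show g (pr z) < inner ℝ e z + ρ / 4 by linarith)
  set δ := min (ρ / 4) η
  have hδ : 0 < δ := lt_min (by linarith) hη
  have hδρ : δ ≤ ρ / 4 := min_le_left _ _
  have hball : ∀ y ∈ Metric.ball z δ, ∀ t ∈ Icc (0 : ℝ) (ρ / 4), y + t • e ∈ Metric.ball z ρ := by
    intro y hy t ht
    rw [Metric.mem_ball, dist_eq_norm] at hy ⊢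
    have h1 : y + t • e - z = (y - z) + t • e := by abel
    have h2 : ‖t • e‖ = t := by rw [norm_smul, he, Real.norm_of_nonneg ht.1, mul_one]
    rw [h1]
    have h3 := norm_add_le (y - z) (t • e)
    rw [h2] at h3
    linarith [ht.2]
  have hinto : ∀ y ∈ Metric.ball z ρ, g (pr y) < inner ℝ e y → y ∈ Ω ∩ Metric.ball z r :=
    fun y hy h => ⟨(hgr y (Metric.ball_subset_ball (min_le_right _ _) hy)).2 h,
      Metric.ball_subset_ball (min_le_left _ _) hy⟩
  have hδr : δ ≤ r := by have := min_le_left r ε; linarith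
  -- The detour goes upwards. Vertical segments starting in `Ω` stay above the graph. The lift `ρ /
  -- 4` puts the whole ball of radius `δ` above the graph, so segments between lifted points are
  -- harmless.
  refine ⟨(ρ / 4) • e, δ, hδ, hδr, fun a ha => ⟨?_, fun b hb => ?_⟩⟩
  · intro y hy
    rw [segment_eq_image'] at hy
    obtain ⟨θ, hθ, rfl⟩ := hy
    have h1 : a + θ • (a + (ρ / 4) • e - a) = a + (θ * (ρ / 4)) • e := by module
    have h2 : 0 ≤ θ * (ρ / 4) := mul_nonneg hθ.1 (by linarith)
    have h3 : θ * (ρ / 4) ≤ ρ / 4 := mul_le_of_le_one_left (by linarith) hθ.2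
    beta_reduce
    rw [h1]
    refine hinto _ (hball a ha.2 _ ⟨h2, h3⟩) ?_
    rw [hshift, hinn]
    have haε : a ∈ Metric.ball z ε :=
      Metric.ball_subset_ball (by have := min_le_right r ε; linarith) ha.2
    have := (hgr a haε).1 ha.1
    simp only [hpr]
    linarith
  · intro y hy
    rw [segment_eq_image'] at hy
    obtain ⟨θ, hθ, rfl⟩ := hy
    have h1 : a + (ρ / 4) • e + θ • (b + (ρ / 4) • e - (a + (ρ / 4) • e)) =
        (a + θ • (b - a)) + (ρ / 4) • e := by module
    have hc : a + θ • (b - a) ∈ Metric.ball z δ :=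
      (convex_ball z δ).add_smul_sub_mem ha.2 hb.2 hθ
    beta_reduce
    rw [h1]
    refine hinto _ (hball _ hc _ ⟨by linarith, le_rfl⟩) ?_
    rw [hshift, hinn]
    exact hηb _ (Metric.ball_subset_ball (min_le_right _ _) hc)

namespace Mesh
variable (𝒢 : Mesh Ω)

theorem inter_ball_nonempty {K : Finset (Vec d)} (hK : IsSimplex K) {z : Vec d} (hz : z ∈ simplex K)
    {δ : ℝ} (hδ : 0 < δ) : (interior (simplex K) ∩ Metric.ball z δ).Nonempty := by
  have h1 : z ∈ closure (interior (simplex K)) := by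
    rw [(convex_simplex K).closure_interior_eq_closure_of_nonempty_interior
      (interior_simplex_nonempty hK)]
    exact subset_closure hz
  obtain ⟨y, hy1, hy2⟩ := mem_closure_iff_nhds.1 h1 _ (Metric.ball_mem_nhds z hδ)
  exact ⟨y, hy2, hy1⟩

theorem mem_closure_of_mem_star {z : Vec d} {K : Finset (Vec d)} (hK : K ∈ 𝒢.star z) :
    z ∈ closure Ω :=
  𝒢.simplex_subset (𝒢.mem_star.1 hK).1 (mem_simplex_of_mem (𝒢.mem_star.1 hK).2)

/-- Near `z` only elements containing `z` are met, and in these `z` is a vertex since there are no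
hanging nodes. -/
theorem eventually_star {z : Vec d} {K₀ : Finset (Vec d)} (hK₀ : K₀ ∈ 𝒢.star z) :
    ∃ r > 0, ∀ x ∈ Metric.ball z r, ∀ K ∈ 𝒢.elems, x ∈ simplex K →
      K ∈ 𝒢.star z ∧ 0 < bary K z x := by
  have h1 := 𝒢.eventually_mem_simplex z
  have h2 : ∀ᶠ x in 𝓝 z, ∀ K ∈ 𝒢.elems, z ∈ K → 0 < bary K z x := by
    rw [Filter.eventually_all_finset]
    intro K hK
    by_cases hz : z ∈ K
    · have := bary_self (𝒢.isSimplex hK) hz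
      filter_upwards [(continuous_bary K z).continuousAt.eventually
        (lt_mem_nhds (by rw [this]; exact one_pos))] with x hx _
      exact hx
    · exact Eventually.of_forall fun _ h => absurd h hz
  obtain ⟨r, hr, hb⟩ := Metric.eventually_nhds_iff_ball.1 (h1.and h2)
  refine ⟨r, hr, fun x hx K hK hxK => ?_⟩
  obtain ⟨hK₀e, hzK₀⟩ := 𝒢.mem_star.1 hK₀
  have hzK := 𝒢.mem_of_mem_simplex hK₀e hK hzK₀ ((hb x hx).1 K hK hxK)
  exact ⟨𝒢.mem_star.2 ⟨hK, hzK⟩, (hb x hx).2 K hK hzK⟩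

/-- Interior points of `K` and `L` close to `z` are joined by a three-edge polygon in `Ω` near `z`.
For generic endpoints it avoids the codimension-two skeleton and so passes from element to element
through facets. The Lipschitz property excludes stars whose parts touch only in low-dimensional
faces. -/
theorem starGraph_preconnected (hΩ : IsLipschitzDomain Ω) (z : Vec d) :
    (𝒢.starGraph z).Preconnected := by
  intro K L
  have hzcl := 𝒢.mem_closure_of_mem_star K.2
  obtain ⟨r, hr, hstar⟩ := 𝒢.eventually_star K.2
  obtain ⟨u, δ, hδ, hδr, hpath⟩ := hΩ.exists_local_path hzcl hr
  obtain ⟨hKe, hzK⟩ := 𝒢.mem_star.1 K.2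
  obtain ⟨hLe, hzL⟩ := 𝒢.mem_star.1 L.2
  -- First `b` is chosen so that its line in direction `u` misses the skeleton. Then `a + u` is
  -- chosen generic relative to `b + u`, which takes care of both remaining edges.
  obtain ⟨b, hb, hbN, -⟩ := 𝒢.exists_generic (isOpen_interior.inter Metric.isOpen_ball)
    (inter_ball_nonempty (𝒢.isSimplex hLe) (mem_simplex_of_mem hzL) hδ) u 0
  have hO : IsOpen ((fun a => a - u) ⁻¹' (interior (simplex K.1) ∩ Metric.ball z δ)) :=
    (isOpen_interior.inter Metric.isOpen_ball).preimage (by fun_prop)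
  have hOne : ((fun a => a - u) ⁻¹' (interior (simplex K.1) ∩ Metric.ball z δ)).Nonempty := by
    obtain ⟨y, hy⟩ := inter_ball_nonempty (𝒢.isSimplex hKe) (mem_simplex_of_mem hzK) hδ
    exact ⟨y + u, by simpa using hy⟩
  obtain ⟨a', ha', haN, hab⟩ := 𝒢.exists_generic hO hOne u (b + u)
  obtain ⟨a, rfl⟩ : ∃ a, a' = a + u := ⟨a' - u, by abel⟩
  have ha : a ∈ interior (simplex K.1) ∩ Metric.ball z δ := by simpa using ha'
  have haΩ : a ∈ Ω ∩ Metric.ball z δ := ⟨𝒢.interior_subset hΩ hKe ha.1, ha.2⟩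
  have hbΩ : b ∈ Ω ∩ Metric.ball z δ := ⟨𝒢.interior_subset hΩ hLe hb.1, hb.2⟩
  have hbuN : b + u ∉ 𝒢.skeleton := by simpa using hbN 1
  set S := segment ℝ a (a + u) ∪ segment ℝ (a + u) (b + u) ∪ segment ℝ b (b + u)
  have hS : IsPreconnected S := by
    refine IsPreconnected.union (b + u) (Or.inr ?_) (right_mem_segment ..)
      (IsPreconnected.union (a + u) (right_mem_segment ..) (left_mem_segment ..)
        (convex_segment _ _).isPreconnected (convex_segment _ _).isPreconnected)
      (convex_segment _ _).isPreconnected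
    exact right_mem_segment ..
  have hSΩ : S ⊆ Ω ∩ Metric.ball z r :=
    union_subset (union_subset (hpath a haΩ).1 ((hpath a haΩ).2 b hbΩ)) (hpath b hbΩ).1
  refine 𝒢.reachable_of_isPreconnected hS (fun x hx => ?_) (fun x hx => ?_)
    ⟨a, Or.inl (Or.inl (left_mem_segment ..)), _root_.interior_subset ha.1⟩
    ⟨b, Or.inr (left_mem_segment ..), _root_.interior_subset hb.1⟩
  · obtain ⟨M, hM, hxM⟩ := 𝒢.exists_mem_simplex (subset_closure (hSΩ hx).1)
    exact ⟨M, (hstar x (hSΩ hx).2 M hM hxM).1, hxM⟩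
  · rcases hx with (hx | hx) | hx
    · rw [segment_eq_image'] at hx
      obtain ⟨θ, -, rfl⟩ := hx
      have e : a + θ • (a + u - a) = a + u + (θ - 1) • u := by module
      beta_reduce
      rw [e]; exact haN _
    · exact hab hbuN x hx
    · rw [segment_eq_image'] at hx
      obtain ⟨θ, -, rfl⟩ := hx
      have e : b + θ • (b + u - b) = b + θ • u := by module
      beta_reduce
      rw [e]; exact hbN _

open Classical in
/-- Every vertex outside `Ω` belongs to a facet that does not meet `Ω`. -/
theorem exists_boundary_facet (hΩ : IsLipschitzDomain Ω) {z : Vec d} (hzΩ : z ∉ Ω)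
    {K₀ : Finset (Vec d)} (hK₀ : K₀ ∈ 𝒢.star z) :
    ∃ K ∈ 𝒢.star z, ∃ v ∈ K, ∀ x ∈ simplex (K.erase v), x ∉ Ω := by
  have hzcl := 𝒢.mem_closure_of_mem_star hK₀
  obtain ⟨r, hr, hstar⟩ := 𝒢.eventually_star hK₀
  obtain ⟨hK₀e, hzK₀⟩ := 𝒢.mem_star.1 hK₀
  obtain ⟨b, hbr, hbcl⟩ := hΩ.exists_exterior hzcl hzΩ hr
  have hskel : ∀ x ∈ 𝒢.skeleton, x ∈ closure Ω := by
    intro x hx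
    simp only [skeleton, lowFaces, mem_iUnion, Finset.mem_biUnion, Finset.mem_filter,
      Finset.mem_powerset] at hx
    obtain ⟨G, ⟨K, hK, hGK, -⟩, hxG⟩ := hx
    exact 𝒢.simplex_subset hK (simplex_mono hGK hxG)
  -- A generic segment from inside `K₀` to the exterior point `b` misses the skeleton. At the last
  -- point where it lies in `closure Ω`, exactly one coordinate can vanish, which singles out the
  -- facet.
  obtain ⟨a, ha, -, hab⟩ := 𝒢.exists_generic (isOpen_interior.inter Metric.isOpen_ball)
    (inter_ball_nonempty (𝒢.isSimplex hK₀e) (mem_simplex_of_mem hzK₀) hr) 0 b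
  have hseg := hab fun h => hbcl (hskel b h)
  have hγ : Continuous fun t : ℝ => a + t • (b - a) := by fun_prop
  set T : Set ℝ := Icc 0 1 ∩ (fun t : ℝ => a + t • (b - a)) ⁻¹' closure Ω
  have hT : IsCompact T := isCompact_Icc.inter_right (isClosed_closure.preimage hγ)
  have h0T : (0 : ℝ) ∈ T := ⟨⟨le_rfl, zero_le_one⟩, by
    simpa using 𝒢.simplex_subset hK₀e (_root_.interior_subset ha.1)⟩
  obtain ⟨t, ⟨⟨ht0, ht1⟩, htcl⟩, htmax⟩ := hT.exists_isGreatest ⟨0, h0T⟩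
  set x := a + t • (b - a) with hx
  have hxcl : x ∈ closure Ω := htcl
  have htlt : t < 1 := by
    refine lt_of_le_of_ne ht1 fun h => hbcl ?_
    rw [hx, h] at hxcl
    simpa using hxcl
  have hxseg : x ∈ segment ℝ a b := by
    rw [segment_eq_image']; exact ⟨t, ⟨ht0, ht1⟩, rfl⟩
  have hxΩ : x ∉ Ω := by
    intro hxΩ
    have hev : ∀ᶠ s in 𝓝[>] t, a + s • (b - a) ∈ Ω :=
      nhdsWithin_le_nhds (hγ.continuousAt.preimage_mem_nhds (hΩ.isOpen.mem_nhds hxΩ))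
    obtain ⟨s, hsΩ, hs⟩ := (hev.and (Ioo_mem_nhdsGT htlt)).exists
    have : s ∈ T := ⟨⟨ht0.trans hs.1.le, hs.2.le⟩, subset_closure hsΩ⟩
    exact absurd (htmax this) (not_le.2 hs.1)
  have hxr : x ∈ Metric.ball z r := (convex_ball z r).segment_subset ha.2 hbr hxseg
  obtain ⟨K, hK, hxK⟩ := 𝒢.exists_mem_simplex hxcl
  obtain ⟨hKstar, hxz⟩ := hstar x hxr K hK hxK
  have hKs := 𝒢.isSimplex hK
  obtain ⟨v, hv, hxv⟩ : ∃ v ∈ K, bary K v x = 0 := by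
    by_contra hcon
    push Not at hcon
    refine hxΩ (𝒢.interior_subset hΩ hK ?_)
    rw [interior_simplex hKs]
    exact fun w hw => lt_of_le_of_ne (bary_nonneg hKs hxK w) (hcon w hw).symm
  refine ⟨K, hKstar, v, hv, fun x₀ hx₀ hx₀Ω => hxΩ ?_⟩
  obtain ⟨hx₀K, hx₀v⟩ := (mem_facet_iff hKs hv).1 hx₀
  -- A point of `Ω` on the facet would put `x` into `Ω`: a second vanishing coordinate of `x` is
  -- impossible, because `x` would then lie on the skeleton.
  refine 𝒢.mem_of_support hΩ hK hx₀Ω hx₀K hxK fun w hw hwx => ?_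
  by_cases hwv : w = v
  · rw [hwv]; exact hx₀v
  · exfalso
    refine hseg x hxseg (𝒢.mem_skeleton hK (G := (K.erase v).erase w) ?_ ?_ ?_)
    · exact (Finset.erase_subset _ _).trans (Finset.erase_subset _ _)
    · rw [Finset.card_erase_of_mem (Finset.mem_erase.2 ⟨hwv, hw⟩), Finset.card_erase_of_mem hv,
        hKs.card_eq]
      have : 0 < (K.erase v).card := Finset.card_pos.2 ⟨w, Finset.mem_erase.2 ⟨hwv, hw⟩⟩
      rw [Finset.card_erase_of_mem hv, hKs.card_eq] at this
      omega
    · rw [mem_face_iff hKs ((Finset.erase_subset _ _).trans (Finset.erase_subset _ _))]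
      refine ⟨hxK, fun y hy hyG => ?_⟩
      by_cases hyw : y = w
      · rw [hyw, hwx]
      · by_cases hyv : y = v
        · rw [hyv, hxv]
        · exact absurd (Finset.mem_erase.2 ⟨hyw, Finset.mem_erase.2 ⟨hyv, hy⟩⟩) hyG

end Mesh

/-! ### Shape regularity -/

/-- The diameter of a simplex. -/
noncomputable def ediam (K : Finset (Vec d)) : ℝ≥0∞ := ENNReal.ofReal (Metric.diam (simplex K))

theorem ediam_ne_top (K : Finset (Vec d)) : ediam K ≠ ⊤ := ENNReal.ofReal_ne_top

/-- Shape regularity of a single simplex. -/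
def IsRegular (σ : ℝ) (K : Finset (Vec d)) : Prop :=
  ∃ (x : Vec d) (ρ : ℝ), 0 < ρ ∧ Metric.closedBall x ρ ⊆ simplex K ∧
    Metric.diam (simplex K) ≤ σ * (2 * ρ)

theorem IsRegular.diam_pos (hd : 1 ≤ d) {σ : ℝ} {K : Finset (Vec d)} (h : IsRegular σ K) :
    0 < Metric.diam (simplex K) := by
  obtain ⟨x, ρ, hρ, hb, -⟩ := h
  have := two_mul_le_diam hd hρ hb
  linarith

theorem IsRegular.ediam_ne_zero (hd : 1 ≤ d) {σ : ℝ} {K : Finset (Vec d)} (h : IsRegular σ K) :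
    ediam K ≠ 0 := by
  rw [ediam, ne_eq, ENNReal.ofReal_eq_zero, not_le]; exact h.diam_pos hd

theorem IsRegular.one_le (hd : 1 ≤ d) {σ : ℝ} {K : Finset (Vec d)} (h : IsRegular σ K) : 1 ≤ σ := by
  obtain ⟨x, ρ, hρ, hb, hσ⟩ := h
  have := two_mul_le_diam hd hρ hb
  by_contra hlt
  nlinarith

theorem IsRegular.baryGrad_mul_ediam_le {σ : ℝ} {K : Finset (Vec d)} (h : IsRegular σ K)
    (hK : IsSimplex K) (v : Vec d) : ‖baryGrad K v‖ₑ * ediam K ≤ ENNReal.ofReal σ := by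
  obtain ⟨x, ρ, hρ, hb, hσ⟩ := h
  rw [← ofReal_norm, ediam, ← ENNReal.ofReal_mul (norm_nonneg _)]
  refine ENNReal.ofReal_le_ofReal ?_
  calc ‖baryGrad K v‖ * Metric.diam (simplex K) ≤ (1 / (2 * ρ)) * (σ * (2 * ρ)) :=
        mul_le_mul (norm_baryGrad_le hK hρ hb v) hσ Metric.diam_nonneg (by positivity)
    _ = σ := by field_simp

/-- `K'` lies in the ball about `z` whose radius is its diameter, while `K` contains a ball of
radius at least its diameter over `2σ`. -/
theorem IsRegular.volume_le (hd : 1 ≤ d) {σ : ℝ} {K K' : Finset (Vec d)} (h : IsRegular σ K)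
    {z : Vec d} (hz : z ∈ simplex K') {Λ : ℝ≥0∞} (hΛ : ediam K' ≤ Λ * ediam K) :
    volume (simplex K') ≤ (Λ * ENNReal.ofReal (2 * σ)) ^ d * volume (simplex K) := by
  have : Nonempty (Fin d) := ⟨⟨0, hd⟩⟩
  obtain ⟨x, ρ, hρ, hb, hσ⟩ := h
  have h1 : volume (simplex K') ≤ volume (Metric.closedBall z (Metric.diam (simplex K'))) :=
    measure_mono fun y hy => by
      rw [Metric.mem_closedBall, dist_eq_norm]; exact norm_sub_le_diam hy hz
  have h2 : volume (Metric.closedBall x ρ) ≤ volume (simplex K) := measure_mono hb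
  rw [Measure.addHaar_closedBall _ _ Metric.diam_nonneg, finrank_euclideanSpace,
    Fintype.card_fin, ENNReal.ofReal_pow Metric.diam_nonneg] at h1
  rw [Measure.addHaar_closedBall _ _ hρ.le, finrank_euclideanSpace, Fintype.card_fin,
    ENNReal.ofReal_pow hρ.le] at h2
  refine h1.trans ((?_ : _ ≤ _).trans (mul_le_mul_right h2 _))
  rw [← mul_assoc, ← mul_pow]
  gcongr
  refine hΛ.trans ?_
  rw [mul_assoc, ediam]
  gcongr
  rw [← ENNReal.ofReal_mul' hρ.le]
  exact ENNReal.ofReal_le_ofReal (by linarith)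

namespace Mesh
variable (𝒢 : Mesh Ω)

/-- Common points lie in the face of common vertices, which is proper because both vertex sets have
`d + 1` elements. -/
theorem interior_inter_simplex {K L : Finset (Vec d)} (hK : K ∈ 𝒢.elems) (hL : L ∈ 𝒢.elems)
    (hKL : K ≠ L) : Disjoint (interior (simplex K)) (simplex L) := by
  classical
  rw [Set.disjoint_left]
  intro x hxK hxL
  have hKs := 𝒢.isSimplex hK
  have hG := 𝒢.mem_convexHull_inter hK hL (_root_.interior_subset hxK) hxL
  rw [mem_face_iff hKs Finset.inter_subset_left] at hG
  obtain ⟨z, hzK, hzL⟩ : ∃ z ∈ K, z ∉ L := by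
    by_contra hcon
    push Not at hcon
    exact hKL (Finset.eq_of_subset_of_card_le hcon (by rw [𝒢.card_eq K hK, 𝒢.card_eq L hL]))
  rw [interior_simplex hKs] at hxK
  exact (hxK z hzK).ne' (hG.2 z hzK (by simp [hzL]))

theorem aedisjoint_simplex {K L : Finset (Vec d)} (hK : K ∈ 𝒢.elems) (hL : L ∈ 𝒢.elems)
    (hKL : K ≠ L) : AEDisjoint volume (simplex K) (simplex L) := by
  have hsub : simplex K ∩ simplex L ⊆ frontier (simplex K) := by
    rintro x ⟨hxK, hxL⟩
    rw [(isClosed_simplex K).frontier_eq]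
    exact ⟨hxK, fun h => disjoint_left.1 (𝒢.interior_inter_simplex hK hL hKL) h hxL⟩
  exact measure_mono_null hsub (volume_frontier_simplex K)

/-- A point of `closure Ω` outside `Ω` lies on the frontier of an element, and these frontiers are
null. Integrals over `Ω` thus split over elements. -/
theorem closure_ae_eq (𝒢 : Mesh Ω) (hΩ : IsLipschitzDomain Ω) : (closure Ω : Set (Vec d)) =ᵐ[volume] Ω := by
  refine (ae_le_set.2 ?_).antisymm (LE.le.eventuallyLE subset_closure)
  have hsub : closure Ω \ Ω ⊆ ⋃ K ∈ 𝒢.elems, frontier (simplex K) := by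
    rintro x ⟨hx, hxΩ⟩
    obtain ⟨K, hK, hxK⟩ := 𝒢.exists_mem_simplex hx
    refine mem_biUnion hK ?_
    rw [(isClosed_simplex K).frontier_eq]
    exact ⟨hxK, fun h => hxΩ (𝒢.interior_subset hΩ hK h)⟩
  exact measure_mono_null hsub
    ((measure_biUnion_null_iff 𝒢.elems.countable_toSet).2 fun K _ => volume_frontier_simplex K)

theorem restrict_eq_closure (𝒢 : Mesh Ω) (hΩ : IsLipschitzDomain Ω) :
    (volume.restrict Ω : Measure (Vec d)) = volume.restrict (closure Ω) :=
  (Measure.restrict_congr_set (𝒢.closure_ae_eq hΩ)).symm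

theorem setLIntegral_eq_sum (hΩ : IsLipschitzDomain Ω) (g : Vec d → ℝ≥0∞) :
    ∫⁻ x in Ω, g x = ∑ K ∈ 𝒢.elems, ∫⁻ x in simplex K, g x := by
  rw [𝒢.restrict_eq_closure hΩ, ← 𝒢.cover]
  exact lintegral_biUnion_finset₀
    (fun K hK L hL hKL => 𝒢.aedisjoint_simplex hK hL hKL)
    (fun K _ => (measurableSet_simplex K).nullMeasurableSet) _

theorem restrict_eq_sum (𝒢 : Mesh Ω) (hΩ : IsLipschitzDomain Ω) :
    (volume.restrict Ω : Measure (Vec d)) = ∑ K ∈ 𝒢.elems, volume.restrict (simplex K) := by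
  ext s hs
  have h := 𝒢.setLIntegral_eq_sum hΩ (s.indicator 1)
  simpa only [lintegral_indicator_one hs, Measure.finsetSum_apply] using h

theorem setIntegral_eq_sum (hΩ : IsLipschitzDomain Ω) {E : Type*} [NormedAddCommGroup E]
    [NormedSpace ℝ E] {g : Vec d → E} (hg : IntegrableOn g Ω) :
    ∫ x in Ω, g x = ∑ K ∈ 𝒢.elems, ∫ x in simplex K, g x := by
  have hsum := 𝒢.restrict_eq_sum hΩ
  rw [hsum]
  refine integral_finsetSum_measure fun K hK => ?_
  rw [IntegrableOn, 𝒢.restrict_eq_closure hΩ] at hg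
  exact hg.mono_measure (Measure.restrict_mono (𝒢.simplex_subset hK) le_rfl)

/-- Volume packing. Diameters in a star need not be known to be comparable yet, so each element is
first contracted towards `z` to the smallest diameter `R`. The contracted elements contain disjoint
balls of radius `R / (2 * σ)`, all inside the ball of radius `R` about `z`. -/
theorem card_star_le (hd : 1 ≤ d) {σ : ℝ} (hσ : 𝒢.ShapeRegular σ) (z : Vec d) :
    (𝒢.star z).card ≤ ⌊(2 * σ) ^ d⌋₊ := by
  have : Nonempty (Fin d) := ⟨⟨0, hd⟩⟩
  rcases (𝒢.star z).eq_empty_or_nonempty with hemp | hne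
  · simp [hemp]
  obtain ⟨K₀, hK₀, hmin⟩ := Finset.exists_min_image (𝒢.star z)
    (fun K => Metric.diam (simplex K)) hne
  have hreg : ∀ K ∈ 𝒢.star z, IsRegular σ K := fun K hK => hσ K (𝒢.mem_star.1 hK).1
  set R := Metric.diam (simplex K₀)
  have hR : 0 < R := (hreg K₀ hK₀).diam_pos hd
  have hσ1 := (hreg K₀ hK₀).one_le hd
  set ρ' := R / (2 * σ)
  have hρ' : 0 < ρ' := by positivity
  have hball : ∀ K ∈ 𝒢.star z, ∃ c, Metric.ball c ρ' ⊆ interior (simplex K) ∧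
      Metric.ball c ρ' ⊆ Metric.closedBall z R := by
    intro K hK
    obtain ⟨x, ρ, hρ, hb, hdiam⟩ := hreg K hK
    obtain ⟨hKe, hzK⟩ := 𝒢.mem_star.1 hK
    have hzK' := mem_simplex_of_mem hzK
    have hdK : 0 < Metric.diam (simplex K) := (hreg K hK).diam_pos hd
    set s := R / Metric.diam (simplex K)
    have hs0 : 0 < s := by positivity
    have hs1 : s ≤ 1 := (div_le_one hdK).2 (hmin K hK)
    have hsR : s * Metric.diam (simplex K) = R := div_mul_cancel₀ _ hdK.ne'
    have hρs : ρ' ≤ s * ρ := by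
      rw [div_le_iff₀ (by positivity), ← hsR]
      nlinarith
    have hpre : ∀ q ∈ Metric.ball (z + s • (x - z)) ρ', ∃ p ∈ simplex K, q = z + s • (p - z) := by
      intro q hq
      have e : q = z + s • ((z + s⁻¹ • (q - z)) - z) := by
        rw [add_sub_cancel_left, smul_inv_smul₀ hs0.ne', add_sub_cancel]
      refine ⟨z + s⁻¹ • (q - z), hb ?_, e⟩
      rw [Metric.mem_ball, dist_eq_norm] at hq
      rw [Metric.mem_closedBall, dist_eq_norm]
      have e2 : q - (z + s • (x - z)) = s • (z + s⁻¹ • (q - z) - x) := by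
        conv_lhs => rw [e]
        module
      rw [e2, norm_smul, Real.norm_of_nonneg hs0.le] at hq
      have := hq.le.trans hρs
      exact le_of_mul_le_mul_left this hs0
    refine ⟨z + s • (x - z), interior_maximal (fun q hq => ?_) Metric.isOpen_ball, fun q hq => ?_⟩
    · obtain ⟨p, hp, rfl⟩ := hpre q hq
      exact (convex_simplex K).add_smul_sub_mem hzK' hp ⟨hs0.le, hs1⟩
    · obtain ⟨p, hp, rfl⟩ := hpre q hq
      rw [Metric.mem_closedBall, dist_eq_norm, add_sub_cancel_left, norm_smul,
        Real.norm_of_nonneg hs0.le, ← hsR]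
      gcongr
      exact norm_sub_le_diam hp hzK'
  choose! c hc1 hc2 using hball
  have hdisj : Set.PairwiseDisjoint (𝒢.star z : Set (Finset (Vec d)))
      (fun K => Metric.ball (c K) ρ') := by
    intro K hK L hL hKL
    exact ((𝒢.interior_inter_simplex (𝒢.mem_star.1 hK).1 (𝒢.mem_star.1 hL).1 hKL).mono_right
      _root_.interior_subset).mono (hc1 K hK) (hc1 L hL)
  have hvol : ∑ K ∈ 𝒢.star z, volume (Metric.ball (c K) ρ') ≤ volume (Metric.closedBall z R) := by
    rw [← measure_biUnion_finset hdisj fun _ _ => measurableSet_ball]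
    exact measure_mono (iUnion₂_subset hc2)
  simp only [Measure.addHaar_ball _ _ hρ'.le, Measure.addHaar_closedBall _ _ hR.le,
    finrank_euclideanSpace, Fintype.card_fin, Finset.sum_const, nsmul_eq_mul] at hvol
  rw [← mul_assoc, ENNReal.mul_le_mul_iff_left (Metric.measure_ball_pos _ _ one_pos).ne'
    measure_ball_lt_top.ne, ← ENNReal.ofReal_natCast, ← ENNReal.ofReal_mul (by positivity),
    ENNReal.ofReal_le_ofReal_iff (by positivity)] at hvol
  refine Nat.le_floor ?_
  have e : R = ρ' * (2 * σ) := by simp only [ρ']; field_simp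
  have hρd : 0 < ρ' ^ d := by positivity
  rw [e, mul_pow, mul_comm] at hvol
  exact le_of_mul_le_mul_left hvol hρd

/-- For `d ≥ 2` a common facet contains an edge. It is no longer than the diameter of `K` and no
shorter than the inscribed diameter of `L`. -/
theorem ediam_le_of_adj (hd : 2 ≤ d) {σ : ℝ} (hσ : 𝒢.ShapeRegular σ) {z : Vec d} {K L : 𝒢.star z}
    (h : (𝒢.starGraph z).Adj K L) : ediam L.1 ≤ ENNReal.ofReal σ * ediam K.1 := by
  classical
  have hLe := (𝒢.mem_star.1 L.2).1
  have hcard : 1 < (K.1 ∩ L.1).card := lt_of_lt_of_le (by omega) h.2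
  obtain ⟨a, ha, b, hb, hab⟩ := Finset.one_lt_card.1 hcard
  rw [Finset.mem_inter] at ha hb
  have h1 : IsRegular σ L.1 := hσ _ hLe
  have hσ1 := h1.one_le (by omega)
  obtain ⟨x, ρ, hρ, hball, hdiam⟩ := h1
  have h2 := two_mul_le_norm_sub (𝒢.isSimplex hLe) hρ hball ha.2 hb.2 hab
  have h3 := norm_sub_le_diam (mem_simplex_of_mem ha.1) (mem_simplex_of_mem hb.1)
  rw [ediam, ediam, ← ENNReal.ofReal_mul (by linarith)]
  refine ENNReal.ofReal_le_ofReal (hdiam.trans ?_)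
  gcongr
  exact h2.trans h3

theorem ediam_le_of_walk (hd : 2 ≤ d) {σ : ℝ} (hσ : 𝒢.ShapeRegular σ) {z : Vec d} {K L : 𝒢.star z}
    (w : (𝒢.starGraph z).Walk K L) : ediam L.1 ≤ ENNReal.ofReal σ ^ w.length * ediam K.1 := by
  induction w with
  | nil => simp
  | cons h w ih =>
    rw [SimpleGraph.Walk.length_cons, pow_succ, mul_assoc]
    refine ih.trans ?_
    gcongr
    exact 𝒢.ediam_le_of_adj hd hσ h

/-- A walk without repetitions is shorter than the number of elements of the star. -/
theorem exists_walk (hd : 1 ≤ d) (hΩ : IsLipschitzDomain Ω) {σ : ℝ} (hσ : 𝒢.ShapeRegular σ)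
    {z : Vec d} (K L : 𝒢.star z) :
    ∃ w : (𝒢.starGraph z).Walk K L, w.length ≤ ⌊(2 * σ) ^ d⌋₊ := by
  classical
  obtain ⟨w⟩ := 𝒢.starGraph_preconnected hΩ z K L
  refine ⟨w.toPath, ((w.toPath.2.length_lt).le).trans ?_⟩
  rw [Fintype.card_coe]
  exact 𝒢.card_star_le hd hσ z

theorem ediam_le (hd : 2 ≤ d) (hΩ : IsLipschitzDomain Ω) {σ : ℝ} (hσ : 𝒢.ShapeRegular σ)
    {z : Vec d} {K L : Finset (Vec d)} (hK : K ∈ 𝒢.star z) (hL : L ∈ 𝒢.star z) :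
    ediam L ≤ ENNReal.ofReal σ ^ ⌊(2 * σ) ^ d⌋₊ * ediam K := by
  obtain ⟨w, hw⟩ := 𝒢.exists_walk (by omega) hΩ hσ ⟨K, hK⟩ ⟨L, hL⟩
  refine (𝒢.ediam_le_of_walk hd hσ w).trans ?_
  have hσ1 : 1 ≤ σ := IsRegular.one_le (by omega) (hσ K (𝒢.mem_star.1 hK).1)
  gcongr
  exact ENNReal.one_le_ofReal.2 hσ1

end Mesh

/-! ### A quasi-interpolation operator -/

section facetPoincare
variable {K : Finset (Vec d)} {v : Vec d} {φ : Vec d → Vec d} {p : ℝ}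

theorem measurable_enorm_sub_rpow (hφ : Continuous φ) (a : Vec d) (p : ℝ) :
    Measurable fun x => ‖φ x - a‖ₑ ^ p :=
  (Continuous.measurable (by fun_prop : Continuous fun x => ‖φ x - a‖ₑ)).pow_const _

theorem enorm_sub_rpow_mul_le {μ : Measure (Vec d)} (hφ : Continuous φ) (hp : 1 < p) (a b : Vec d) :
    μ univ * ‖a - b‖ₑ ^ p ≤
      2 ^ (p - 1) * ((∫⁻ x, ‖φ x - a‖ₑ ^ p ∂μ) + ∫⁻ x, ‖φ x - b‖ₑ ^ p ∂μ) := by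
  have hm := measurable_enorm_sub_rpow hφ a p
  rw [← lintegral_add_left hm, ← lintegral_const_mul' _ _ (by finiteness), mul_comm,
    ← lintegral_const]
  refine lintegral_mono fun x => ?_
  refine le_trans (ENNReal.rpow_le_rpow ?_ (by positivity))
    (ENNReal.rpow_add_le_mul_rpow_add_rpow _ _ hp.le)
  have e : a - b = -(φ x - a) + (φ x - b) := by abel
  rw [e]
  exact (enorm_add_le _ _).trans (by rw [enorm_neg])

open Classical in
-- The trace inequality for `φ - a`, with the Poincaré bound inserted. The extra factor `ediam K`
-- compensates the inverse height `‖baryGrad K v‖` by shape regularity.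
theorem facet_poincare (hd : 1 ≤ d) {σ : ℝ} (hr : IsRegular σ K) (hK : IsSimplex K) (hv : v ∈ K)
    (hφ : ContDiff ℝ 1 φ) (hp : 1 < p) {a : Vec d}
    (ha : ∫⁻ x in simplex K, ‖φ x - a‖ₑ ^ p ≤
      2 ^ d * ediam K ^ p * ∫⁻ x in simplex K, ‖fderiv ℝ φ x‖ₑ ^ p) :
    ediam K * ∫⁻ x, ‖φ x - a‖ₑ ^ p ∂facetMeasure (K.erase v) ≤
      2 ^ p * 2 ^ d * (2 ^ d + 1) * ENNReal.ofReal σ *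
        (ediam K ^ p * ∫⁻ x in simplex K, ‖fderiv ℝ φ x‖ₑ ^ p) := by
  have h1 := lintegral_facet_le hd hK hv (hφ.sub (contDiff_const (c := a))) hp
  have h2 : ∀ x, fderiv ℝ (fun y => φ y - a) x = fderiv ℝ φ x := fun x => by
    rw [fderiv_sub_const]
  simp only [h2] at h1
  set I := ∫⁻ x in simplex K, ‖fderiv ℝ φ x‖ₑ ^ p
  calc _ ≤ ediam K * (2 ^ p * 2 ^ d * ‖baryGrad K v‖ₑ *
        (2 ^ d * ediam K ^ p * I + ediam K ^ p * I)) := by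
        gcongr
        refine h1.trans ?_
        gcongr
        exact le_rfl
    _ = 2 ^ p * 2 ^ d * (2 ^ d + 1) * (‖baryGrad K v‖ₑ * ediam K) * (ediam K ^ p * I) := by ring
    _ ≤ _ := by
        gcongr
        exact hr.baryGrad_mul_ediam_le hK v

open Classical in
-- Volume is at most diameter times facet area, so two constants can be compared through the values
-- of `φ` on a single facet.
theorem volume_mul_enorm_sub_le (hd : 1 ≤ d) {σ : ℝ} (hr : IsRegular σ K) (hK : IsSimplex K)
    (hv : v ∈ K) (hφ : ContDiff ℝ 1 φ) (hp : 1 < p) {a : Vec d}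
    (ha : ∫⁻ x in simplex K, ‖φ x - a‖ₑ ^ p ≤
      2 ^ d * ediam K ^ p * ∫⁻ x in simplex K, ‖fderiv ℝ φ x‖ₑ ^ p) (b : Vec d) :
    volume (simplex K) * ‖a - b‖ₑ ^ p ≤ 2 ^ (p - 1) * (2 ^ p * 2 ^ d * (2 ^ d + 1) *
      ENNReal.ofReal σ * (ediam K ^ p * ∫⁻ x in simplex K, ‖fderiv ℝ φ x‖ₑ ^ p) +
        ediam K * ∫⁻ x, ‖φ x - b‖ₑ ^ p ∂facetMeasure (K.erase v)) := by
  calc volume (simplex K) * ‖a - b‖ₑ ^ p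
      ≤ ediam K * (facetMeasure (K.erase v) univ * ‖a - b‖ₑ ^ p) := by
        rw [← mul_assoc]
        gcongr
        exact volume_simplex_le hd hK hv
    _ ≤ ediam K * (2 ^ (p - 1) * ((∫⁻ x, ‖φ x - a‖ₑ ^ p ∂facetMeasure (K.erase v)) +
        ∫⁻ x, ‖φ x - b‖ₑ ^ p ∂facetMeasure (K.erase v))) := by
        gcongr ediam K * ?_
        exact enorm_sub_rpow_mul_le hφ.continuous hp a b
    _ = 2 ^ (p - 1) * (ediam K * (∫⁻ x, ‖φ x - a‖ₑ ^ p ∂facetMeasure (K.erase v)) +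
        ediam K * ∫⁻ x, ‖φ x - b‖ₑ ^ p ∂facetMeasure (K.erase v)) := by ring
    _ ≤ _ := by
        gcongr 2 ^ (p - 1) * (?_ + _)
        exact facet_poincare hd hr hK hv hφ hp ha

end facetPoincare

namespace Mesh

/-- On the line neighbours share only a point, and shape regularity does not make their lengths
comparable, so chaining is unavailable. It is not needed: the facet of `K` at `z` is `{z}`, and `φ
z` itself is a nodal value, zero outside `Ω`. -/
theorem star_poincare_one_dim {σ p : ℝ} (hp : 1 < p) :
    ∃ C : ℝ≥0∞, C ≠ ⊤ ∧ ∀ (Ω : Set (Vec 1)) (𝒢 : Mesh Ω), 𝒢.ShapeRegular σ →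
      ∀ φ : Vec 1 → Vec 1, ContDiff ℝ 1 φ → (∀ x ∉ Ω, φ x = 0) → ∀ z, ∃ c : Vec 1,
        (z ∉ Ω → c = 0) ∧ ∀ K ∈ 𝒢.star z, ∫⁻ x in simplex K, ‖φ x - c‖ₑ ^ p ≤
          C * ediam K ^ p * ∑ L ∈ 𝒢.star z, ∫⁻ x in simplex L, ‖fderiv ℝ φ x‖ₑ ^ p := by
  classical
  refine ⟨2 ^ (p - 1) * (2 ^ 1 + 2 ^ (p - 1) * (2 ^ p * 2 ^ 1 * (2 ^ 1 + 1) * ENNReal.ofReal σ)),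
    by finiteness, fun Ω 𝒢 hσ φ hφ hφΩ z => ⟨φ z, hφΩ z, fun K hK => ?_⟩⟩
  obtain ⟨hKe, hzK⟩ := 𝒢.mem_star.1 hK
  have hKs := 𝒢.isSimplex hKe
  obtain ⟨a, ha⟩ := exists_poincare_const hKs hφ hp
  obtain ⟨v, hv, hvz⟩ := Finset.exists_mem_ne (by rw [hKs.card_eq]; norm_num) z
  have hF : K.erase v = {z} := by
    refine (Finset.eq_of_subset_of_card_le (Finset.singleton_subset_iff.2
      (Finset.mem_erase.2 ⟨hvz.symm, hzK⟩)) ?_).symm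
    rw [Finset.card_erase_of_mem hv, hKs.card_eq]; simp
  have h1 := volume_mul_enorm_sub_le le_rfl (hσ K hKe) hKs hv hφ hp ha (φ z)
  have h2 : ∫⁻ x, ‖φ x - φ z‖ₑ ^ p ∂facetMeasure (K.erase v) = 0 := by
    rw [facetMeasure, lintegral_eq_zero_iff' (measurable_enorm_sub_rpow hφ.continuous _ _).aemeasurable]
    filter_upwards [ae_restrict_mem (measurableSet_simplex _)] with x hx
    rw [hF, simplex, Finset.coe_singleton, convexHull_singleton, mem_singleton_iff] at hx
    simp [hx, (by linarith : 0 < p)]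
  rw [h2, mul_zero, add_zero] at h1
  set IK := ∫⁻ x in simplex K, ‖fderiv ℝ φ x‖ₑ ^ p
  have hIK : IK ≤ ∑ L ∈ 𝒢.star z, ∫⁻ x in simplex L, ‖fderiv ℝ φ x‖ₑ ^ p :=
    Finset.single_le_sum (f := fun L => ∫⁻ x in simplex L, ‖fderiv ℝ φ x‖ₑ ^ p)
      (fun _ _ => zero_le) hK
  have h3 := enorm_sub_rpow_mul_le (μ := volume.restrict (simplex K)) hφ.continuous hp a (φ z)
  calc ∫⁻ x in simplex K, ‖φ x - φ z‖ₑ ^ p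
      ≤ ∫⁻ x in simplex K, 2 ^ (p - 1) * (‖φ x - a‖ₑ ^ p + ‖a - φ z‖ₑ ^ p) := by
        refine lintegral_mono fun x => ?_
        refine le_trans (ENNReal.rpow_le_rpow ?_ (by positivity))
          (ENNReal.rpow_add_le_mul_rpow_add_rpow _ _ hp.le)
        have e : φ x - φ z = (φ x - a) + (a - φ z) := by abel
        rw [e]; exact enorm_add_le _ _
    _ = 2 ^ (p - 1) * ((∫⁻ x in simplex K, ‖φ x - a‖ₑ ^ p) +
          volume (simplex K) * ‖a - φ z‖ₑ ^ p) := by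
        rw [lintegral_const_mul' _ _ (by finiteness),
          lintegral_add_left (measurable_enorm_sub_rpow hφ.continuous _ _), setLIntegral_const,
          mul_comm (volume _)]
    _ ≤ 2 ^ (p - 1) * (2 ^ 1 * ediam K ^ p * IK + 2 ^ (p - 1) * (2 ^ p * 2 ^ 1 * (2 ^ 1 + 1) *
          ENNReal.ofReal σ * (ediam K ^ p * IK))) := by
        gcongr
        exact ha
    _ = 2 ^ (p - 1) * (2 ^ 1 + 2 ^ (p - 1) * (2 ^ p * 2 ^ 1 * (2 ^ 1 + 1) * ENNReal.ofReal σ)) *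
          ediam K ^ p * IK := by ring
    _ ≤ _ := by gcongr

open Classical in
theorem erase_eq_inter_of_adj {𝒢 : Mesh Ω} {z : Vec d} {K L : 𝒢.star z}
    (h : (𝒢.starGraph z).Adj K L) :
    ∃ v ∈ K.1, K.1.erase v = K.1 ∩ L.1 := by
  have hKc := (𝒢.isSimplex (𝒢.mem_star.1 K.2).1).card_eq
  have hLc := (𝒢.isSimplex (𝒢.mem_star.1 L.2).1).card_eq
  have hlt : (K.1 ∩ L.1).card < K.1.card := by
    refine Finset.card_lt_card (Finset.inter_subset_left.ssubset_of_ne fun heq => h.1 ?_)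
    exact Subtype.ext (Finset.eq_of_subset_of_card_le (Finset.inter_eq_left.1 heq) (by omega))
  obtain ⟨v, hv⟩ : ∃ v, K.1 \ (K.1 ∩ L.1) = {v} := by
    rw [← Finset.card_eq_one, Finset.card_sdiff_of_subset Finset.inter_subset_left]
    have := h.2
    omega
  have hvK : v ∈ K.1 \ (K.1 ∩ L.1) := by rw [hv]; simp
  refine ⟨v, (Finset.mem_sdiff.1 hvK).1, ?_⟩
  rw [Finset.erase_eq, ← hv, Finset.sdiff_sdiff_eq_self Finset.inter_subset_left]

theorem enorm_sub_le_of_walk {𝒢 : Mesh Ω} {z : Vec d} {a : Finset (Vec d) → Vec d} {D : ℝ≥0∞}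
    (hD : ∀ K L : 𝒢.star z, (𝒢.starGraph z).Adj K L → ‖a K - a L‖ₑ ≤ D) {K L : 𝒢.star z}
    (w : (𝒢.starGraph z).Walk K L) : ‖a K - a L‖ₑ ≤ w.length * D := by
  induction w with
  | nil => simp
  | @cons u v w h q ih =>
    rw [SimpleGraph.Walk.length_cons, Nat.cast_add, Nat.cast_one, add_mul, one_mul, add_comm]
    have e : a u - a w = (a u - a v) + (a v - a w) := by abel
    rw [e]
    exact (enorm_add_le _ _).trans (add_le_add (hD _ _ h) ih)

/-- Every element of the star has its own Poincaré constant `a K`. Constants of neighbours are close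
because both approximate `φ` on the common facet, and a walk of bounded length spreads this over the
star. If `z ∉ Ω`, a boundary facet plays the role of one more neighbour, with constant zero. -/
theorem star_poincare_of_two_le (hd : 2 ≤ d) {σ p : ℝ} (hp : 1 < p) :
    ∃ C : ℝ≥0∞, C ≠ ⊤ ∧ ∀ (Ω : Set (Vec d)), IsLipschitzDomain Ω → ∀ 𝒢 : Mesh Ω, 𝒢.ShapeRegular σ →
      ∀ φ : Vec d → Vec d, ContDiff ℝ 1 φ → (∀ x ∉ Ω, φ x = 0) → ∀ z, ∃ c : Vec d,
        (z ∉ Ω → c = 0) ∧ ∀ K ∈ 𝒢.star z, ∫⁻ x in simplex K, ‖φ x - c‖ₑ ^ p ≤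
          C * ediam K ^ p * ∑ L ∈ 𝒢.star z, ∫⁻ x in simplex L, ‖fderiv ℝ φ x‖ₑ ^ p := by
  classical
  have hd1 : 1 ≤ d := by omega
  -- `N` bounds the size of a star and the walk lengths, `Λ` the ratios of diameters, `W` the ratios
  -- of volumes; `B` is the constant of `facet_poincare`, and `C₂` that of one comparison.
  set N := ⌊(2 * σ) ^ d⌋₊
  set Λ : ℝ≥0∞ := ENNReal.ofReal σ ^ N
  set W : ℝ≥0∞ := (Λ * ENNReal.ofReal (2 * σ)) ^ d
  set B : ℝ≥0∞ := 2 ^ p * 2 ^ d * (2 ^ d + 1) * ENNReal.ofReal σ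
  set C₂ : ℝ≥0∞ := W * (2 ^ (p - 1) * (B * (1 + Λ) * Λ ^ p))
  have hΛt : Λ ≠ ⊤ := by finiteness
  have hWt : W ≠ ⊤ := by finiteness
  have hBt : B ≠ ⊤ := by finiteness
  have hC₂t : C₂ ≠ ⊤ := by finiteness
  refine ⟨2 ^ (p - 1) * (2 ^ d + (N + 1) ^ p * C₂), by finiteness,
    fun Ω hΩ 𝒢 hσ φ hφ hφΩ z => ?_⟩
  rcases (𝒢.star z).eq_empty_or_nonempty with hemp | ⟨K₀, hK₀⟩
  · exact ⟨0, fun _ => rfl, fun K hK => by simp [hemp] at hK⟩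
  have hreg : ∀ K ∈ 𝒢.star z, IsRegular σ K := fun K hK => hσ K (𝒢.mem_star.1 hK).1
  have hspx : ∀ K ∈ 𝒢.star z, IsSimplex K := fun K hK => 𝒢.isSimplex (𝒢.mem_star.1 hK).1
  have hΛ : ∀ K ∈ 𝒢.star z, ∀ L ∈ 𝒢.star z, ediam L ≤ Λ * ediam K :=
    fun K hK L hL => 𝒢.ediam_le hd hΩ hσ hK hL
  have hpoin : ∀ K ∈ 𝒢.star z, ∃ a, ∫⁻ x in simplex K, ‖φ x - a‖ₑ ^ p ≤
      2 ^ d * ediam K ^ p * ∫⁻ x in simplex K, ‖fderiv ℝ φ x‖ₑ ^ p :=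
    fun K hK => exists_poincare_const (hspx K hK) hφ hp
  choose! a ha using hpoin
  set I : ℝ≥0∞ := ∑ L ∈ 𝒢.star z, ∫⁻ x in simplex L, ‖fderiv ℝ φ x‖ₑ ^ p
  have hI : ∀ K ∈ 𝒢.star z, ∫⁻ x in simplex K, ‖fderiv ℝ φ x‖ₑ ^ p ≤ I := fun K hK =>
    Finset.single_le_sum (f := fun L => ∫⁻ x in simplex L, ‖fderiv ℝ φ x‖ₑ ^ p)
      (fun _ _ => zero_le) hK
  -- comparison with a facet, scaled to an arbitrary element of the star
  have hscale : ∀ K' ∈ 𝒢.star z, ∀ K ∈ 𝒢.star z, ∀ v ∈ K, ∀ b : Vec d,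
      ediam K * ∫⁻ x, ‖φ x - b‖ₑ ^ p ∂facetMeasure (K.erase v) ≤
        Λ * B * (Λ ^ p * ediam K' ^ p * I) →
      volume (simplex K') * ‖a K - b‖ₑ ^ p ≤ C₂ * ediam K' ^ p * I := by
    intro K' hK' K hK v hv b hb
    have h1 := volume_mul_enorm_sub_le hd1 (hreg K hK) (hspx K hK) hv hφ hp (ha K hK) b
    have h2 := (hreg K hK).volume_le hd1 (mem_simplex_of_mem (𝒢.mem_star.1 hK').2)
      (hΛ K hK K' hK')
    have h3 : ediam K ^ p ≤ Λ ^ p * ediam K' ^ p := by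
      rw [← ENNReal.mul_rpow_of_nonneg _ _ (by positivity)]
      exact ENNReal.rpow_le_rpow (hΛ K' hK' K hK) (by positivity)
    calc volume (simplex K') * ‖a K - b‖ₑ ^ p
        ≤ W * volume (simplex K) * ‖a K - b‖ₑ ^ p := by gcongr
      _ = W * (volume (simplex K) * ‖a K - b‖ₑ ^ p) := by ring
      _ ≤ W * (2 ^ (p - 1) * (B * ((Λ ^ p * ediam K' ^ p) * I) +
            Λ * B * (Λ ^ p * ediam K' ^ p * I))) := by
          gcongr W * ?_
          refine h1.trans ?_
          gcongr 2 ^ (p - 1) * ?_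
          exact add_le_add (mul_le_mul' le_rfl (mul_le_mul' h3 (hI K hK))) hb
      _ = _ := by simp only [C₂]; ring
  have hadj : ∀ K' ∈ 𝒢.star z, ∀ K L : 𝒢.star z, (𝒢.starGraph z).Adj K L →
      volume (simplex K') * ‖a K - a L‖ₑ ^ p ≤ C₂ * ediam K' ^ p * I := by
    intro K' hK' K L hKL
    obtain ⟨v, hv, hvF⟩ := erase_eq_inter_of_adj hKL
    obtain ⟨w, hw, hwF⟩ := erase_eq_inter_of_adj hKL.symm
    refine hscale K' hK' K K.2 v hv _ ?_
    have hFF : K.1.erase v = L.1.erase w := by rw [hvF, hwF, Finset.inter_comm]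
    rw [hFF]
    have h1 := facet_poincare hd1 (hreg L L.2) (hspx L L.2) hw hφ hp (ha L L.2)
    have h3 : ediam L.1 ^ p ≤ Λ ^ p * ediam K' ^ p := by
      rw [← ENNReal.mul_rpow_of_nonneg _ _ (by positivity)]
      exact ENNReal.rpow_le_rpow (hΛ K' hK' L L.2) (by positivity)
    calc _ ≤ Λ * ediam L.1 * ∫⁻ x, ‖φ x - a L‖ₑ ^ p ∂facetMeasure (L.1.erase w) := by
          gcongr
          exact hΛ L L.2 K K.2
      _ = Λ * (ediam L.1 * ∫⁻ x, ‖φ x - a L‖ₑ ^ p ∂facetMeasure (L.1.erase w)) := by ring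
      _ ≤ Λ * (B * (Λ ^ p * ediam K' ^ p * I)) := by
          gcongr Λ * ?_
          exact h1.trans (mul_le_mul' le_rfl (mul_le_mul' h3 (hI L L.2)))
      _ = _ := by ring
  -- the nodal value
  obtain ⟨c, K₁, hK₁, hc0, hc⟩ : ∃ c : Vec d, ∃ K₁ ∈ 𝒢.star z, (z ∉ Ω → c = 0) ∧
      ∀ K' ∈ 𝒢.star z, volume (simplex K') * ‖a K₁ - c‖ₑ ^ p ≤ C₂ * ediam K' ^ p * I := by
    by_cases hz : z ∈ Ω
    · refine ⟨a K₀, K₀, hK₀, fun h => absurd hz h, fun K' _ => ?_⟩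
      rw [sub_self, enorm_zero, ENNReal.zero_rpow_of_pos (by linarith), mul_zero]
      exact zero_le
    · obtain ⟨K, hK, v, hv, hF⟩ := 𝒢.exists_boundary_facet hΩ hz hK₀
      refine ⟨0, K, hK, fun _ => rfl, fun K' hK' => hscale K' hK' K hK v hv 0 ?_⟩
      have : ∫⁻ x, ‖φ x - 0‖ₑ ^ p ∂facetMeasure (K.erase v) = 0 := by
        rw [facetMeasure,
          lintegral_eq_zero_iff' (measurable_enorm_sub_rpow hφ.continuous _ _).aemeasurable]
        filter_upwards [ae_restrict_mem (measurableSet_simplex _)] with x hx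
        simp [hφΩ x (hF x hx), (by linarith : 0 < p)]
      rw [this, mul_zero]
      exact zero_le
  refine ⟨c, hc0, fun K hK => ?_⟩
  have hv0 : volume (simplex K) ≠ 0 := (volume_simplex_pos (hspx K hK)).ne'
  have hvt : volume (simplex K) ≠ ⊤ := (volume_simplex_lt_top K).ne
  set X : ℝ≥0∞ := C₂ * ediam K ^ p * I
  -- All comparisons are normalised by the volume of the same element `K`. Dividing it out gives one
  -- bound `D` for each step, so the triangle inequality can be summed along the walk, plus one step
  -- to the nodal value.
  set D : ℝ≥0∞ := (X / volume (simplex K)) ^ (1 / p)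
  have hp0 : 0 < p := by linarith
  have hDle : ∀ e : Vec d, volume (simplex K) * ‖e‖ₑ ^ p ≤ X → ‖e‖ₑ ≤ D := by
    intro e he
    have : ‖e‖ₑ ^ p ≤ X / volume (simplex K) := by
      rw [ENNReal.le_div_iff_mul_le (Or.inl hv0) (Or.inl hvt), mul_comm]; exact he
    have := ENNReal.rpow_le_rpow this (z := 1 / p) (by positivity)
    rwa [← ENNReal.rpow_mul, mul_one_div_cancel hp0.ne', ENNReal.rpow_one] at this
  have hDp : volume (simplex K) * D ^ p = X := by
    rw [← ENNReal.rpow_mul, one_div_mul_cancel hp0.ne', ENNReal.rpow_one,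
      ENNReal.mul_div_cancel hv0 hvt]
  obtain ⟨w, hw⟩ := 𝒢.exists_walk hd1 hΩ hσ ⟨K, hK⟩ ⟨K₁, hK₁⟩
  have h1 : ‖a K - a K₁‖ₑ ≤ w.length * D :=
    enorm_sub_le_of_walk (fun L M hLM => hDle _ (hadj K hK L M hLM)) w
  have h2 : ‖a K₁ - c‖ₑ ≤ D := hDle _ (hc K hK)
  have h3 : ‖a K - c‖ₑ ≤ (N + 1) * D := by
    have e : a K - c = (a K - a K₁) + (a K₁ - c) := by abel
    rw [e, add_mul, one_mul]
    refine (enorm_add_le _ _).trans (add_le_add (h1.trans ?_) h2)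
    gcongr
  calc ∫⁻ x in simplex K, ‖φ x - c‖ₑ ^ p
      ≤ ∫⁻ x in simplex K, 2 ^ (p - 1) * (‖φ x - a K‖ₑ ^ p + ‖a K - c‖ₑ ^ p) := by
        refine lintegral_mono fun x => ?_
        refine le_trans (ENNReal.rpow_le_rpow ?_ (by positivity))
          (ENNReal.rpow_add_le_mul_rpow_add_rpow _ _ hp.le)
        have e : φ x - c = (φ x - a K) + (a K - c) := by abel
        rw [e]; exact enorm_add_le _ _
    _ = 2 ^ (p - 1) * ((∫⁻ x in simplex K, ‖φ x - a K‖ₑ ^ p) +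
          volume (simplex K) * ‖a K - c‖ₑ ^ p) := by
        rw [lintegral_const_mul' _ _ (by finiteness),
          lintegral_add_left (measurable_enorm_sub_rpow hφ.continuous _ _), setLIntegral_const,
          mul_comm (volume _)]
    _ ≤ 2 ^ (p - 1) * (2 ^ d * ediam K ^ p * I + volume (simplex K) * ((N + 1) * D) ^ p) := by
        gcongr
        refine (ha K hK).trans ?_
        gcongr
        exact hI K hK
    _ = 2 ^ (p - 1) * (2 ^ d * ediam K ^ p * I + (N + 1) ^ p * X) := by
        rw [ENNReal.mul_rpow_of_nonneg _ _ hp0.le, mul_left_comm, hDp]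
    _ = _ := by simp only [X]; ring

theorem star_poincare (hd : 1 ≤ d) (σ : ℝ) {p : ℝ} (hp : 1 < p) :
    ∃ C : ℝ≥0∞, C ≠ ⊤ ∧ ∀ (Ω : Set (Vec d)), IsLipschitzDomain Ω → ∀ 𝒢 : Mesh Ω, 𝒢.ShapeRegular σ →
      ∀ φ : Vec d → Vec d, ContDiff ℝ 1 φ → (∀ x ∉ Ω, φ x = 0) → ∃ c : Vec d → Vec d,
        (∀ z ∉ Ω, c z = 0) ∧ ∀ z, ∀ K ∈ 𝒢.star z, ∫⁻ x in simplex K, ‖φ x - c z‖ₑ ^ p ≤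
          C * ediam K ^ p * ∑ L ∈ 𝒢.star z, ∫⁻ x in simplex L, ‖fderiv ℝ φ x‖ₑ ^ p := by
  have key : ∃ C : ℝ≥0∞, C ≠ ⊤ ∧ ∀ (Ω : Set (Vec d)), IsLipschitzDomain Ω → ∀ 𝒢 : Mesh Ω,
      𝒢.ShapeRegular σ →
      ∀ φ : Vec d → Vec d, ContDiff ℝ 1 φ → (∀ x ∉ Ω, φ x = 0) → ∀ z, ∃ c : Vec d,
        (z ∉ Ω → c = 0) ∧ ∀ K ∈ 𝒢.star z, ∫⁻ x in simplex K, ‖φ x - c‖ₑ ^ p ≤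
          C * ediam K ^ p * ∑ L ∈ 𝒢.star z, ∫⁻ x in simplex L, ‖fderiv ℝ φ x‖ₑ ^ p := by
    rcases hd.eq_or_lt with rfl | hd2
    · obtain ⟨C, hC, h⟩ := star_poincare_one_dim (σ := σ) hp
      exact ⟨C, hC, fun Ω _ => h Ω⟩
    · exact star_poincare_of_two_le hd2 hp
  obtain ⟨C, hC, h⟩ := key
  refine ⟨C, hC, fun Ω hΩ 𝒢 hσ φ hφ hφΩ => ?_⟩
  choose c hc1 hc2 using h Ω hΩ 𝒢 hσ φ hφ hφΩ
  exact ⟨c, hc1, hc2⟩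

end Mesh

/-- The affine function on the simplex `K` with the nodal values `c`. -/
noncomputable def nodalAffine (c : Vec d → Vec d) (K : Finset (Vec d)) (x : Vec d) : Vec d :=
  ∑ z ∈ K, bary K z x • c z

/-- The interpolation error on the simplex `K`. -/
noncomputable def interpError (φ c : Vec d → Vec d) (K : Finset (Vec d)) (x : Vec d) : Vec d :=
  φ x - nodalAffine c K x

section interp
variable {K : Finset (Vec d)} {φ c : Vec d → Vec d} {p : ℝ}

theorem hasFDerivAt_bary (K : Finset (Vec d)) (z x : Vec d) :
    HasFDerivAt (bary K z) (innerSL ℝ (baryGrad K z)) x := by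
  have e : (bary K z : Vec d → ℝ) = fun y => bary K z 0 + innerSL ℝ (baryGrad K z) y := by
    ext y
    have := bary_add K z 0 y
    rw [zero_add] at this
    rw [this]; rfl
  rw [e]
  exact (innerSL ℝ (baryGrad K z)).hasFDerivAt.const_add _

theorem contDiff_bary {n : WithTop ℕ∞} (K : Finset (Vec d)) (z : Vec d) : ContDiff ℝ n (bary K z) := by
  have e : (bary K z : Vec d → ℝ) = fun y => bary K z 0 + innerSL ℝ (baryGrad K z) y := by
    ext y
    have := bary_add K z 0 y
    rw [zero_add] at this
    rw [this]; rfl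
  rw [e]
  exact contDiff_const.add (innerSL ℝ (baryGrad K z)).contDiff

theorem contDiff_nodalAffine {n : WithTop ℕ∞} (c : Vec d → Vec d) (K : Finset (Vec d)) :
    ContDiff ℝ n (nodalAffine c K) :=
  ContDiff.sum fun z _ => (contDiff_bary K z).smul contDiff_const

theorem hasFDerivAt_nodalAffine (c : Vec d → Vec d) (K : Finset (Vec d)) (x : Vec d) :
    HasFDerivAt (nodalAffine c K)
      (∑ z ∈ K, (innerSL ℝ (baryGrad K z)).smulRight (c z)) x :=
  HasFDerivAt.fun_sum fun z _ => (hasFDerivAt_bary K z x).smul_const (c z)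

/-- The coordinates form a partition of unity, so the error is a weighted mean of the differences
controlled by the star Poincaré inequality. -/
theorem interpError_eq (hK : IsSimplex K) (φ c : Vec d → Vec d) (x : Vec d) :
    interpError φ c K x = ∑ z ∈ K, bary K z x • (φ x - c z) := by
  simp only [interpError, nodalAffine, smul_sub, Finset.sum_sub_distrib, ← Finset.sum_smul,
    sum_bary hK, one_smul]

theorem contDiff_interpError (hφ : ContDiff ℝ 1 φ) (c : Vec d → Vec d) (K : Finset (Vec d)) :
    ContDiff ℝ 1 (interpError φ c K) := hφ.sub (contDiff_nodalAffine c K)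

theorem enorm_interpError_le (hK : IsSimplex K) (φ c : Vec d → Vec d) {x : Vec d}
    (hx : x ∈ simplex K) : ‖interpError φ c K x‖ₑ ≤ ∑ z ∈ K, ‖φ x - c z‖ₑ := by
  rw [interpError_eq hK]
  refine (enorm_sum_le _ _).trans (Finset.sum_le_sum fun z _ => ?_)
  rw [enorm_smul]
  refine mul_le_of_le_one_left' ?_
  rw [Real.enorm_of_nonneg (bary_nonneg hK hx z)]
  exact ENNReal.ofReal_le_one.2 (bary_le_one hK hx z)

/-- The gradients of the coordinates sum to zero, so `φ x` may be subtracted from every nodal value.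
-/
theorem enorm_fderiv_interpError_le (hK : IsSimplex K) (hφ : ContDiff ℝ 1 φ) (c : Vec d → Vec d)
    (x : Vec d) : ‖fderiv ℝ (interpError φ c K) x‖ₑ ≤
      ‖fderiv ℝ φ x‖ₑ + ∑ z ∈ K, ‖baryGrad K z‖ₑ * ‖φ x - c z‖ₑ := by
  have h1 : HasFDerivAt (interpError φ c K) (fderiv ℝ φ x -
      ∑ z ∈ K, (innerSL ℝ (baryGrad K z)).smulRight (c z)) x :=
    ((hφ.differentiable one_ne_zero) x).hasFDerivAt.sub (hasFDerivAt_nodalAffine c K x)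
  have h2 : fderiv ℝ φ x - ∑ z ∈ K, (innerSL ℝ (baryGrad K z)).smulRight (c z) =
      fderiv ℝ φ x + ∑ z ∈ K, (innerSL ℝ (baryGrad K z)).smulRight (φ x - c z) := by
    ext1 e
    have h3 : ∑ z ∈ K, (inner ℝ (baryGrad K z) e : ℝ) = 0 := by
      rw [← sum_inner, sum_baryGrad hK, inner_zero_left]
    have h4 : ∀ b : Vec d → Vec d, (∑ z ∈ K, (innerSL ℝ (baryGrad K z)).smulRight (b z)) e =
        ∑ z ∈ K, (inner ℝ (baryGrad K z) e : ℝ) • b z := fun b => by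
      rw [sum_apply]; rfl
    change fderiv ℝ φ x e - (∑ z ∈ K, (innerSL ℝ (baryGrad K z)).smulRight (c z)) e =
      fderiv ℝ φ x e + (∑ z ∈ K, (innerSL ℝ (baryGrad K z)).smulRight (φ x - c z)) e
    rw [h4, h4]
    simp only [smul_sub, Finset.sum_sub_distrib, ← Finset.sum_smul, h3, zero_smul]
    abel
  have h5 : ‖fderiv ℝ (interpError φ c K) x‖ ≤
      ‖fderiv ℝ φ x‖ + ∑ z ∈ K, ‖baryGrad K z‖ * ‖φ x - c z‖ := by
    rw [h1.fderiv, h2]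
    refine (norm_add_le _ _).trans (add_le_add_right ?_ _)
    refine (norm_sum_le _ _).trans (Finset.sum_le_sum fun z _ => ?_)
    rw [ContinuousLinearMap.norm_smulRight_apply, innerSL_apply_norm]
  have h6 : ∀ z ∈ K, 0 ≤ ‖baryGrad K z‖ * ‖φ x - c z‖ := fun z _ => by positivity
  refine (ofReal_norm (fderiv ℝ (interpError φ c K) x)).symm.le.trans
    ((ENNReal.ofReal_le_ofReal h5).trans (le_of_eq ?_))
  rw [ENNReal.ofReal_add (norm_nonneg _) (Finset.sum_nonneg h6), ENNReal.ofReal_sum_of_nonneg h6,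
    ofReal_norm]
  simp only [ENNReal.ofReal_mul (norm_nonneg _), ofReal_norm]

end interp

namespace Mesh

/-- The overlap of the vertex stars is bounded. -/
theorem sum_star_le (hd : 1 ≤ d) {σ : ℝ} (𝒢 : Mesh Ω) (hσ : 𝒢.ShapeRegular σ)
    (i : Finset (Vec d) → ℝ≥0∞) :
    ∑ K ∈ 𝒢.elems, ∑ z ∈ K, ∑ L ∈ 𝒢.star z, i L ≤
      (((d + 1) * ⌊(2 * σ) ^ d⌋₊ : ℕ) : ℝ≥0∞) * ∑ L ∈ 𝒢.elems, i L := by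
  classical
  set V : Finset (Vec d) := 𝒢.elems.biUnion id
  have h1 : ∀ K ∈ 𝒢.elems, ∑ z ∈ K, ∑ L ∈ 𝒢.star z, i L =
      ∑ z ∈ V, if z ∈ K then ∑ L ∈ 𝒢.star z, i L else 0 := by
    intro K hK
    rw [← Finset.sum_filter]
    refine Finset.sum_congr ?_ fun _ _ => rfl
    ext z
    simp only [V, Finset.mem_filter, Finset.mem_biUnion, id]
    exact ⟨fun h => ⟨⟨K, hK, h⟩, h⟩, fun h => h.2⟩
  rw [Finset.sum_congr rfl h1, Finset.sum_comm]
  -- The star of `z` is counted once for each of its elements; afterwards each `L` is counted once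
  -- for each of its `d + 1` vertices.
  have h2 : ∀ z ∈ V, (∑ K ∈ 𝒢.elems, if z ∈ K then ∑ L ∈ 𝒢.star z, i L else 0) ≤
      (⌊(2 * σ) ^ d⌋₊ : ℕ) * ∑ L ∈ 𝒢.elems, if z ∈ L then i L else 0 := by
    intro z _
    rw [← Finset.sum_filter, ← Finset.sum_filter, Finset.sum_const, nsmul_eq_mul]
    change ((𝒢.star z).card : ℝ≥0∞) * ∑ L ∈ 𝒢.star z, i L ≤ _ * ∑ L ∈ 𝒢.star z, i L
    gcongr
    exact 𝒢.card_star_le hd hσ z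
  refine (Finset.sum_le_sum h2).trans ?_
  rw [← Finset.mul_sum, Finset.sum_comm, Nat.cast_mul, mul_comm ((d + 1 : ℕ) : ℝ≥0∞), mul_assoc]
  gcongr
  rw [Finset.mul_sum]
  refine Finset.sum_le_sum fun L hL => ?_
  rw [← Finset.sum_filter, Finset.sum_const, nsmul_eq_mul]
  gcongr
  rw [← 𝒢.card_eq L hL]
  exact Finset.card_le_card fun z hz => (Finset.mem_filter.1 hz).2

open Classical in
/-- Quasi-interpolation by continuous piecewise affine fields vanishing outside `Ω`. -/
theorem exists_quasiInterpolant (hd : 1 ≤ d) (σ : ℝ) {p : ℝ} (hp : 1 < p) :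
    ∃ C : ℝ≥0∞, C ≠ ⊤ ∧ ∀ (Ω : Set (Vec d)), IsLipschitzDomain Ω → ∀ 𝒢 : Mesh Ω, 𝒢.ShapeRegular σ →
      ∀ φ : Vec d → Vec d, ContDiff ℝ 1 φ → (∀ x ∉ Ω, φ x = 0) →
      ∃ (c : Vec d → Vec d) (J : Finset (Vec d) → ℝ≥0∞), (∀ z ∉ Ω, c z = 0) ∧
        ∑ K ∈ 𝒢.elems, J K ≤ C * ∫⁻ x in Ω, ‖fderiv ℝ φ x‖ₑ ^ p ∧
        ∀ K ∈ 𝒢.elems,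
          ∫⁻ x in simplex K, ‖interpError φ c K x‖ₑ ^ p ≤ C * (ediam K ^ p * J K) ∧
          ∫⁻ x in simplex K, ‖fderiv ℝ (interpError φ c K) x‖ₑ ^ p ≤ C * J K ∧
          ∀ v ∈ K, ediam K * ∫⁻ x, ‖interpError φ c K x‖ₑ ^ p ∂facetMeasure (K.erase v) ≤
            C * (ediam K ^ p * J K) := by
  obtain ⟨C₀, hC₀, hstar⟩ := star_poincare hd σ hp
  set s := ENNReal.ofReal σ
  -- `A`, `B` and `F` are the constants for the error, its gradient and its trace; `M` bounds the
  -- overlap of stars.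
  set A : ℝ≥0∞ := (d + 1 : ℕ) ^ (p - 1) * C₀
  set B : ℝ≥0∞ := 2 ^ (p - 1) * (1 + (d + 1 : ℕ) ^ (p - 1) * s ^ p * C₀)
  set F : ℝ≥0∞ := 2 ^ p * 2 ^ d * s * (A + B)
  set M : ℝ≥0∞ := (((d + 1) * ⌊(2 * σ) ^ d⌋₊ : ℕ) : ℝ≥0∞)
  have hp0 : 0 < p := by linarith
  have hA : A ≠ ⊤ := by finiteness
  have hB : B ≠ ⊤ := by finiteness
  have hF : F ≠ ⊤ := by finiteness
  have hM : M ≠ ⊤ := by finiteness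
  refine ⟨M + A + B + F, by finiteness, fun Ω hΩ 𝒢 hσ φ hφ hφΩ => ?_⟩
  obtain ⟨c, hc0, hc⟩ := hstar Ω hΩ 𝒢 hσ φ hφ hφΩ
  set i : Finset (Vec d) → ℝ≥0∞ := fun L => ∫⁻ x in simplex L, ‖fderiv ℝ φ x‖ₑ ^ p
  have hMle : M ≤ M + A + B + F := by rw [add_assoc, add_assoc]; exact le_self_add
  have hAle : A ≤ M + A + B + F := by
    rw [add_comm M, add_assoc, add_assoc]; exact le_self_add
  have hBle : B ≤ M + A + B + F := by
    rw [add_comm (M + A), add_assoc]; exact le_self_add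
  have hFle : F ≤ M + A + B + F := le_add_self
  -- `J K` collects the gradient energy over the stars of the vertices of `K`.
  refine ⟨c, fun K => ∑ z ∈ K, ∑ L ∈ 𝒢.star z, i L, hc0, ?_, fun K hK => ?_⟩
  · rw [𝒢.setLIntegral_eq_sum hΩ]
    exact (𝒢.sum_star_le hd hσ i).trans (by gcongr)
  have hKs := 𝒢.isSimplex hK
  have hr : IsRegular σ K := hσ K hK
  set J := ∑ z ∈ K, ∑ L ∈ 𝒢.star z, i L
  have hcont := hφ.continuous
  have hmz : ∀ z, Measurable fun x => ‖φ x - c z‖ₑ ^ p := fun z =>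
    measurable_enorm_sub_rpow hcont _ _
  have hz : ∀ z ∈ K, ∫⁻ x in simplex K, ‖φ x - c z‖ₑ ^ p ≤
      C₀ * ediam K ^ p * ∑ L ∈ 𝒢.star z, i L := fun z hzK => hc z K (𝒢.mem_star.2 ⟨hK, hzK⟩)
  have hsumz : ∑ z ∈ K, ∫⁻ x in simplex K, ‖φ x - c z‖ₑ ^ p ≤ C₀ * (ediam K ^ p * J) := by
    refine (Finset.sum_le_sum hz).trans ?_
    rw [← Finset.mul_sum, mul_assoc]
  have hiK : i K ≤ J := by
    obtain ⟨z, hzK⟩ : K.Nonempty := by rw [← Finset.card_pos, hKs.card_eq]; omega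
    refine le_trans ?_ (Finset.single_le_sum (f := fun z => ∑ L ∈ 𝒢.star z, i L)
      (fun _ _ => zero_le) hzK)
    exact Finset.single_le_sum (f := i) (fun _ _ => zero_le) (𝒢.mem_star.2 ⟨hK, hzK⟩)
  have h1 : ∫⁻ x in simplex K, ‖interpError φ c K x‖ₑ ^ p ≤ A * (ediam K ^ p * J) := by
    calc _ ≤ ∫⁻ x in simplex K, (d + 1 : ℕ) ^ (p - 1) * ∑ z ∈ K, ‖φ x - c z‖ₑ ^ p := by
          refine setLIntegral_mono' (measurableSet_simplex K) fun x hx => ?_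
          refine (ENNReal.rpow_le_rpow (enorm_interpError_le hKs φ c hx) hp0.le).trans ?_
          have := ENNReal.rpow_sum_le_const_mul_sum_rpow K (fun z => ‖φ x - c z‖ₑ) hp.le
          rwa [hKs.card_eq] at this
      _ = (d + 1 : ℕ) ^ (p - 1) * ∑ z ∈ K, ∫⁻ x in simplex K, ‖φ x - c z‖ₑ ^ p := by
          rw [lintegral_const_mul' _ _ (by finiteness), lintegral_finsetSum _ fun z _ => hmz z]
      _ ≤ (d + 1 : ℕ) ^ (p - 1) * (C₀ * (ediam K ^ p * J)) := by gcongr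
      _ = _ := by simp only [A]; ring
  -- The power of the diameter absorbs the gradients of the coordinates through shape regularity and
  -- is cancelled afterwards.
  have h2' : ediam K ^ p * ∫⁻ x in simplex K, ‖fderiv ℝ (interpError φ c K) x‖ₑ ^ p ≤
      ediam K ^ p * (B * J) := by
    have hmf : Measurable fun x => ‖fderiv ℝ φ x‖ₑ ^ p :=
      (Continuous.measurable ((hφ.continuous_fderiv one_ne_zero).enorm)).pow_const _
    have hpt : ∀ x, ediam K ^ p * ‖fderiv ℝ (interpError φ c K) x‖ₑ ^ p ≤
        2 ^ (p - 1) * (ediam K ^ p * ‖fderiv ℝ φ x‖ₑ ^ p +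
          (d + 1 : ℕ) ^ (p - 1) * (s ^ p * ∑ z ∈ K, ‖φ x - c z‖ₑ ^ p)) := by
      intro x
      have e1 : ediam K * ‖fderiv ℝ (interpError φ c K) x‖ₑ ≤
          ediam K * ‖fderiv ℝ φ x‖ₑ + ∑ z ∈ K, s * ‖φ x - c z‖ₑ := by
        calc _ ≤ ediam K * (‖fderiv ℝ φ x‖ₑ + ∑ z ∈ K, ‖baryGrad K z‖ₑ * ‖φ x - c z‖ₑ) := by
              gcongr; exact enorm_fderiv_interpError_le hKs hφ c x
          _ = ediam K * ‖fderiv ℝ φ x‖ₑ + ∑ z ∈ K, (‖baryGrad K z‖ₑ * ediam K) * ‖φ x - c z‖ₑ := by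
              rw [mul_add, Finset.mul_sum]
              congr 1
              exact Finset.sum_congr rfl fun z _ => by ring
          _ ≤ _ := by
              gcongr with z hzK
              exact hr.baryGrad_mul_ediam_le hKs z
      rw [← ENNReal.mul_rpow_of_nonneg _ _ hp0.le]
      refine (ENNReal.rpow_le_rpow e1 hp0.le).trans
        ((ENNReal.rpow_add_le_mul_rpow_add_rpow _ _ hp.le).trans ?_)
      rw [ENNReal.mul_rpow_of_nonneg _ _ hp0.le]
      gcongr 2 ^ (p - 1) * (_ + ?_)
      have := ENNReal.rpow_sum_le_const_mul_sum_rpow K (fun z => s * ‖φ x - c z‖ₑ) hp.le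
      rw [hKs.card_eq] at this
      refine this.trans (le_of_eq ?_)
      rw [Finset.mul_sum (a := s ^ p)]
      congr 1
      exact Finset.sum_congr rfl fun z _ => ENNReal.mul_rpow_of_nonneg _ _ hp0.le
    have hsm : Measurable fun x => ∑ z ∈ K, ‖φ x - c z‖ₑ ^ p :=
      Finset.measurable_fun_sum K fun z _ => hmz z
    rw [← lintegral_const_mul' _ _ (ENNReal.rpow_ne_top_of_nonneg hp0.le (ediam_ne_top K))]
    calc _ ≤ ∫⁻ x in simplex K, 2 ^ (p - 1) * (ediam K ^ p * ‖fderiv ℝ φ x‖ₑ ^ p +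
          (d + 1 : ℕ) ^ (p - 1) * (s ^ p * ∑ z ∈ K, ‖φ x - c z‖ₑ ^ p)) := lintegral_mono hpt
      _ = 2 ^ (p - 1) * (ediam K ^ p * i K + (d + 1 : ℕ) ^ (p - 1) * (s ^ p *
          ∑ z ∈ K, ∫⁻ x in simplex K, ‖φ x - c z‖ₑ ^ p)) := by
          rw [lintegral_const_mul' _ _ (by finiteness), lintegral_add_left (hmf.const_mul _),
            lintegral_const_mul _ hmf, lintegral_const_mul' _ _ (by finiteness),
            lintegral_const_mul' _ _ (by finiteness), lintegral_finsetSum _ fun z _ => hmz z]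
      _ ≤ 2 ^ (p - 1) * (ediam K ^ p * J + (d + 1 : ℕ) ^ (p - 1) * (s ^ p *
          (C₀ * (ediam K ^ p * J)))) := by gcongr
      _ = _ := by simp only [B]; ring
  have h2 : ∫⁻ x in simplex K, ‖fderiv ℝ (interpError φ c K) x‖ₑ ^ p ≤ B * J :=
    (ENNReal.mul_le_mul_iff_right
      ((ENNReal.rpow_pos (pos_iff_ne_zero.2 (hr.ediam_ne_zero hd)) (ediam_ne_top K)).ne')
      (ENNReal.rpow_ne_top_of_nonneg hp0.le (ediam_ne_top K))).1 h2'
  refine ⟨h1.trans (by gcongr), h2.trans (by gcongr), fun v hv => ?_⟩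
  have h3 := lintegral_facet_le hd hKs hv (contDiff_interpError hφ c K) hp
  calc _ ≤ ediam K * (2 ^ p * 2 ^ d * ‖baryGrad K v‖ₑ *
        (A * (ediam K ^ p * J) + ediam K ^ p * (B * J))) := by
        gcongr ediam K * ?_
        refine h3.trans ?_
        gcongr 2 ^ p * 2 ^ d * ‖baryGrad K v‖ₑ * (?_ + ?_)
        · exact h2'
    _ = 2 ^ p * 2 ^ d * (‖baryGrad K v‖ₑ * ediam K) * ((A + B) * (ediam K ^ p * J)) := by ring
    _ ≤ 2 ^ p * 2 ^ d * s * ((A + B) * (ediam K ^ p * J)) := by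
        gcongr
        exact hr.baryGrad_mul_ediam_le hKs v
    _ = F * (ediam K ^ p * J) := by simp only [F]; ring
    _ ≤ _ := by gcongr

end Mesh

/-! ### Classical and weak gradients -/

/-- The matrix of a linear map. -/
noncomputable def matOf (L : Vec d →L[ℝ] Vec d) : Mat d :=
  WithLp.toLp 2 fun ij => L (EuclideanSpace.single ij.2 1) ij.1

/-- The classical gradient of a vector field. -/
noncomputable def classicalGrad (u : Vec d → Vec d) (x : Vec d) : Mat d := matOf (fderiv ℝ u x)

theorem classicalGrad_apply (u : Vec d → Vec d) (x : Vec d) (i j : Fin d) :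
    classicalGrad u x (i, j) = fderiv ℝ u x (EuclideanSpace.single j 1) i := rfl

theorem norm_matOf_le (L : Vec d →L[ℝ] Vec d) : ‖matOf L‖ ≤ d * ‖L‖ := by
  have h : ‖matOf L‖ ^ 2 ≤ (d * ‖L‖) ^ 2 := by
    rw [EuclideanSpace.norm_sq_eq, Fintype.sum_prod_type_right]
    calc ∑ j, ∑ i, ‖matOf L (i, j)‖ ^ 2 = ∑ j : Fin d, ‖L (EuclideanSpace.single j 1)‖ ^ 2 := by
          refine Finset.sum_congr rfl fun j _ => ?_
          rw [EuclideanSpace.norm_sq_eq]; rfl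
      _ ≤ ∑ _j : Fin d, ‖L‖ ^ 2 := by
          gcongr with j
          simpa using L.le_opNorm (EuclideanSpace.single j 1)
      _ = d * ‖L‖ ^ 2 := by simp
      _ ≤ (d : ℝ) ^ 2 * ‖L‖ ^ 2 := by
          gcongr
          exact_mod_cast Nat.le_self_pow two_ne_zero d
      _ = _ := by ring
  exact le_of_sq_le_sq h (by positivity)

theorem norm_le_norm_matOf (L : Vec d →L[ℝ] Vec d) : ‖L‖ ≤ ‖matOf L‖ := by
  refine L.opNorm_le_bound (norm_nonneg _) fun e => ?_
  have hL : ∀ i, L e i = ∑ j, matOf L (i, j) * e j := by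
    intro i
    have he : e = ∑ j, e j • EuclideanSpace.single j (1 : ℝ) := by
      simpa using ((EuclideanSpace.basisFun (Fin d) ℝ).sum_repr e).symm
    conv_lhs => rw [he, map_sum]
    simp [matOf, mul_comm]
  have h : ‖L e‖ ^ 2 ≤ (‖matOf L‖ * ‖e‖) ^ 2 := by
    rw [mul_pow, EuclideanSpace.norm_sq_eq, EuclideanSpace.norm_sq_eq, Fintype.sum_prod_type,
      Finset.sum_mul]
    refine Finset.sum_le_sum fun i _ => ?_
    rw [hL, Real.norm_eq_abs, sq_abs, EuclideanSpace.norm_sq_eq]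
    simpa using Finset.sum_mul_sq_le_sq_mul_sq Finset.univ (fun j => matOf L (i, j)) (fun j => e j)
  exact le_of_sq_le_sq h (by positivity)

theorem measurable_classicalGrad (u : Vec d → Vec d) : Measurable (classicalGrad u) := by
  refine (WithLp.measurable_toLp 2 _).comp (measurable_pi_lambda _ fun ij => ?_)
  have := measurable_fderiv_apply_const ℝ u (EuclideanSpace.single ij.2 1)
  exact (EuclideanSpace.proj ij.1 : Vec d →L[ℝ] ℝ).continuous.measurable.comp this

theorem norm_classicalGrad_le {M : ℝ≥0} {u : Vec d → Vec d} (hu : LipschitzWith M u) (x : Vec d) :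
    ‖classicalGrad u x‖ ≤ d * M :=
  (norm_matOf_le _).trans (by gcongr; exact norm_fderiv_le_of_lipschitz ℝ hu)

theorem locallyIntegrableOn_apply {ι : Type*} [Fintype ι] {G : Vec d → EuclideanSpace ℝ ι}
    (hG : LocallyIntegrableOn G Ω volume) (i : ι) :
    LocallyIntegrableOn (fun x => G x i) Ω volume := by
  intro x hx
  obtain ⟨s, hs, hi⟩ := hG x hx
  exact ⟨s, hs, (EuclideanSpace.proj i : EuclideanSpace ℝ ι →L[ℝ] ℝ).integrable_comp hi⟩

theorem integrable_mul_of_tsupport_subset {f g : Vec d → ℝ} (hf : LocallyIntegrableOn f Ω volume)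
    (hg : Continuous g) (hgc : HasCompactSupport g) (hgΩ : tsupport g ⊆ Ω) :
    Integrable (fun x => f x * g x) volume := by
  have h : IntegrableOn (fun x => f x * g x) (tsupport g) volume :=
    (hf.integrableOn_compact_subset hgΩ hgc).mul_continuousOn hg.continuousOn hgc
  refine (integrableOn_iff_integrable_of_support_subset fun x hx => ?_).1 h
  exact subset_tsupport g fun h0 => hx (by simp [h0])

/-- The fundamental lemma of the calculus of variations, applied entrywise. It makes the chosen
representative `weakGrad` computable almost everywhere. -/
theorem HasWeakGrad.ae_eq (hΩ : IsOpen Ω) {u : Vec d → Vec d} {G H : Vec d → Mat d}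
    (hG : HasWeakGrad Ω u G) (hH : HasWeakGrad Ω u H) : G =ᵐ[volume.restrict Ω] H := by
  have key : ∀ ij : Fin d × Fin d, ∀ᵐ x ∂volume, x ∈ Ω → G x ij - H x ij = 0 := by
    rintro ⟨i, j⟩
    have lG := locallyIntegrableOn_apply hG.2.1 (i, j)
    have lH := locallyIntegrableOn_apply hH.2.1 (i, j)
    refine hΩ.ae_eq_zero_of_integral_contDiff_smul_eq_zero (lG.sub lH) fun g hg hgc hgΩ => ?_
    have hz : ∀ x ∉ Ω, g x = 0 := fun x hx => image_eq_zero_of_notMem_tsupport fun h => hx (hgΩ h)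
    have h1 := hG.2.2 g hg hgc hgΩ i j
    rw [hH.2.2 g hg hgc hgΩ i j, neg_inj, setIntegral_eq_integral_of_forall_compl_eq_zero
      fun x hx => by rw [hz x hx, mul_zero], setIntegral_eq_integral_of_forall_compl_eq_zero
      fun x hx => by rw [hz x hx, mul_zero]] at h1
    simp only [smul_eq_mul, mul_comm (g _), sub_mul]
    rw [integral_sub (integrable_mul_of_tsupport_subset lG hg.continuous hgc hgΩ)
      (integrable_mul_of_tsupport_subset lH hg.continuous hgc hgΩ), h1, sub_self]
  rw [Filter.EventuallyEq, ae_restrict_iff' hΩ.measurableSet]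
  filter_upwards [ae_all_iff.2 key] with x hx hxΩ
  ext ij
  exact sub_eq_zero.1 (hx ij hxΩ)

theorem HasWeakGrad.weakGrad_ae_eq (hΩ : IsOpen Ω) {u : Vec d → Vec d} {G : Vec d → Mat d}
    (hG : HasWeakGrad Ω u G) : weakGrad Ω u =ᵐ[volume.restrict Ω] G := by
  have h : ∃ G, HasWeakGrad Ω u G := ⟨G, hG⟩
  rw [weakGrad, dif_pos h]
  exact h.choose_spec.ae_eq hΩ hG

theorem HasWeakGrad.sub {u v : Vec d → Vec d} {G H : Vec d → Mat d}
    (hG : HasWeakGrad Ω u G) (hH : HasWeakGrad Ω v H) :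
    HasWeakGrad Ω (u - v) (G - H) := by
  refine ⟨hG.1.sub hH.1, hG.2.1.sub hH.2.1, fun g hg hgc hgΩ i j => ?_⟩
  have hdc : Continuous fun x => fderiv ℝ g x (EuclideanSpace.single j 1) :=
    (hg.continuous_fderiv (by simp)).clm_apply continuous_const
  have hds := tsupport_fderiv_apply_subset ℝ (f := g) (EuclideanSpace.single j 1)
  have hdk : HasCompactSupport fun x => fderiv ℝ g x (EuclideanSpace.single j 1) :=
    hgc.fderiv_apply ℝ _
  have a1 := (integrable_mul_of_tsupport_subset (locallyIntegrableOn_apply hG.1 i) hdc hdk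
    (hds.trans hgΩ)).integrableOn (s := Ω)
  have a2 := (integrable_mul_of_tsupport_subset (locallyIntegrableOn_apply hH.1 i) hdc hdk
    (hds.trans hgΩ)).integrableOn (s := Ω)
  have b1 := (integrable_mul_of_tsupport_subset (locallyIntegrableOn_apply hG.2.1 (i, j))
    hg.continuous hgc hgΩ).integrableOn (s := Ω)
  have b2 := (integrable_mul_of_tsupport_subset (locallyIntegrableOn_apply hH.2.1 (i, j))
    hg.continuous hgc hgΩ).integrableOn (s := Ω)
  simp only [Pi.sub_apply, PiLp.sub_apply, sub_mul]
  rw [integral_sub a1 a2, integral_sub b1 b2, hG.2.2 g hg hgc hgΩ i j, hH.2.2 g hg hgc hgΩ i j]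
  ring

theorem lipschitzWith_apply {ι : Type*} [Fintype ι] {M : ℝ≥0} {u : Vec d → EuclideanSpace ℝ ι}
    (hu : LipschitzWith M u) (i : ι) : LipschitzWith M fun x => u x i :=
  LipschitzWith.of_dist_le_mul fun x y =>
    le_trans (by rw [dist_eq_norm, dist_eq_norm]; exact PiLp.norm_apply_le (u x - u y) i)
      (hu.dist_le_mul x y)

/-- By Rademacher's theorem a Lipschitz field is differentiable almost everywhere. -/
theorem ae_lineDeriv_apply_eq {M : ℝ≥0} {u : Vec d → Vec d} (hu : LipschitzWith M u) (i j : Fin d) :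
    (fun x => lineDeriv ℝ (fun y => u y i) x (EuclideanSpace.single j 1)) =ᵐ[volume]
      fun x => classicalGrad u x (i, j) := by
  filter_upwards [hu.ae_differentiableAt] with x hx
  have h1 : HasFDerivAt (fun y => u y i)
      ((EuclideanSpace.proj i : Vec d →L[ℝ] ℝ).comp (fderiv ℝ u x)) x :=
    (EuclideanSpace.proj i : Vec d →L[ℝ] ℝ).hasFDerivAt.comp x hx.hasFDerivAt
  exact (h1.hasLineDerivAt _).lineDeriv

theorem locallyIntegrableOn_classicalGrad {M : ℝ≥0} {u : Vec d → Vec d} (hu : LipschitzWith M u) :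
    LocallyIntegrableOn (classicalGrad u) Ω volume := by
  refine LocallyIntegrable.locallyIntegrableOn ?_ Ω
  exact (locallyIntegrable_const (d * M : ℝ)).mono (measurable_classicalGrad u).aestronglyMeasurable
    (ae_of_all _ fun x => (norm_classicalGrad_le hu x).trans (le_abs_self _))

/-- A Lipschitz field is weakly differentiable. -/
theorem hasWeakGrad_of_lipschitz {M : ℝ≥0} {u : Vec d → Vec d} (hu : LipschitzWith M u) :
    HasWeakGrad Ω u (classicalGrad u) := by
  refine ⟨hu.continuous.locallyIntegrable.locallyIntegrableOn Ω,
    locallyIntegrableOn_classicalGrad hu, fun g hg hgc hgΩ i j => ?_⟩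
  have hz : ∀ x ∉ Ω, g x = 0 := fun x hx => image_eq_zero_of_notMem_tsupport fun h => hx (hgΩ h)
  have hdz : ∀ x ∉ Ω, fderiv ℝ g x (EuclideanSpace.single j 1) = 0 := fun x hx =>
    image_eq_zero_of_notMem_tsupport (f := fun x => fderiv ℝ g x (EuclideanSpace.single j 1))
      fun h => hx (hgΩ (tsupport_fderiv_apply_subset ℝ (f := g) _ h))
  obtain ⟨D, hD⟩ := ContDiff.lipschitzWith_of_hasCompactSupport hgc hg (by simp)
  -- Integration by parts for a Lipschitz function against a compactly supported one; the minus sign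
  -- is carried by the reversed direction.
  have h := (lipschitzWith_apply hu i).integral_lineDeriv_mul_eq hD hgc
    (EuclideanSpace.single j (1 : ℝ)) (μ := volume)
  have hae : (fun x => lineDeriv ℝ (fun y => u y i) x (EuclideanSpace.single j 1) * g x) =ᵐ[volume]
      fun x => classicalGrad u x (i, j) * g x :=
    (ae_lineDeriv_apply_eq hu i j).mul (EventuallyEq.refl _ g)
  rw [setIntegral_eq_integral_of_forall_compl_eq_zero fun x hx => by rw [hdz x hx, mul_zero],
    setIntegral_eq_integral_of_forall_compl_eq_zero fun x hx => by rw [hz x hx, mul_zero],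
    ← integral_congr_ae hae, h, ← integral_neg]
  refine integral_congr_ae (ae_of_all _ fun x => ?_)
  have : lineDeriv ℝ g x (-EuclideanSpace.single j 1) = -fderiv ℝ g x (EuclideanSpace.single j 1) := by
    rw [DifferentiableAt.lineDeriv_eq_fderiv ((hg.differentiable (by simp)) x), map_neg]
  simp only [this]
  ring

theorem weakGrad_ae_eq_classicalGrad (hΩ : IsOpen Ω) {M : ℝ≥0} {u : Vec d → Vec d}
    (hu : LipschitzWith M u) : weakGrad Ω u =ᵐ[volume.restrict Ω] classicalGrad u :=
  (hasWeakGrad_of_lipschitz hu).weakGrad_ae_eq hΩ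

theorem MemSobolev.memLp_weakGrad (hΩ : IsOpen Ω) {p : ℝ} {u : Vec d → Vec d}
    (hu : MemSobolev Ω p u) : MemLp (weakGrad Ω u) (ENNReal.ofReal p) (volume.restrict Ω) := by
  obtain ⟨G, hG, hGp⟩ := hu.2
  exact hGp.ae_eq (hG.weakGrad_ae_eq hΩ).symm

theorem MemSobolev.weakGrad_sub (hΩ : IsOpen Ω) {p : ℝ} {u v : Vec d → Vec d}
    (hu : MemSobolev Ω p u) (hv : MemSobolev Ω p v) :
    weakGrad Ω (u - v) =ᵐ[volume.restrict Ω] weakGrad Ω u - weakGrad Ω v := by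
  obtain ⟨G, hG, -⟩ := hu.2
  obtain ⟨H, hH, -⟩ := hv.2
  exact ((hG.sub hH).weakGrad_ae_eq hΩ).trans
    ((hG.weakGrad_ae_eq hΩ).symm.sub (hH.weakGrad_ae_eq hΩ).symm)

theorem MemSobolev.sub {p : ℝ} {u v : Vec d → Vec d}
    (hu : MemSobolev Ω p u) (hv : MemSobolev Ω p v) : MemSobolev Ω p (u - v) := by
  obtain ⟨G, hG, hGp⟩ := hu.2
  obtain ⟨H, hH, hHp⟩ := hv.2
  exact ⟨hu.1.sub hv.1, G - H, hG.sub hH, hGp.sub hHp⟩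

theorem memLp_of_continuous_of_isBounded {E : Type*} [NormedAddCommGroup E]
    [SecondCountableTopology E] (hΩ : Bornology.IsBounded Ω)
    {u : Vec d → E} (hu : Continuous u) (q : ℝ≥0∞) : MemLp u q (volume.restrict Ω) := by
  have : IsFiniteMeasure (volume.restrict Ω) :=
    ⟨by simpa using hΩ.measure_lt_top⟩
  obtain ⟨C, hC⟩ := (hΩ.isCompact_closure).exists_bound_of_continuousOn hu.continuousOn
  have h : ∀ᵐ x ∂volume.restrict Ω, ‖u x‖ ≤ C :=
    ae_restrict_of_ae_restrict_of_subset subset_closure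
      (ae_restrict_of_forall_mem isClosed_closure.measurableSet hC)
  exact MemLp.of_bound hu.aestronglyMeasurable C h

theorem memLp_classicalGrad (hΩ : Bornology.IsBounded Ω) {M : ℝ≥0} {u : Vec d → Vec d}
    (hu : LipschitzWith M u) (q : ℝ≥0∞) : MemLp (classicalGrad u) q (volume.restrict Ω) := by
  have : IsFiniteMeasure (volume.restrict Ω) :=
    ⟨by simpa using hΩ.measure_lt_top⟩
  exact MemLp.of_bound (measurable_classicalGrad u).aestronglyMeasurable _
    (ae_of_all _ (norm_classicalGrad_le hu))

theorem memSobolev_of_lipschitz (hΩ : Bornology.IsBounded Ω) (p : ℝ) {M : ℝ≥0}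
    {u : Vec d → Vec d} (hu : LipschitzWith M u) : MemSobolev Ω p u :=
  ⟨memLp_of_continuous_of_isBounded hΩ hu.continuous _, _, hasWeakGrad_of_lipschitz hu,
    memLp_classicalGrad hΩ hu _⟩

theorem eLpNorm_weakGrad_le_sobolevNorm {p : ℝ} (hp : 0 < p) (u : Vec d → Vec d) :
    eLpNorm (weakGrad Ω u) (ENNReal.ofReal p) (volume.restrict Ω) ≤ sobolevNorm Ω p u := by
  rw [sobolevNorm, one_div, ENNReal.le_rpow_inv_iff hp]
  exact le_add_self

theorem eLpNorm_le_sobolevNorm {p : ℝ} (hp : 0 < p) (u : Vec d → Vec d) :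
    eLpNorm u (ENNReal.ofReal p) (volume.restrict Ω) ≤ sobolevNorm Ω p u := by
  rw [sobolevNorm, one_div, ENNReal.le_rpow_inv_iff hp]
  exact le_self_add

/-! ### Polynomials and finite element functions -/

theorem IsPoly.contDiff {m : ℕ} {f : Vec d → ℝ} (hf : IsPoly m f) {n : WithTop ℕ∞} :
    ContDiff ℝ n f := by
  obtain ⟨p, -, hp⟩ := hf
  rw [show f = fun x => MvPolynomial.eval (fun i => x i) p from funext hp]
  clear hp
  induction p using MvPolynomial.induction_on with
  | C a => simpa using contDiff_const
  | add p q hp hq => simpa using hp.add hq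
  | mul_X p i hp =>
    simpa using hp.mul (EuclideanSpace.proj i : Vec d →L[ℝ] ℝ).contDiff

/-- The polynomial of degree at most one defined by an affine function. -/
noncomputable def affinePoly (A : Vec d →ᵃ[ℝ] ℝ) : MvPolynomial (Fin d) ℝ :=
  MvPolynomial.C (A 0) +
    ∑ i, MvPolynomial.C (A.linear (EuclideanSpace.single i 1)) * MvPolynomial.X i

theorem eval_affinePoly (A : Vec d →ᵃ[ℝ] ℝ) (x : Vec d) :
    MvPolynomial.eval (fun i => x i) (affinePoly A) = A x := by
  have h : A x = A 0 + A.linear x := by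
    have := A.map_vadd 0 x
    simpa [add_comm] using this
  have hx : x = ∑ i, x i • EuclideanSpace.single i (1 : ℝ) := by
    simpa using ((EuclideanSpace.basisFun (Fin d) ℝ).sum_repr x).symm
  have h2 : A.linear x = ∑ i, A.linear (EuclideanSpace.single i 1) * x i := by
    conv_lhs => rw [hx, map_sum]
    simp [mul_comm]
  simp [affinePoly, h, h2]

theorem totalDegree_affinePoly (A : Vec d →ᵃ[ℝ] ℝ) : (affinePoly A).totalDegree ≤ 1 := by
  refine (MvPolynomial.totalDegree_add _ _).trans (max_le (by simp) ?_)
  refine (MvPolynomial.totalDegree_finsetSum _ _).trans (Finset.sup_le fun i _ => ?_)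
  refine (MvPolynomial.totalDegree_mul _ _).trans ?_
  simp

theorem isPoly_affine (A : Vec d →ᵃ[ℝ] ℝ) : IsPoly 1 A :=
  ⟨affinePoly A, totalDegree_affinePoly A, fun x => (eval_affinePoly A x).symm⟩

/-- A coordinate as an affine function. -/
noncomputable def coordAffine (i : Fin d) : Vec d →ᵃ[ℝ] ℝ :=
  (EuclideanSpace.proj i : Vec d →L[ℝ] ℝ).toLinearMap.toAffineMap

/-- The degree is left open because `polyOn` accepts a polynomial of any degree. -/
theorem IsPoly.exists_comp_affine {m : ℕ} {f : Vec d → ℝ} (hf : IsPoly m f)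
    (F : Vec d →ᵃ[ℝ] Vec d) : ∃ m', IsPoly m' fun x => f (F x) := by
  obtain ⟨p, -, hp⟩ := hf
  refine ⟨_, MvPolynomial.bind₁ (fun i => affinePoly ((coordAffine i).comp F)) p, le_rfl,
    fun x => ?_⟩
  have h := MvPolynomial.aeval_bind₁ (R := ℝ) (fun i => x i)
    (fun i => affinePoly ((coordAffine i).comp F)) p
  simp only [MvPolynomial.aeval_eq_eval, eval_affinePoly] at h
  rw [h]
  exact hp (F x)

theorem polyOn_spec {K : Finset (Vec d)} {f : Vec d → ℝ}
    (h : ∃ q, (∃ m, IsPoly m q) ∧ f =ᵐ[volume.restrict (simplex K)] q) :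
    f =ᵐ[volume.restrict (simplex K)] polyOn K f := by
  rw [polyOn, dif_pos h]
  exact h.choose_spec.2

/-- The default value zero is smooth too, so no hypothesis on `f` is required. -/
theorem contDiff_polyOn (K : Finset (Vec d)) (f : Vec d → ℝ) {n : WithTop ℕ∞} :
    ContDiff ℝ n (polyOn K f) := by
  rw [polyOn]
  split_ifs with h
  · obtain ⟨m, hm⟩ := h.choose_spec.1
    exact hm.contDiff
  · exact contDiff_const

theorem continuous_partialOn (K : Finset (Vec d)) (i : Fin d) (f : Vec d → ℝ) :
    Continuous (partialOn K i f) :=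
  ((contDiff_polyOn K f (n := 1)).continuous_fderiv one_ne_zero).clm_apply continuous_const

theorem continuous_divOn (K : Finset (Vec d)) (T : Vec d → Mat d) : Continuous (divOn K T) :=
  (PiLp.continuous_toLp 2 _).comp (continuous_pi fun _ =>
    continuous_finsetSum _ fun _ _ => continuous_partialOn K _ _)

theorem continuous_gradOn (K : Finset (Vec d)) (q : Vec d → ℝ) : Continuous (gradOn K q) :=
  (PiLp.continuous_toLp 2 _).comp (continuous_pi fun _ => continuous_partialOn K _ _)

theorem continuous_normalTrace (K F : Finset (Vec d)) (T : Vec d → Mat d) (q : Vec d → ℝ) :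
    Continuous (normalTrace K F T q) := by
  refine (PiLp.continuous_toLp 2 _).comp (continuous_pi fun i =>
    continuous_finsetSum _ fun j _ => Continuous.mul (Continuous.sub ?_ ?_) continuous_const)
  · exact (contDiff_polyOn K _ (n := 0)).continuous
  · split_ifs
    · exact (contDiff_polyOn K _ (n := 0)).continuous
    · exact continuous_const

theorem Mesh.continuous_jump (𝒢 : Mesh Ω) (T : Vec d → Mat d) (q : Vec d → ℝ)
    (F : Finset (Vec d)) : Continuous (𝒢.jump T q F) := by
  classical
  unfold Mesh.jump
  split_ifs
  · exact continuous_finsetSum _ fun K _ => continuous_normalTrace K F T q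
  · exact continuous_const

theorem Mesh.restrict_simplex_le (𝒢 : Mesh Ω) (hΩ : IsLipschitzDomain Ω) {K : Finset (Vec d)}
    (hK : K ∈ 𝒢.elems) :
    (volume.restrict (simplex K) : Measure (Vec d)) ≤ volume.restrict Ω := by
  rw [𝒢.restrict_eq_closure hΩ]
  exact Measure.restrict_mono (𝒢.simplex_subset hK) le_rfl

namespace FESpaces
variable {𝒢 : Mesh Ω} {l j : ℕ} (X : FESpaces 𝒢 l j)

theorem pressure_ae_eq {Q : Vec d → ℝ} (hQ : Q ∈ X.pressure) {K : Finset (Vec d)}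
    (hK : K ∈ 𝒢.elems) : Q =ᵐ[volume.restrict (simplex K)] polyOn K Q := by
  obtain ⟨p, hp, hQp⟩ := hQ.2 K hK
  exact polyOn_spec ⟨_, (X.PQ_upper p hp).exists_comp_affine (X.F K).toAffineMap, hQp⟩

/-- Discrete velocities are Lipschitz on the whole space. -/
theorem exists_lipschitzWith (hΩ : IsLipschitzDomain Ω) {V : Vec d → Vec d} (hV : V ∈ X.velocity) :
    ∃ M, LipschitzWith M V := by
  have hcont : Continuous V := by
    -- Two closed sets, `closure Ω` and the complement of `Ω`, cover the space; elementwise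
    -- Lipschitz bounds then combine to a global one.
    have h1 : ContinuousOn V Ωᶜ := (continuousOn_const (c := (0 : Vec d))).congr hV.2.2
    have h2 := (X.VV_continuous V hV.1).union_of_isClosed h1 isClosed_closure
      hΩ.isOpen.isClosed_compl
    rw [← continuousOn_univ]
    refine h2.mono fun x _ => ?_
    by_cases hx : x ∈ Ω
    · exact Or.inl (subset_closure hx)
    · exact Or.inr hx
  have hloc : ∀ i, ∃ M, LipschitzOnWith M V (𝒢.closedCover i) := by
    rintro (_ | ⟨K, hK⟩)
    · exact ⟨0, LipschitzOnWith.of_dist_le_mul fun x hx y hy => by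
        rw [hV.2.2 x hx, hV.2.2 y hy]; simp⟩
    · obtain ⟨p, hp, hVp⟩ := hV.2.1 K hK
      have hpc : ContDiff ℝ 1 fun x => p (X.F K x) := by
        rw [contDiff_euclidean]
        intro i
        obtain ⟨m, hm⟩ := (X.PV_upper p hp i).exists_comp_affine (X.F K).toAffineMap
        exact hm.contDiff
      obtain ⟨M, hM⟩ := LocallyLipschitzOn.exists_lipschitzOnWith_of_compact
        (isCompact_simplex K) hpc.locallyLipschitz.locallyLipschitzOn
      exact ⟨M, fun x hx y hy => by rw [hVp x hx, hVp y hy]; exact hM hx hy⟩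
  choose M hM using hloc
  have hfin : Finite (Option 𝒢.elems) := inferInstance
  have := Fintype.ofFinite (Option 𝒢.elems)
  refine ⟨Finset.univ.sup M, lipschitzWith_of_closed_cover (𝒢.isClosed_closedCover hΩ)
    𝒢.iUnion_closedCover hcont fun i => (hM i).weaken (Finset.le_sup (Finset.mem_univ i))⟩

/-- The continuous piecewise affine fields vanishing outside `Ω` are discrete velocities. -/
theorem mem_velocity_of_nodalAffine {V c : Vec d → Vec d} (hV : Continuous V)
    (hV0 : ∀ x ∉ Ω, V x = 0) (hVc : ∀ K ∈ 𝒢.elems, ∀ x ∈ simplex K, V x = nodalAffine c K x) :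
    V ∈ X.velocity := by
  have key : ∀ K : Finset (Vec d), ∃ A : Vec d →ᵃ[ℝ] Vec d, ∀ x, nodalAffine c K x = A x := by
    intro K
    have h : ∀ s : Finset (Vec d), ∃ A : Vec d →ᵃ[ℝ] Vec d, ∀ x, ∑ z ∈ s, bary K z x • c z = A x := by
      classical
      intro s
      induction s using Finset.induction_on with
      | empty => exact ⟨0, fun x => by simp⟩
      | insert z s hz ih =>
        obtain ⟨A, hA⟩ := ih
        refine ⟨(LinearMap.toSpanSingleton ℝ (Vec d) (c z)).toAffineMap.comp (bary K z) + A,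
          fun x => ?_⟩
        rw [Finset.sum_insert hz, hA]
        rfl
    exact h K
  refine ⟨X.VV_affine V hV hV0 fun K hK => ?_, fun K hK => ?_, hV0⟩
  · obtain ⟨A, hA⟩ := key K
    exact ⟨A, fun x hx => (hVc K hK x hx).trans (hA x)⟩
  · obtain ⟨A, hA⟩ := key K
    refine ⟨fun x => A ((X.F K).symm x), X.PV_lower _ fun i => ?_, fun x hx => ?_⟩
    · exact isPoly_affine ((coordAffine i).comp (A.comp (X.F K).symm.toAffineMap))
    · simp only [AffineEquiv.symm_apply_apply]
      rw [← hA, hVc K hK x hx]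

end FESpaces

/-! ### Symmetric parts, exponents, and the stress -/

/-- A symmetric matrix is orthogonal to antisymmetric ones. The symmetric stress may therefore be
tested with full gradients. -/
theorem inner_symPart {S : Mat d} (hS : S ∈ SymMat d) (A : Mat d) :
    (inner ℝ S (symPart A : Mat d) : ℝ) = inner ℝ S A := by
  have h : ∑ ij : Fin d × Fin d, A (ij.2, ij.1) * S ij = ∑ ij : Fin d × Fin d, A ij * S ij := by
    rw [← (Equiv.prodComm (Fin d) (Fin d)).sum_comp]
    refine Finset.sum_congr rfl fun ij _ => ?_
    simp only [Equiv.prodComm_apply, Prod.fst_swap, Prod.snd_swap]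
    congr 1
    exact (hS ij.1 ij.2).symm
  have e : ∀ B : Mat d, (inner ℝ S B : ℝ) = ∑ ij : Fin d × Fin d, B ij * S ij := fun B => by
    rw [PiLp.inner_apply]; rfl
  rw [e, e]
  calc _ = ∑ ij : Fin d × Fin d, (A ij * S ij / 2 + A (ij.2, ij.1) * S ij / 2) := by
        refine Finset.sum_congr rfl fun ij _ => ?_
        simp only [symPart]
        ring
    _ = _ := by
        rw [Finset.sum_add_distrib, ← Finset.sum_div, ← Finset.sum_div, h]
        ring

theorem norm_symPart_le (A : Mat d) : ‖symPart A‖ ≤ ‖A‖ := by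
  have h : ‖symPart A‖ * ‖symPart A‖ ≤ ‖symPart A‖ * ‖A‖ := by
    rw [← real_inner_self_eq_norm_mul_norm]
    change (inner ℝ (symPart A : Mat d) (symPart A : Mat d) : ℝ) ≤ ‖(symPart A : Mat d)‖ * ‖A‖
    rw [inner_symPart (symPart A).2]
    exact real_inner_le_norm _ _
  rcases (norm_nonneg (symPart A)).eq_or_lt with h0 | h0
  · rw [← h0]; exact norm_nonneg _
  · exact le_of_mul_le_mul_left h h0

theorem continuous_symPart : Continuous (symPart : Mat d → SymMat d) := by
  refine Continuous.subtype_mk ((PiLp.continuous_toLp 2 _).comp (continuous_pi fun ij => ?_)) _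
  have h : ∀ ij, Continuous fun A : Mat d => A ij := fun ij =>
    (EuclideanSpace.proj ij : Mat d →L[ℝ] ℝ).continuous
  exact ((h _).add (h _)).div_const 2

/-- The bound `tt ≤ r'` places stress and force in `L^tt`. In the first case `tt` increases with `t
< r ≤ d`, and at `t = r` the inequality reads exactly `r ≤ 3d / (d + 2)`. -/
theorem Exponents.bounds {r t tt : ℝ} (hd : 1 ≤ d) (h : Exponents d r t tt) :
    1 < r ∧ 1 < t ∧ 1 < tt ∧ tt ≤ r.conjExponent := by
  have hd' : (1 : ℝ) ≤ d := by exact_mod_cast hd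
  have h1 : (1 : ℝ) ≤ 2 * d / (d + 1) := by rw [le_div_iff₀ (by positivity)]; linarith
  obtain ⟨hr, h | h⟩ := h
  · obtain ⟨h2, h3, h4, rfl⟩ := h
    rw [le_div_iff₀ (by positivity)] at h2
    rw [div_lt_iff₀ (by positivity)] at h3
    have hr1 : 1 < r := by
      rw [div_lt_iff₀ (by positivity)] at hr
      nlinarith
    have ht1 : 1 < t := by nlinarith
    have hrd : r ≤ d := by nlinarith
    have hdt : 0 < d - t := by linarith
    refine ⟨hr1, ht1, ?_, ?_⟩
    · rw [mul_div_assoc', lt_div_iff₀ hdt]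
      nlinarith
    · rw [Real.conjExponent, mul_div_assoc', div_le_div_iff₀ hdt (by linarith)]
      nlinarith [mul_pos (show 0 < r - t by linarith) (show (0 : ℝ) < d by linarith)]
  · obtain ⟨h2, rfl, rfl⟩ := h
    have hr1 : 1 < t := lt_of_le_of_lt h1 hr
    exact ⟨hr1, hr1, (Real.HolderConjugate.conjExponent hr1).symm.lt, le_rfl⟩

/-- Superposition with a Carathéodory mapping preserves measurability. -/
theorem aestronglyMeasurable_caratheodory {α E F : Type*} [MeasurableSpace α] [TopologicalSpace E]
    [NormedAddCommGroup F] {μ : Measure α} {S : α → E → F}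
    (hS : ∀ δ, AEStronglyMeasurable (fun x => S x δ) μ) (hc : ∀ᵐ x ∂μ, Continuous (S x))
    {D : α → E} (hD : AEStronglyMeasurable D μ) : AEStronglyMeasurable (fun x => S x (D x)) μ := by
  classical
  obtain ⟨D', hD', hDD'⟩ := hD
  -- Along simple approximations of the second argument the superposition is a finite sum of
  -- measurable pieces; continuity in that argument passes to the limit.
  have hk : ∀ k, AEStronglyMeasurable (fun x => S x (hD'.approx k x)) μ := by
    intro k
    set s := hD'.approx k
    have h : (fun x => S x (s x)) = fun x => ∑ c ∈ s.range, (s ⁻¹' {c}).indicator (fun x => S x c) x := by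
      ext x
      rw [Finset.sum_eq_single (s x)]
      · rw [indicator_of_mem (by simp)]
      · intro c _ hc
        rw [indicator_of_notMem fun hx => hc (by simpa using hx.symm)]
      · intro hx
        exact absurd (s.mem_range_self x) hx
    rw [h]
    exact Finset.aestronglyMeasurable_fun_sum _ fun c _ => (hS c).indicator (s.measurableSet_fiber c)
  refine aestronglyMeasurable_of_tendsto_ae atTop hk ?_
  filter_upwards [hc, hDD'] with x hx hxD
  rw [hxD]
  exact (hx.tendsto _).comp (hD'.tendsto_approx x)

section data
variable {U : Vec d → Vec d} {M : ℝ≥0}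

theorem ae_norm_weakGrad_le (hΩ : IsOpen Ω) (hU : LipschitzWith M U) :
    ∀ᵐ x ∂volume.restrict Ω, ‖weakGrad Ω U x‖ ≤ d * M := by
  filter_upwards [weakGrad_ae_eq_classicalGrad hΩ hU] with x hx
  rw [hx]
  exact norm_classicalGrad_le hU x

theorem aestronglyMeasurable_weakGrad (hΩ : IsOpen Ω) (hU : LipschitzWith M U) :
    AEStronglyMeasurable (weakGrad Ω U) (volume.restrict Ω) :=
  ((measurable_classicalGrad U).aestronglyMeasurable).congr
    (weakGrad_ae_eq_classicalGrad hΩ hU).symm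

/-- The gradient of a Lipschitz field is bounded, so the growth condition dominates the stress by a
constant plus `k`. -/
theorem memLp_stress (hΩ : IsLipschitzDomain Ω) (hU : LipschitzWith M U) {r : ℝ} (hr : 1 < r)
    {S : ℕ → Vec d → SymMat d → SymMat d} (hS : IsStressApproximation Ω r S) (n : ℕ) :
    MemLp (stress Ω (S n) U) (ENNReal.ofReal r.conjExponent) (volume.restrict Ω) := by
  have : IsFiniteMeasure (volume.restrict Ω) := ⟨by simpa using hΩ.isBounded.measure_lt_top⟩
  obtain ⟨c₁, c₂, m, k, hc₁, -, -, hk0, -, hk, hg⟩ := hS.growth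
  have hmeas : AEStronglyMeasurable (stress Ω (S n) U) (volume.restrict Ω) :=
    continuous_subtype_val.comp_aestronglyMeasurable
      (aestronglyMeasurable_caratheodory (hS.measurable n) (hS.continuous n)
        (continuous_symPart.comp_aestronglyMeasurable
          (aestronglyMeasurable_weakGrad hΩ.isOpen hU)))
  refine ((memLp_const (c₁ * (d * M : ℝ) ^ (r - 1))).add hk).mono' hmeas ?_
  filter_upwards [hg n, ae_norm_weakGrad_le hΩ.isOpen hU] with x hx hxU
  refine (hx (symGrad Ω U x)).1.trans (add_le_add_left ?_ _)
  exact mul_le_mul_of_nonneg_left (Real.rpow_le_rpow (norm_nonneg _)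
    ((norm_symPart_le _).trans hxU) (by linarith)) hc₁.le

/-- The pair `(U, ∇U)` takes values almost everywhere in a compact set, on which `Φ` is bounded. -/
theorem memLp_of_continuous_data {E : Type*} [NormedAddCommGroup E]
    (hΩ : IsLipschitzDomain Ω) (hU : LipschitzWith M U) {Φ : Vec d × Mat d → E}
    (hΦ : Continuous Φ) (q : ℝ≥0∞) :
    MemLp (fun x => Φ (U x, weakGrad Ω U x)) q (volume.restrict Ω) := by
  have : IsFiniteMeasure (volume.restrict Ω) := ⟨by simpa using hΩ.isBounded.measure_lt_top⟩
  obtain ⟨B, hB⟩ := hΩ.isBounded.isCompact_closure.exists_bound_of_continuousOn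
    hU.continuous.continuousOn
  obtain ⟨C, hC⟩ := ((isCompact_closedBall (0 : Vec d) B).prod
    (isCompact_closedBall (0 : Mat d) (d * M))).exists_bound_of_continuousOn hΦ.continuousOn
  refine MemLp.of_bound (hΦ.comp_aestronglyMeasurable
    (hU.continuous.aestronglyMeasurable.prodMk (aestronglyMeasurable_weakGrad hΩ.isOpen hU))) C ?_
  filter_upwards [ae_norm_weakGrad_le hΩ.isOpen hU, ae_restrict_mem hΩ.isOpen.measurableSet]
    with x hx hxΩ
  exact hC _ ⟨by simpa using hB x (subset_closure hxΩ), by simpa using hx⟩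

theorem memLp_convection (hΩ : IsLipschitzDomain Ω) (hU : LipschitzWith M U) (q : ℝ≥0∞) :
    MemLp (convection Ω U) q (volume.restrict Ω) := by
  refine memLp_of_continuous_data hΩ hU (Φ := fun z => WithLp.toLp 2 fun j => 1 / 2 * ∑ i,
    (z.1 i * z.2 (j, i) + (z.2 (i, i) * z.1 j + z.1 i * z.2 (j, i)))) ?_ q
  refine (PiLp.continuous_toLp 2 _).comp (continuous_pi fun j => ?_)
  fun_prop

theorem memLp_divergence (hΩ : IsLipschitzDomain Ω) (hU : LipschitzWith M U) (q : ℝ≥0∞) :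
    MemLp (divergence Ω U) q (volume.restrict Ω) :=
  memLp_of_continuous_data hΩ hU (Φ := fun z => ∑ i, z.2 (i, i)) (by fun_prop) q

end data

/-! ### The residual as a bilinear form -/

/-- The trace of a matrix. -/
noncomputable def tr (G : Mat d) : ℝ := ∑ i, G (i, i)

theorem abs_tr_le (G : Mat d) : |tr G| ≤ d * ‖G‖ := by
  refine (Finset.abs_sum_le_sum_abs _ _).trans ?_
  calc _ ≤ ∑ _i : Fin d, ‖G‖ := Finset.sum_le_sum fun i _ => PiLp.norm_apply_le G (i, i)
    _ = _ := by simp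

theorem continuous_tr : Continuous (tr : Mat d → ℝ) := by unfold tr; fun_prop

/-- The integrand `T : G + b·y - q tr G` of the residual. -/
noncomputable def resForm (T : Mat d) (b : Vec d) (q : ℝ) (G : Mat d) (y : Vec d) : ℝ :=
  inner ℝ T G + inner ℝ b y - q * tr G

theorem tr_sub (G H : Mat d) : tr (G - H) = tr G - tr H := by
  simp [tr, Finset.sum_sub_distrib]

theorem resForm_sub (T : Mat d) (b : Vec d) (q : ℝ) (G H : Mat d) (y z : Vec d) :
    resForm T b q (G - H) (y - z) = resForm T b q G y - resForm T b q H z := by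
  simp only [resForm, tr_sub, inner_sub_right]
  ring

theorem resPdeIntegrand_eq {T : Vec d → Mat d} {x : Vec d} (hT : T x ∈ SymMat d) (f v w : Vec d → Vec d)
    (q : Vec d → ℝ) : resPdeIntegrand Ω f v q T w x =
      resForm (T x) (convection Ω v x - f x) (q x) (weakGrad Ω w x) (w x) := by
  simp only [resPdeIntegrand, resForm, symGrad, inner_symPart hT, inner_sub_left]
  change _ - q x * tr (weakGrad Ω w x) - _ = _
  ring

section form
variable {μ : Measure (Vec d)} {T : Vec d → Mat d} {b : Vec d → Vec d} {q : Vec d → ℝ}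
  {G : Vec d → Mat d} {y : Vec d → Vec d} {s p : ℝ}

theorem aestronglyMeasurable_resForm (hT : AEStronglyMeasurable T μ)
    (hb : AEStronglyMeasurable b μ) (hq : AEStronglyMeasurable q μ)
    (hG : AEStronglyMeasurable G μ) (hy : AEStronglyMeasurable y μ) :
    AEStronglyMeasurable (fun x => resForm (T x) (b x) (q x) (G x) (y x)) μ :=
  ((hT.inner hG).add (hb.inner hy)).sub (hq.mul (continuous_tr.comp_aestronglyMeasurable hG))

theorem enorm_resForm_le (T : Mat d) (b : Vec d) (q : ℝ) (G : Mat d) (y : Vec d) :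
    ‖resForm T b q G y‖ₑ ≤ ‖T‖ₑ * ‖G‖ₑ + ‖b‖ₑ * ‖y‖ₑ + d * (‖q‖ₑ * ‖G‖ₑ) := by
  have h : ‖resForm T b q G y‖ ≤ ‖T‖ * ‖G‖ + ‖b‖ * ‖y‖ + d * (‖q‖ * ‖G‖) := by
    refine (norm_sub_le _ _).trans (add_le_add ((norm_add_le _ _).trans
      (add_le_add (norm_inner_le_norm _ _) (norm_inner_le_norm _ _))) ?_)
    rw [norm_mul]
    calc ‖q‖ * ‖tr G‖ ≤ ‖q‖ * (d * ‖G‖) := by gcongr; exact abs_tr_le G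
      _ = _ := by ring
  rw [← ofReal_norm]
  refine (ENNReal.ofReal_le_ofReal h).trans (le_of_eq ?_)
  rw [ENNReal.ofReal_add (by positivity) (by positivity), ENNReal.ofReal_add (by positivity)
    (by positivity)]
  simp only [ENNReal.ofReal_mul (norm_nonneg _), ENNReal.ofReal_mul (Nat.cast_nonneg d),
    ofReal_norm, ENNReal.ofReal_natCast]

theorem lintegral_mul_enorm_le {E F : Type*} [NormedAddCommGroup E] [NormedAddCommGroup F]
    (hsp : s.HolderConjugate p) {u : Vec d → E} {v : Vec d → F} (hu : AEStronglyMeasurable u μ)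
    (hv : AEStronglyMeasurable v μ) :
    ∫⁻ x, ‖u x‖ₑ * ‖v x‖ₑ ∂μ ≤ eLpNorm u (ENNReal.ofReal s) μ * eLpNorm v (ENNReal.ofReal p) μ := by
  have h := ENNReal.lintegral_mul_le_Lp_mul_Lq μ hsp hu.enorm hv.enorm
  rw [eLpNorm_eq_lintegral_rpow_enorm_toReal (by simpa using hsp.pos) ENNReal.ofReal_ne_top,
    eLpNorm_eq_lintegral_rpow_enorm_toReal (by simpa using hsp.symm.pos) ENNReal.ofReal_ne_top,
    ENNReal.toReal_ofReal hsp.nonneg, ENNReal.toReal_ofReal hsp.symm.nonneg]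
  exact h

/-- The residual form is bounded on `L^p × L^p`. -/
theorem lintegral_enorm_resForm_le (hsp : s.HolderConjugate p) (hT : AEStronglyMeasurable T μ)
    (hb : AEStronglyMeasurable b μ) (hq : AEStronglyMeasurable q μ)
    (hG : AEStronglyMeasurable G μ) (hy : AEStronglyMeasurable y μ) :
    ∫⁻ x, ‖resForm (T x) (b x) (q x) (G x) (y x)‖ₑ ∂μ ≤
      eLpNorm T (ENNReal.ofReal s) μ * eLpNorm G (ENNReal.ofReal p) μ +
      eLpNorm b (ENNReal.ofReal s) μ * eLpNorm y (ENNReal.ofReal p) μ +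
      d * (eLpNorm q (ENNReal.ofReal s) μ * eLpNorm G (ENNReal.ofReal p) μ) := by
  refine (lintegral_mono fun x => enorm_resForm_le _ _ _ _ _).trans ?_
  have h1 : AEMeasurable (fun x => ‖T x‖ₑ * ‖G x‖ₑ) μ := hT.enorm.mul hG.enorm
  have h2 : AEMeasurable (fun x => ‖T x‖ₑ * ‖G x‖ₑ + ‖b x‖ₑ * ‖y x‖ₑ) μ :=
    h1.add (hb.enorm.mul hy.enorm)
  rw [lintegral_add_left' h2, lintegral_add_left' h1, lintegral_const_mul' _ _ (by finiteness)]
  gcongr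
  · exact lintegral_mul_enorm_le hsp hT hG
  · exact lintegral_mul_enorm_le hsp hb hy
  · exact lintegral_mul_enorm_le hsp hq hG

theorem integrable_resForm (hsp : s.HolderConjugate p) (hT : MemLp T (ENNReal.ofReal s) μ)
    (hb : MemLp b (ENNReal.ofReal s) μ) (hq : MemLp q (ENNReal.ofReal s) μ)
    (hG : MemLp G (ENNReal.ofReal p) μ) (hy : MemLp y (ENNReal.ofReal p) μ) :
    Integrable (fun x => resForm (T x) (b x) (q x) (G x) (y x)) μ := by
  refine ⟨aestronglyMeasurable_resForm hT.1 hb.1 hq.1 hG.1 hy.1, ?_⟩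
  refine (lintegral_enorm_resForm_le hsp hT.1 hb.1 hq.1 hG.1 hy.1).trans_lt ?_
  have := hT.2; have := hb.2; have := hq.2; have := hG.2; have := hy.2
  finiteness

end form

/-! ### Elementwise integration by parts -/

/-- The flux `T - q id`, built from the polynomials on the element `K`. -/
noncomputable def fluxOn (K : Finset (Vec d)) (T : Vec d → Mat d) (q : Vec d → ℝ) (x : Vec d) :
    Mat d :=
  WithLp.toLp 2 fun ij =>
    polyOn K (fun y => T y ij) x - if ij.1 = ij.2 then polyOn K q x else 0

theorem inner_fluxOn {K : Finset (Vec d)} {T : Vec d → Mat d} {q : Vec d → ℝ} {x : Vec d}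
    (hT : ∀ ij, T x ij = polyOn K (fun y => T y ij) x) (hq : q x = polyOn K q x) (G : Mat d) :
    (inner ℝ (fluxOn K T q x) G : ℝ) = inner ℝ (T x) G - q x * tr G := by
  simp only [PiLp.inner_apply, fluxOn, ← hT, ← hq, Fintype.sum_prod_type, tr]
  simp [mul_sub, Finset.sum_sub_distrib, Finset.mul_sum, mul_comm]

theorem contDiff_fluxOn (K : Finset (Vec d)) (T : Vec d → Mat d) (q : Vec d → ℝ)
    (ij : Fin d × Fin d) {n : WithTop ℕ∞} : ContDiff ℝ n fun x => fluxOn K T q x ij := by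
  refine (contDiff_polyOn K _).sub ?_
  split_ifs
  · exact contDiff_polyOn K q
  · exact contDiff_const

theorem continuous_fluxOn (K : Finset (Vec d)) (T : Vec d → Mat d) (q : Vec d → ℝ) :
    Continuous (fluxOn K T q) :=
  (PiLp.continuous_toLp 2 _).comp (continuous_pi fun ij =>
    (contDiff_fluxOn K T q ij (n := 0)).continuous)

theorem continuous_classicalGrad {e : Vec d → Vec d} (he : ContDiff ℝ 1 e) :
    Continuous (classicalGrad e) := by
  refine (PiLp.continuous_toLp 2 _).comp (continuous_pi fun ij => ?_)
  exact (EuclideanSpace.proj ij.1 : Vec d →L[ℝ] ℝ).continuous.comp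
    ((he.continuous_fderiv one_ne_zero).clm_apply continuous_const)

theorem integrable_facetMeasure (hd : 1 ≤ d) {K F : Finset (Vec d)} (hK : IsSimplex K)
    (hFK : F ⊆ K) (hF : F.card = d) {E : Type*} [NormedAddCommGroup E]
    {g : Vec d → E} (hg : Continuous g) : Integrable g (facetMeasure F) := by
  have := isFiniteMeasure_facetMeasure hd hK hFK hF
  obtain ⟨C, hC⟩ := (isCompact_simplex F).exists_bound_of_continuousOn hg.continuousOn
  exact Integrable.of_bound hg.aestronglyMeasurable C
    (ae_restrict_of_forall_mem (measurableSet_simplex F) hC)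

/-- The product rule; the pressure part of `-div (T - q id)` is `∇q`. -/
theorem inner_fluxOn_classicalGrad (K : Finset (Vec d)) (T : Vec d → Mat d) (q : Vec d → ℝ)
    {e : Vec d → Vec d} (he : ContDiff ℝ 1 e) (x : Vec d) :
    (inner ℝ (fluxOn K T q x) (classicalGrad e x) : ℝ) =
      inner ℝ (-divOn K T x + gradOn K q x) (e x) +
      ∑ ij : Fin d × Fin d, fderiv ℝ (fun y => fluxOn K T q y ij * e y ij.1) x
        (EuclideanSpace.single ij.2 1) := by
  have hde : ∀ i, HasFDerivAt (fun y => e y i)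
      ((EuclideanSpace.proj i : Vec d →L[ℝ] ℝ).comp (fderiv ℝ e x)) x := fun i =>
    (EuclideanSpace.proj i : Vec d →L[ℝ] ℝ).hasFDerivAt.comp x
      ((he.differentiable one_ne_zero) x).hasFDerivAt
  have hdp : ∀ f, HasFDerivAt (polyOn K f) (fderiv ℝ (polyOn K f) x) x := fun f =>
    (((contDiff_polyOn K f (n := 1)).differentiable one_ne_zero) x).hasFDerivAt
  have hda : ∀ ij : Fin d × Fin d, HasFDerivAt (fun y => fluxOn K T q y ij)
      (fderiv ℝ (polyOn K fun y => T y ij) x - if ij.1 = ij.2 then fderiv ℝ (polyOn K q) x else 0)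
      x := by
    intro ij
    refine (hdp _).sub ?_
    split_ifs
    · exact hdp q
    · exact hasFDerivAt_const _ _
  have h1 : ∀ i j : Fin d, fderiv ℝ (fun y => fluxOn K T q y (i, j) * e y i) x
      (EuclideanSpace.single j 1) = fluxOn K T q x (i, j) * classicalGrad e x (i, j) +
      e x i * (partialOn K j (fun y => T y (i, j)) x - if i = j then partialOn K j q x else 0) := by
    intro i j
    have hm : fderiv ℝ (fun y => fluxOn K T q y (i, j) * e y i) x = _ :=
      ((hda (i, j)).mul (hde i)).fderiv
    rw [hm]
    have : (if i = j then fderiv ℝ (polyOn K q) x else 0) (EuclideanSpace.single j 1) =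
        if i = j then partialOn K j q x else 0 := by split_ifs <;> rfl
    rw [← this]
    rfl
  have hin : ∀ a b : ℝ, (inner ℝ a b : ℝ) = b * a := fun a b => rfl
  simp only [Fintype.sum_prod_type, h1, PiLp.inner_apply, hin, PiLp.add_apply, PiLp.neg_apply,
    divOn, gradOn, Finset.sum_add_distrib, ← Finset.mul_sum, Finset.sum_sub_distrib,
    Finset.sum_ite_eq, Finset.mem_univ, if_true]
  have : ∀ i : Fin d, e x i * (-∑ j, partialOn K j (fun y => T y (i, j)) x + partialOn K i q x) =
      -(e x i * (∑ j, partialOn K j (fun y => T y (i, j)) x - partialOn K i q x)) := fun i => by ring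
  simp only [this, Finset.sum_neg_distrib, mul_comm (classicalGrad e x _)]
  ring

open Classical in
theorem integral_fluxOn (hd : 1 ≤ d) {K : Finset (Vec d)} (hK : IsSimplex K) (T : Vec d → Mat d)
    (q : Vec d → ℝ) {e : Vec d → Vec d} (he : ContDiff ℝ 1 e) :
    ∫ x in simplex K, (inner ℝ (fluxOn K T q x) (classicalGrad e x) : ℝ) =
      (∫ x in simplex K, (inner ℝ (-divOn K T x + gradOn K q x) (e x) : ℝ)) +
      ∑ v ∈ K, ∫ x, (inner ℝ (normalTrace K (K.erase v) T q x) (e x) : ℝ)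
        ∂facetMeasure (K.erase v) := by
  have hψ : ∀ ij : Fin d × Fin d, ContDiff ℝ 1 fun y => fluxOn K T q y ij * e y ij.1 := fun ij =>
    (contDiff_fluxOn K T q ij).mul (contDiff_euclidean.1 he ij.1)
  have hint : ∀ {g : Vec d → ℝ}, Continuous g → IntegrableOn g (simplex K) := fun hg =>
    hg.continuousOn.integrableOn_compact (isCompact_simplex K)
  have hc1 : Continuous fun x => (inner ℝ (-divOn K T x + gradOn K q x) (e x) : ℝ) :=
    ((continuous_divOn K T).neg.add (continuous_gradOn K q)).inner he.continuous
  have hc2 : ∀ ij : Fin d × Fin d, Continuous fun x =>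
      fderiv ℝ (fun y => fluxOn K T q y ij * e y ij.1) x (EuclideanSpace.single ij.2 1) := fun ij =>
    ((hψ ij).continuous_fderiv one_ne_zero).clm_apply continuous_const
  simp only [inner_fluxOn_classicalGrad K T q he]
  rw [integral_add (hint hc1) (hint (continuous_finsetSum _ fun ij _ => hc2 ij)),
    integral_finsetSum _ fun ij _ => hint (hc2 ij)]
  congr 1
  simp only [integral_fderiv_simplex hd hK (hψ _)]
  rw [Finset.sum_comm]
  refine Finset.sum_congr rfl fun v hv => ?_
  have hcard : (K.erase v).card = d := by rw [Finset.card_erase_of_mem hv, hK.card_eq]; rfl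
  have hi : ∀ ij : Fin d × Fin d, Integrable (fun x =>
      (inner ℝ (outerNormal K (K.erase v)) (EuclideanSpace.single ij.2 (1 : ℝ)) : ℝ) *
        (fluxOn K T q x ij * e x ij.1)) (facetMeasure (K.erase v)) := fun ij =>
    integrable_facetMeasure hd hK (K.erase_subset v) hcard
      (continuous_const.mul (hψ ij).continuous)
  simp only [← integral_const_mul]
  rw [← integral_finsetSum _ fun ij _ => hi ij]
  refine integral_congr_ae (ae_of_all _ fun x => ?_)
  have hin : ∀ a b : ℝ, (inner ℝ a b : ℝ) = b * a := fun a b => rfl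
  have hs : ∀ (w : Vec d) (j : Fin d), (inner ℝ w (EuclideanSpace.single j (1 : ℝ)) : ℝ) = w j :=
    fun w j => by rw [EuclideanSpace.inner_single_right, one_mul]; rfl
  simp only [Fintype.sum_prod_type, PiLp.inner_apply, normalTrace, hin, hs, Finset.mul_sum, fluxOn]
  exact Finset.sum_congr rfl fun i _ => Finset.sum_congr rfl fun j _ => by ring

theorem sum_powersetCard_eq_sum_erase {K : Finset (Vec d)} (hK : K.card = d + 1) [DecidableEq (Vec d)]
    {E : Type*} [AddCommMonoid E] (g : Finset (Vec d) → E) :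
    ∑ F ∈ K.powersetCard d, g F = ∑ v ∈ K, g (K.erase v) := by
  have h : K.powersetCard d = K.image K.erase := by
    ext F
    rw [Finset.mem_powersetCard, Finset.mem_image]
    constructor
    · rintro ⟨hF, hc⟩
      obtain ⟨v, hv⟩ := Finset.card_eq_one.1
        (show (K \ F).card = 1 by rw [Finset.card_sdiff_of_subset hF]; omega)
      refine ⟨v, (Finset.mem_sdiff.1 (hv ▸ Finset.mem_singleton_self v)).1, ?_⟩
      rw [Finset.erase_eq, ← hv, Finset.sdiff_sdiff_eq_self hF]
    · rintro ⟨v, hv, rfl⟩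
      exact ⟨K.erase_subset v, by rw [Finset.card_erase_of_mem hv, hK]; rfl⟩
  rw [h, Finset.sum_image (Finset.erase_injOn K)]

theorem enorm_inner_le {E : Type*} [NormedAddCommGroup E] [InnerProductSpace ℝ E] (u v : E) :
    ‖(inner ℝ u v : ℝ)‖ₑ ≤ ‖u‖ₑ * ‖v‖ₑ := by
  rw [← ofReal_norm, ← ofReal_norm, ← ofReal_norm, ← ENNReal.ofReal_mul (norm_nonneg _)]
  exact ENNReal.ofReal_le_ofReal (norm_inner_le_norm _ _)

namespace Mesh
variable (𝒢 : Mesh Ω)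

open Classical in
theorem sum_facets_comm {E : Type*} [AddCommMonoid E]
    (g : Finset (Vec d) → Finset (Vec d) → E) :
    ∑ K ∈ 𝒢.elems, ∑ F ∈ K.powersetCard d, g K F =
      ∑ F ∈ 𝒢.elems.biUnion (Finset.powersetCard d), ∑ K ∈ 𝒢.elems with F ⊆ K, g K F := by
  refine Finset.sum_comm' fun K F => ?_
  simp only [Finset.mem_powersetCard, Finset.mem_filter, Finset.mem_biUnion]
  constructor
  · rintro ⟨hK, hF, hc⟩
    exact ⟨⟨hK, hF⟩, K, hK, hF, hc⟩
  · rintro ⟨⟨hK, hF⟩, L, -, -, hc⟩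
    exact ⟨hK, hF, hc⟩

/-- The sum of the normal traces over all facets of all elements reduces to the jumps. -/
theorem enorm_sum_normalTrace_le (hd : 1 ≤ d) (hΩ : IsLipschitzDomain Ω) (T : Vec d → Mat d)
    (q : Vec d → ℝ) {ψ : Vec d → Vec d} (hψ : Continuous ψ) (hψΩ : ∀ x ∉ Ω, ψ x = 0) :
    ‖∑ K ∈ 𝒢.elems, ∑ F ∈ K.powersetCard d,
        ∫ x, (inner ℝ (normalTrace K F T q x) (ψ x) : ℝ) ∂facetMeasure F‖ₑ ≤
      ∑ K ∈ 𝒢.elems, ∑ F ∈ K.powersetCard d,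
        ∫⁻ x, ‖𝒢.jump T q F x‖ₑ * ‖ψ x‖ₑ ∂facetMeasure F := by
  classical
  rw [𝒢.sum_facets_comm, 𝒢.sum_facets_comm]
  refine (enorm_sum_le _ _).trans (Finset.sum_le_sum fun F hF => ?_)
  obtain ⟨L, hL, hFL⟩ := Finset.mem_biUnion.1 hF
  obtain ⟨hFL, hFc⟩ := Finset.mem_powersetCard.1 hFL
  have hLF : L ∈ 𝒢.elems.filter fun K => F ⊆ K := Finset.mem_filter.2 ⟨hL, hFL⟩
  -- On a side the traces add up to the jump, whose contribution is dominated by its copy belonging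
  -- to `L`. Any other facet misses `Ω`, and `ψ` vanishes on it.
  by_cases hs : 𝒢.IsSide F
  · have h : ∑ K ∈ 𝒢.elems with F ⊆ K, ∫ x, (inner ℝ (normalTrace K F T q x) (ψ x) : ℝ)
        ∂facetMeasure F = ∫ x, (inner ℝ (𝒢.jump T q F x) (ψ x) : ℝ) ∂facetMeasure F := by
      rw [← integral_finsetSum _ fun K _ => integrable_facetMeasure hd (𝒢.isSimplex hL) hFL hFc
        ((continuous_normalTrace K F T q).inner hψ)]
      simp only [Mesh.jump, if_pos hs, sum_inner]
    rw [h]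
    refine (enorm_integral_le_lintegral_enorm _).trans (le_trans (lintegral_mono fun x => enorm_inner_le _ _)
      (Finset.single_le_sum (f := fun _ => ∫⁻ x, ‖𝒢.jump T q F x‖ₑ * ‖ψ x‖ₑ ∂facetMeasure F)
        (fun _ _ => zero_le) hLF))
  · rw [Finset.sum_eq_zero, enorm_zero]
    · exact zero_le
    · intro K _
      refine integral_eq_zero_of_ae ((ae_restrict_iff' (measurableSet_simplex F)).2
        (ae_of_all _ fun x hx => ?_))
      simp [hψΩ x (𝒢.disjoint_of_not_isSide hΩ hL hFL hFc hs hx)]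

end Mesh

/-! ### The mesh size -/

namespace Mesh
variable (𝒢 : Mesh Ω)

theorem volume_patch_ne_top (hΩ : IsLipschitzDomain Ω) (A : Set (Vec d)) :
    volume (𝒢.patch A) ≠ ⊤ := by
  refine ((measure_mono ?_).trans_lt hΩ.isBounded.closure.measure_lt_top).ne
  exact iUnion₂_subset fun K hK => iUnion_subset fun _ => 𝒢.simplex_subset hK

theorem enorm_h (hΩ : IsLipschitzDomain Ω) (x : Vec d) :
    ‖𝒢.h x‖ₑ = volume (𝒢.patch {x}) ^ (1 / (d : ℝ)) := by
  rw [Mesh.h, ENNReal.toReal_rpow, Real.enorm_of_nonneg ENNReal.toReal_nonneg, ENNReal.ofReal_toReal]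
  exact ENNReal.rpow_ne_top_of_nonneg (by positivity) (𝒢.volume_patch_ne_top hΩ _)

theorem exists_enorm_h_le (hΩ : IsLipschitzDomain Ω) : ∃ H : ℝ≥0∞, H ≠ ⊤ ∧ ∀ x, ‖𝒢.h x‖ₑ ≤ H := by
  refine ⟨volume (closure Ω) ^ (1 / (d : ℝ)), ENNReal.rpow_ne_top_of_nonneg (by positivity)
    hΩ.isBounded.closure.measure_lt_top.ne, fun x => ?_⟩
  rw [𝒢.enorm_h hΩ]
  refine ENNReal.rpow_le_rpow (measure_mono ?_) (by positivity)
  exact iUnion₂_subset fun K hK => iUnion_subset fun _ => 𝒢.simplex_subset hK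

/-- The patch of `x` contains `K` and thus an inscribed ball of radius at least the diameter over
`2σ`. Only this direction of the comparison is needed. -/
theorem exists_ediam_le_h (hd : 1 ≤ d) (σ : ℝ) : ∃ C : ℝ≥0∞, C ≠ ⊤ ∧
    ∀ (Ω : Set (Vec d)), IsLipschitzDomain Ω → ∀ 𝒢 : Mesh Ω, 𝒢.ShapeRegular σ →
      ∀ K ∈ 𝒢.elems, ∀ x ∈ simplex K, ediam K ≤ C * ‖𝒢.h x‖ₑ := by
  have : Nonempty (Fin d) := ⟨⟨0, hd⟩⟩
  set β : ℝ≥0∞ := volume (Metric.ball (0 : Vec d) 1)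
  have hd0 : (d : ℝ) ≠ 0 := by positivity
  have hβ0 : β ≠ 0 := (Metric.measure_ball_pos volume _ one_pos).ne'
  have hβt : β ≠ ⊤ := measure_ball_lt_top.ne
  set w := β ^ (1 / (d : ℝ))
  have hw0 : w ≠ 0 := (ENNReal.rpow_pos (pos_iff_ne_zero.2 hβ0) hβt).ne'
  have hwt : w ≠ ⊤ := ENNReal.rpow_ne_top_of_nonneg (by positivity) hβt
  refine ⟨ENNReal.ofReal (2 * σ) * w⁻¹, ENNReal.mul_ne_top ENNReal.ofReal_ne_top
    (ENNReal.inv_ne_top.2 hw0), fun Ω hΩ 𝒢 hσ K hK x hx => ?_⟩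
  obtain ⟨y, ρ, hρ, hb, hdiam⟩ := hσ K hK
  have h1 : ENNReal.ofReal ρ * w ≤ ‖𝒢.h x‖ₑ := by
    have e : ENNReal.ofReal ρ * w = (ENNReal.ofReal ρ ^ d * β) ^ (1 / (d : ℝ)) := by
      rw [ENNReal.mul_rpow_of_nonneg _ _ (by positivity), ← ENNReal.rpow_natCast,
        ← ENNReal.rpow_mul, mul_one_div_cancel hd0, ENNReal.rpow_one]
    rw [e, 𝒢.enorm_h hΩ]
    refine ENNReal.rpow_le_rpow ?_ (by positivity)
    have h2 : volume (Metric.closedBall y ρ) ≤ volume (𝒢.patch {x}) :=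
      measure_mono (hb.trans (subset_iUnion₂_of_subset K hK
        (subset_iUnion_of_subset ⟨x, hx, rfl⟩ le_rfl)))
    rwa [Measure.addHaar_closedBall _ _ hρ.le, finrank_euclideanSpace, Fintype.card_fin,
      ENNReal.ofReal_pow hρ.le] at h2
  calc ediam K ≤ ENNReal.ofReal (2 * σ) * ENNReal.ofReal ρ := by
        rw [ediam, ← ENNReal.ofReal_mul' hρ.le]
        exact ENNReal.ofReal_le_ofReal (by linarith)
    _ = ENNReal.ofReal (2 * σ) * w⁻¹ * (ENNReal.ofReal ρ * w) := by
        rw [mul_assoc, ← mul_assoc w⁻¹, mul_comm w⁻¹, mul_assoc (ENNReal.ofReal ρ),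
          ENNReal.inv_mul_cancel hw0 hwt, mul_one]
    _ ≤ _ := by gcongr

end Mesh

/-! ### The residual of a field split into elements -/

/-- Hölder's inequality with a weight distributed over the two factors. -/
theorem lintegral_mul_le_of_scaled {α : Type*} [MeasurableSpace α] {μ : Measure α} {s p : ℝ}
    (hsp : s.HolderConjugate p) {u v : α → ℝ≥0∞} (hu : AEMeasurable u μ) (hv : AEMeasurable v μ)
    {a I B : ℝ≥0∞} (hI : a ^ s * ∫⁻ x, u x ^ s ∂μ ≤ I)
    (hB : ∫⁻ x, v x ^ p ∂μ ≤ a ^ p * B) :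
    ∫⁻ x, u x * v x ∂μ ≤ I ^ (1 / s) * B ^ (1 / p) := by
  have hs := hsp.pos
  have hp := hsp.symm.pos
  calc ∫⁻ x, u x * v x ∂μ ≤ (∫⁻ x, u x ^ s ∂μ) ^ (1 / s) * (∫⁻ x, v x ^ p ∂μ) ^ (1 / p) :=
        ENNReal.lintegral_mul_le_Lp_mul_Lq μ hsp hu hv
    _ ≤ (∫⁻ x, u x ^ s ∂μ) ^ (1 / s) * (a ^ p * B) ^ (1 / p) := by gcongr
    _ = (a ^ s * ∫⁻ x, u x ^ s ∂μ) ^ (1 / s) * B ^ (1 / p) := by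
        rw [ENNReal.mul_rpow_of_nonneg _ _ (by positivity),
          ENNReal.mul_rpow_of_nonneg _ _ (by positivity), ← ENNReal.rpow_mul, ← ENNReal.rpow_mul,
          mul_one_div_cancel hs.ne', mul_one_div_cancel hp.ne']
        ring
    _ ≤ _ := by gcongr

theorem integrable_inner_of_memLp {μ : Measure (Vec d)} {ι : Type*} [Fintype ι] {s p : ℝ}
    (hsp : s.HolderConjugate p) {u v : Vec d → EuclideanSpace ℝ ι}
    (hu : MemLp u (ENNReal.ofReal s) μ) (hv : MemLp v (ENNReal.ofReal p) μ) :
    Integrable (fun x => (inner ℝ (u x) (v x) : ℝ)) μ := by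
  refine ⟨hu.1.inner hv.1, ?_⟩
  refine (lintegral_mono fun x => enorm_inner_le (u x) (v x)).trans_lt
    ((lintegral_mul_enorm_le hsp hu.1 hv.1).trans_lt (ENNReal.mul_lt_top hu.2 hv.2))

/-- The element residual. -/
noncomputable def resOn (K : Finset (Vec d)) (T : Vec d → Mat d) (b : Vec d → Vec d)
    (q : Vec d → ℝ) (x : Vec d) : Vec d :=
  -divOn K T x + gradOn K q x + b x

section split
variable {K : Finset (Vec d)} {s p : ℝ} {T PT : Vec d → Mat d} {b : Vec d → Vec d} {q : Vec d → ℝ}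

theorem memLp_of_continuous_simplex (K : Finset (Vec d)) {E : Type*} [NormedAddCommGroup E]
    [SecondCountableTopology E] {u : Vec d → E} (hu : Continuous u) (r : ℝ≥0∞) :
    MemLp u r (volume.restrict (simplex K)) :=
  memLp_of_continuous_of_isBounded (isCompact_simplex K).isBounded hu r

theorem memLp_of_polyOn (hPT : ∀ ij, (fun x => PT x ij) =ᵐ[volume.restrict (simplex K)]
      polyOn K (fun x => PT x ij)) (r : ℝ≥0∞) : MemLp PT r (volume.restrict (simplex K)) := by
  have hc : Continuous fun x => (WithLp.toLp 2 fun ij => polyOn K (fun y => PT y ij) x : Mat d) :=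
    (PiLp.continuous_toLp 2 _).comp (continuous_pi fun ij =>
      (contDiff_polyOn K _ (n := 0)).continuous)
  refine (memLp_of_continuous_simplex K hc r).ae_eq ?_
  filter_upwards [ae_all_iff.2 hPT] with x hx
  ext ij
  exact (hx ij).symm

theorem memLp_resOn (hb : MemLp b (ENNReal.ofReal s) (volume.restrict (simplex K))) :
    MemLp (resOn K PT b q) (ENNReal.ofReal s) (volume.restrict (simplex K)) :=
  (memLp_of_continuous_simplex K
    ((continuous_divOn K PT).neg.add (continuous_gradOn K q)) _).add hb

/-- Only the flux `PT - q id`, polynomial on `K`, is integrated by parts; the projection error `T -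
PT` stays paired with the gradient. -/
theorem integral_resForm_simplex (hd : 1 ≤ d) (hK : IsSimplex K) (hsp : s.HolderConjugate p)
    (hT : MemLp T (ENNReal.ofReal s) (volume.restrict (simplex K)))
    (hb : MemLp b (ENNReal.ofReal s) (volume.restrict (simplex K)))
    (hPT : ∀ ij, (fun x => PT x ij) =ᵐ[volume.restrict (simplex K)] polyOn K (fun x => PT x ij))
    (hq : q =ᵐ[volume.restrict (simplex K)] polyOn K q)
    {e : Vec d → Vec d} (he : ContDiff ℝ 1 e) :
    ∫ x in simplex K, resForm (T x) (b x) (q x) (classicalGrad e x) (e x) =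
      (∫ x in simplex K, (inner ℝ (T x - PT x) (classicalGrad e x) : ℝ)) +
      (∫ x in simplex K, (inner ℝ (resOn K PT b q x) (e x) : ℝ)) +
      ∑ F ∈ K.powersetCard d, ∫ x, (inner ℝ (normalTrace K F PT q x) (e x) : ℝ)
        ∂facetMeasure F := by
  classical
  have hG := memLp_of_continuous_simplex K (continuous_classicalGrad he) (ENNReal.ofReal p)
  have hy := memLp_of_continuous_simplex K he.continuous (ENNReal.ofReal p)
  have i1 := integrable_inner_of_memLp hsp (hT.sub (memLp_of_polyOn hPT _)) hG
  have i2 : Integrable (fun x => (inner ℝ (fluxOn K PT q x) (classicalGrad e x) : ℝ))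
      (volume.restrict (simplex K)) :=
    ((continuous_fluxOn K PT q).inner (continuous_classicalGrad he)).continuousOn.integrableOn_compact
      (isCompact_simplex K)
  have i3 := integrable_inner_of_memLp hsp hb hy
  have i4 : Integrable (fun x => (inner ℝ (-divOn K PT x + gradOn K q x) (e x) : ℝ))
      (volume.restrict (simplex K)) :=
    (((continuous_divOn K PT).neg.add (continuous_gradOn K q)).inner
      he.continuous).continuousOn.integrableOn_compact (isCompact_simplex K)
  have e1 : ∫ x in simplex K, resForm (T x) (b x) (q x) (classicalGrad e x) (e x) =
      ∫ x in simplex K, ((inner ℝ (T x - PT x) (classicalGrad e x) +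
        inner ℝ (fluxOn K PT q x) (classicalGrad e x)) + inner ℝ (b x) (e x) : ℝ) := by
    refine integral_congr_ae ?_
    filter_upwards [ae_all_iff.2 hPT, hq] with x hx hqx
    rw [inner_fluxOn hx hqx, inner_sub_left, resForm]
    ring
  have e2 : ∫ x in simplex K, (inner ℝ (resOn K PT b q x) (e x) : ℝ) =
      (∫ x in simplex K, (inner ℝ (-divOn K PT x + gradOn K q x) (e x) : ℝ)) +
      ∫ x in simplex K, (inner ℝ (b x) (e x) : ℝ) := by
    rw [← integral_add i4 i3]
    simp only [resOn, inner_add_left]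
  have i12 : Integrable (fun x => (inner ℝ (T x - PT x) (classicalGrad e x) +
      inner ℝ (fluxOn K PT q x) (classicalGrad e x) : ℝ)) (volume.restrict (simplex K)) := i1.add i2
  rw [e1, integral_add i12 i3, e2, sum_powersetCard_eq_sum_erase hK.card_eq]
  have e3 := integral_add i1 i2
  simp only [Pi.sub_apply] at e3
  rw [e3, integral_fluxOn hd hK PT q he]
  ring

end split

namespace Mesh
variable (𝒢 : Mesh Ω) {s p : ℝ} {T PT : Vec d → Mat d} {b : Vec d → Vec d} {q : Vec d → ℝ}

/-- The residual of a Lipschitz field that is smooth on the elements and vanishes outside `Ω`. -/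
theorem enorm_integral_resForm_le (hd : 1 ≤ d) (hΩ : IsLipschitzDomain Ω)
    (hsp : s.HolderConjugate p)
    (hT : MemLp T (ENNReal.ofReal s) (volume.restrict Ω))
    (hb : MemLp b (ENNReal.ofReal s) (volume.restrict Ω))
    (hq : MemLp q (ENNReal.ofReal s) (volume.restrict Ω))
    (hPT : ∀ K ∈ 𝒢.elems, ∀ ij, (fun x => PT x ij) =ᵐ[volume.restrict (simplex K)]
      polyOn K (fun x => PT x ij))
    (hqK : ∀ K ∈ 𝒢.elems, q =ᵐ[volume.restrict (simplex K)] polyOn K q)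
    {ψ : Vec d → Vec d} {M : ℝ≥0} (hψ : LipschitzWith M ψ) (hψΩ : ∀ x ∉ Ω, ψ x = 0)
    {e : Finset (Vec d) → Vec d → Vec d} (he : ∀ K ∈ 𝒢.elems, ContDiff ℝ 1 (e K))
    (heψ : ∀ K ∈ 𝒢.elems, ∀ x ∈ simplex K, ψ x = e K x) :
    ‖∫ x in Ω, resForm (T x) (b x) (q x) (weakGrad Ω ψ x) (ψ x)‖ₑ ≤
      ∑ K ∈ 𝒢.elems, ((∫⁻ x in simplex K, ‖T x - PT x‖ₑ * ‖classicalGrad (e K) x‖ₑ) +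
        (∫⁻ x in simplex K, ‖resOn K PT b q x‖ₑ * ‖e K x‖ₑ) +
        ∑ F ∈ K.powersetCard d, ∫⁻ x, ‖𝒢.jump PT q F x‖ₑ * ‖e K x‖ₑ ∂facetMeasure F) := by
  classical
  have hS := memSobolev_of_lipschitz hΩ.isBounded p hψ
  have hint := integrable_resForm hsp hT hb hq (hS.memLp_weakGrad hΩ.isOpen) hS.1
  rw [𝒢.setIntegral_eq_sum hΩ hint]
  have hle := fun {K} (hK : K ∈ 𝒢.elems) => 𝒢.restrict_simplex_le hΩ hK
  have h1 : ∀ K ∈ 𝒢.elems,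
      ∫ x in simplex K, resForm (T x) (b x) (q x) (weakGrad Ω ψ x) (ψ x) =
      (∫ x in simplex K, (inner ℝ (T x - PT x) (classicalGrad (e K) x) : ℝ)) +
      (∫ x in simplex K, (inner ℝ (resOn K PT b q x) (e K x) : ℝ)) +
      ∑ F ∈ K.powersetCard d, ∫ x, (inner ℝ (normalTrace K F PT q x) (ψ x) : ℝ)
        ∂facetMeasure F := by
    intro K hK
    have e1 : ∀ F ∈ K.powersetCard d,
        ∫ x, (inner ℝ (normalTrace K F PT q x) (ψ x) : ℝ) ∂facetMeasure F =
        ∫ x, (inner ℝ (normalTrace K F PT q x) (e K x) : ℝ) ∂facetMeasure F := by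
      intro F hF
      refine setIntegral_congr_fun (measurableSet_simplex F) fun x hx => ?_
      simp only [heψ K hK x (simplex_mono (Finset.mem_powersetCard.1 hF).1 hx)]
    rw [Finset.sum_congr rfl e1, ← integral_resForm_simplex hd (𝒢.isSimplex hK) hsp
      (hT.mono_measure (hle hK)) (hb.mono_measure (hle hK)) (hPT K hK) (hqK K hK) (he K hK)]
    refine integral_congr_ae ?_
    -- Off the null frontier, `ψ` coincides with the smooth `e K` in a neighbourhood, so the
    -- gradients agree.
    have hin : ∀ᵐ x ∂volume.restrict (simplex K), x ∈ interior (simplex K) := by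
      rw [ae_restrict_iff' (measurableSet_simplex K)]
      filter_upwards [measure_eq_zero_iff_ae_notMem.1 (volume_frontier_simplex K)] with x hx hxK
      by_contra hxi
      exact hx (by rw [(isClosed_simplex K).frontier_eq]; exact ⟨hxK, hxi⟩)
    filter_upwards [hin, (ae_mono (hle hK)) (weakGrad_ae_eq_classicalGrad hΩ.isOpen hψ)] with x hx hw
    have hev : ψ =ᶠ[𝓝 x] e K := by
      filter_upwards [isOpen_interior.mem_nhds hx] with y hy using
        heψ K hK y (_root_.interior_subset hy)
    rw [hw, classicalGrad, hev.fderiv_eq, hev.eq_of_nhds]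
    rfl
  rw [Finset.sum_congr rfl h1, Finset.sum_add_distrib, Finset.sum_add_distrib]
  refine (enorm_add_le _ _).trans ?_
  refine (add_le_add (enorm_add_le _ _) le_rfl).trans ?_
  rw [Finset.sum_add_distrib, Finset.sum_add_distrib]
  refine add_le_add (add_le_add ?_ ?_) ?_
  · refine (enorm_sum_le _ _).trans (Finset.sum_le_sum fun K _ => ?_)
    exact (enorm_integral_le_lintegral_enorm _).trans (lintegral_mono fun x => enorm_inner_le _ _)
  · refine (enorm_sum_le _ _).trans (Finset.sum_le_sum fun K _ => ?_)
    exact (enorm_integral_le_lintegral_enorm _).trans (lintegral_mono fun x => enorm_inner_le _ _)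
  · refine (𝒢.enorm_sum_normalTrace_le hd hΩ PT q hψ.continuous hψΩ).trans (le_of_eq ?_)
    refine Finset.sum_congr rfl fun K hK => Finset.sum_congr rfl fun F hF => ?_
    refine setLIntegral_congr_fun (measurableSet_simplex F) fun x hx => ?_
    simp only [heψ K hK x (simplex_mono (Finset.mem_powersetCard.1 hF).1 hx)]

end Mesh

/-! ### The residual bound for smooth fields -/

theorem integral_resForm_sub {s p : ℝ} (hsp : s.HolderConjugate p) (hΩ : IsOpen Ω)
    {T : Vec d → Mat d} {b : Vec d → Vec d} {q : Vec d → ℝ}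
    (hT : MemLp T (ENNReal.ofReal s) (volume.restrict Ω))
    (hb : MemLp b (ENNReal.ofReal s) (volume.restrict Ω))
    (hq : MemLp q (ENNReal.ofReal s) (volume.restrict Ω))
    {u v : Vec d → Vec d} (hu : MemSobolev Ω p u) (hv : MemSobolev Ω p v) :
    ∫ x in Ω, resForm (T x) (b x) (q x) (weakGrad Ω (u - v) x) ((u - v) x) =
      (∫ x in Ω, resForm (T x) (b x) (q x) (weakGrad Ω u x) (u x)) -
      ∫ x in Ω, resForm (T x) (b x) (q x) (weakGrad Ω v x) (v x) := by
  rw [← integral_sub (integrable_resForm hsp hT hb hq (hu.memLp_weakGrad hΩ) hu.1)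
    (integrable_resForm hsp hT hb hq (hv.memLp_weakGrad hΩ) hv.1)]
  refine integral_congr_ae ?_
  filter_upwards [hu.weakGrad_sub hΩ hv] with x hx
  rw [hx, Pi.sub_apply, Pi.sub_apply, resForm_sub]

namespace Mesh
variable (𝒢 : Mesh Ω)

/-- The local indicator for a lower-order term `b`. -/
noncomputable def residualIndicator (s : ℝ) (T PT : Vec d → Mat d) (b : Vec d → Vec d)
    (q : Vec d → ℝ) (K : Finset (Vec d)) : ℝ≥0∞ :=
  (∫⁻ x in simplex K, ‖𝒢.h x • resOn K PT b q x‖ₑ ^ s)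
  + (∑ F ∈ K.powersetCard d, ∫⁻ x, ‖𝒢.h x ^ (1 / s) • 𝒢.jump PT q F x‖ₑ ^ s ∂facetMeasure F)
  + ∫⁻ x in simplex K, ‖T x - PT x‖ₑ ^ s

variable {𝒢} {s p : ℝ} {T PT : Vec d → Mat d} {b : Vec d → Vec d} {q : Vec d → ℝ}

theorem h_nonneg (x : Vec d) : 0 ≤ 𝒢.h x := Real.rpow_nonneg ENNReal.toReal_nonneg _

theorem enorm_h_rpow_smul {s : ℝ} (hs : 0 < s) (x : Vec d) (y : Vec d) :
    ‖𝒢.h x ^ (1 / s) • y‖ₑ ^ s = ‖𝒢.h x‖ₑ * ‖y‖ₑ ^ s := by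
  rw [enorm_smul, ENNReal.mul_rpow_of_nonneg _ _ hs.le, Real.enorm_rpow_of_nonneg (h_nonneg x)
    (by positivity), ← ENNReal.rpow_mul, one_div_mul_cancel hs.ne', ENNReal.rpow_one]

theorem residualIndicator_ne_top (hd : 1 ≤ d) (hΩ : IsLipschitzDomain Ω) (hs : 1 < s)
    {K : Finset (Vec d)} (hK : K ∈ 𝒢.elems)
    (hT : MemLp T (ENNReal.ofReal s) (volume.restrict Ω))
    (hb : MemLp b (ENNReal.ofReal s) (volume.restrict Ω))
    (hPT : ∀ ij, (fun x => PT x ij) =ᵐ[volume.restrict (simplex K)]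
      polyOn K (fun x => PT x ij)) :
    𝒢.residualIndicator s T PT b q K ≠ ⊤ := by
  have hs0 : 0 < s := by linarith
  have hs' : ENNReal.ofReal s ≠ 0 := by simpa using hs0
  have hle := 𝒢.restrict_simplex_le hΩ hK
  obtain ⟨H, hH, hhH⟩ := 𝒢.exists_enorm_h_le hΩ
  have key : ∀ {E : Type} [NormedAddCommGroup E] {μ : Measure (Vec d)} {u : Vec d → E},
      MemLp u (ENNReal.ofReal s) μ → ∫⁻ x, ‖u x‖ₑ ^ s ∂μ < ⊤ := by
    intro E _ μ u hu
    have := lintegral_rpow_enorm_lt_top_of_eLpNorm_lt_top hs' ENNReal.ofReal_ne_top hu.2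
    rwa [ENNReal.toReal_ofReal hs0.le] at this
  refine ENNReal.add_ne_top.2 ⟨ENNReal.add_ne_top.2 ⟨?_, ?_⟩, ?_⟩
  · refine ((lintegral_mono (g := fun x => H ^ s * ‖resOn K PT b q x‖ₑ ^ s) fun x => ?_).trans_lt
      ?_).ne
    · rw [enorm_smul, ENNReal.mul_rpow_of_nonneg _ _ hs0.le]
      exact mul_le_mul_left (ENNReal.rpow_le_rpow (hhH x) hs0.le) _
    · rw [lintegral_const_mul' _ _ (by finiteness)]
      exact ENNReal.mul_lt_top (by finiteness) (key (memLp_resOn (hb.mono_measure hle)))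
  · refine ENNReal.sum_ne_top.2 fun F hF => ?_
    obtain ⟨hFK, hFc⟩ := Finset.mem_powersetCard.1 hF
    have := isFiniteMeasure_facetMeasure hd (𝒢.isSimplex hK) hFK hFc
    obtain ⟨C, hC⟩ := (isCompact_simplex F).exists_bound_of_continuousOn
      (𝒢.continuous_jump PT q F).continuousOn
    have hj : MemLp (𝒢.jump PT q F) (ENNReal.ofReal s) (facetMeasure F) :=
      MemLp.of_bound (𝒢.continuous_jump PT q F).aestronglyMeasurable C
        (ae_restrict_of_forall_mem (measurableSet_simplex F) hC)
    refine ((lintegral_mono (g := fun x => H * ‖𝒢.jump PT q F x‖ₑ ^ s) fun x => ?_).trans_lt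
      ?_).ne
    · rw [enorm_h_rpow_smul hs0]
      exact mul_le_mul_left (hhH x) _
    · rw [lintegral_const_mul' _ _ hH]
      exact ENNReal.mul_lt_top hH.lt_top (key hj)
  · exact (key ((hT.mono_measure hle).sub (memLp_of_polyOn hPT _))).ne

open Classical in
/-- The local residual is bounded by the local indicator. -/
theorem local_residual_le (hd : 1 ≤ d) (hΩ : IsLipschitzDomain Ω) (hsp : s.HolderConjugate p)
    {K : Finset (Vec d)} (hK : K ∈ 𝒢.elems) (hK0 : ediam K ≠ 0) {C D J : ℝ≥0∞}
    (hD : D ≠ ⊤) (hDh : ∀ x ∈ simplex K, ediam K ≤ D * ‖𝒢.h x‖ₑ)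
    (hT : MemLp T (ENNReal.ofReal s) (volume.restrict Ω))
    (hb : MemLp b (ENNReal.ofReal s) (volume.restrict Ω))
    (hPT : ∀ ij, (fun x => PT x ij) =ᵐ[volume.restrict (simplex K)]
      polyOn K (fun x => PT x ij))
    {e : Vec d → Vec d} (he : ContDiff ℝ 1 e)
    (h1 : ∫⁻ x in simplex K, ‖e x‖ₑ ^ p ≤ C * (ediam K ^ p * J))
    (h2 : ∫⁻ x in simplex K, ‖fderiv ℝ e x‖ₑ ^ p ≤ C * J)
    (h3 : ∀ v ∈ K, ediam K * ∫⁻ x, ‖e x‖ₑ ^ p ∂facetMeasure (K.erase v) ≤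
      C * (ediam K ^ p * J)) :
    (∫⁻ x in simplex K, ‖T x - PT x‖ₑ * ‖classicalGrad e x‖ₑ) +
      (∫⁻ x in simplex K, ‖resOn K PT b q x‖ₑ * ‖e x‖ₑ) +
      ∑ F ∈ K.powersetCard d, ∫⁻ x, ‖𝒢.jump PT q F x‖ₑ * ‖e x‖ₑ ∂facetMeasure F ≤
    (d + 3 : ℕ) * (((1 + D ^ s + D) * 𝒢.residualIndicator s T PT b q K) ^ (1 / s) *
      ((1 + (d : ℝ≥0∞) ^ p) * (C * J)) ^ (1 / p)) := by
  have hs0 := hsp.pos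
  have hp0 := hsp.symm.pos
  have hKs := 𝒢.isSimplex hK
  have hle := 𝒢.restrict_simplex_le hΩ hK
  set η := 𝒢.residualIndicator s T PT b q K with hη
  set A := 1 + D ^ s + D
  set B := (1 + (d : ℝ≥0∞) ^ p) * (C * J)
  have hA1 : 1 ≤ A := by simp only [A, add_assoc]; exact le_self_add
  have hA2 : D ^ s ≤ A := by
    simp only [A, add_comm (1 : ℝ≥0∞), add_assoc]; exact le_self_add
  have hA3 : D ≤ A := le_add_self
  have hCB : C * J ≤ B := le_mul_of_one_le_left zero_le le_self_add
  -- Weighted Hölder three times: the weight is `1` for the projection error, `ediam K` for the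
  -- element residual and `ediam K ^ (1 / s)` for the jumps, matching the powers of the mesh size in
  -- the indicator.
  have t1 : ∫⁻ x in simplex K, ‖T x - PT x‖ₑ * ‖classicalGrad e x‖ₑ ≤
      (A * η) ^ (1 / s) * B ^ (1 / p) := by
    refine lintegral_mul_le_of_scaled hsp (a := 1)
      ((hT.mono_measure hle).sub (memLp_of_polyOn hPT _)).1.enorm
      (continuous_classicalGrad he).enorm.aemeasurable ?_ ?_
    · rw [ENNReal.one_rpow, one_mul]
      refine le_trans ?_ (le_mul_of_one_le_left zero_le hA1)
      exact le_add_self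
    · rw [ENNReal.one_rpow, one_mul]
      calc _ ≤ ∫⁻ x in simplex K, (d : ℝ≥0∞) ^ p * ‖fderiv ℝ e x‖ₑ ^ p := by
            refine lintegral_mono fun x => ?_
            rw [← ENNReal.mul_rpow_of_nonneg _ _ hp0.le]
            gcongr
            have := norm_matOf_le (fderiv ℝ e x)
            rw [← ofReal_norm, ← ofReal_norm, ← ENNReal.ofReal_natCast,
              ← ENNReal.ofReal_mul (Nat.cast_nonneg d)]
            exact ENNReal.ofReal_le_ofReal this
        _ = (d : ℝ≥0∞) ^ p * ∫⁻ x in simplex K, ‖fderiv ℝ e x‖ₑ ^ p :=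
            lintegral_const_mul' _ _ (by finiteness)
        _ ≤ (d : ℝ≥0∞) ^ p * (C * J) := by gcongr
        _ ≤ B := by simp only [B]; gcongr; exact le_add_self
  have t2 : ∫⁻ x in simplex K, ‖resOn K PT b q x‖ₑ * ‖e x‖ₑ ≤
      (A * η) ^ (1 / s) * B ^ (1 / p) := by
    refine lintegral_mul_le_of_scaled hsp (a := ediam K)
      (memLp_resOn (hb.mono_measure hle)).1.enorm he.continuous.enorm.aemeasurable ?_ ?_
    · rw [← lintegral_const_mul' _ _ (ENNReal.rpow_ne_top_of_nonneg hs0.le (ediam_ne_top K))]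
      calc _ ≤ ∫⁻ x in simplex K, D ^ s * ‖𝒢.h x • resOn K PT b q x‖ₑ ^ s := by
            refine setLIntegral_mono' (measurableSet_simplex K) fun x hx => ?_
            rw [enorm_smul, ← ENNReal.mul_rpow_of_nonneg _ _ hs0.le,
              ← ENNReal.mul_rpow_of_nonneg _ _ hs0.le, ← mul_assoc]
            gcongr
            exact hDh x hx
        _ = D ^ s * ∫⁻ x in simplex K, ‖𝒢.h x • resOn K PT b q x‖ₑ ^ s :=
            lintegral_const_mul' _ _ (by finiteness)
        _ ≤ A * η := by
            gcongr
            rw [hη, residualIndicator, add_assoc]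
            exact le_self_add
    · refine h1.trans ?_
      calc _ = ediam K ^ p * (C * J) := by ring
        _ ≤ _ := by gcongr
  have t3 : ∀ F ∈ K.powersetCard d, ∫⁻ x, ‖𝒢.jump PT q F x‖ₑ * ‖e x‖ₑ ∂facetMeasure F ≤
      (A * η) ^ (1 / s) * B ^ (1 / p) := by
    intro F hF
    refine lintegral_mul_le_of_scaled hsp (a := ediam K ^ (1 / s))
      (𝒢.continuous_jump PT q F).enorm.aemeasurable he.continuous.enorm.aemeasurable ?_ ?_
    · rw [← ENNReal.rpow_mul, one_div_mul_cancel hs0.ne', ENNReal.rpow_one,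
        ← lintegral_const_mul' _ _ (ediam_ne_top K)]
      calc _ ≤ ∫⁻ x, D * ‖𝒢.h x ^ (1 / s) • 𝒢.jump PT q F x‖ₑ ^ s ∂facetMeasure F := by
            refine setLIntegral_mono' (measurableSet_simplex F) fun x hx => ?_
            rw [enorm_h_rpow_smul hs0, ← mul_assoc]
            gcongr
            exact hDh x (simplex_mono (Finset.mem_powersetCard.1 hF).1 hx)
        _ = D * ∫⁻ x, ‖𝒢.h x ^ (1 / s) • 𝒢.jump PT q F x‖ₑ ^ s ∂facetMeasure F :=
            lintegral_const_mul' _ _ hD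
        _ ≤ A * η := by
            gcongr
            refine (Finset.single_le_sum (f := fun F =>
              ∫⁻ x, ‖𝒢.h x ^ (1 / s) • 𝒢.jump PT q F x‖ₑ ^ s ∂facetMeasure F)
              (fun _ _ => zero_le) hF).trans ?_
            rw [hη, residualIndicator, add_assoc]
            exact le_self_add.trans le_add_self
    · have h4 : ∀ F ∈ K.powersetCard d, ediam K * ∫⁻ x, ‖e x‖ₑ ^ p ∂facetMeasure F ≤
          C * (ediam K ^ p * J) := by
        intro F hF
        obtain ⟨hFK, hFc⟩ := Finset.mem_powersetCard.1 hF
        obtain ⟨v, hv⟩ := Finset.card_eq_one.1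
          (show (K \ F).card = 1 by rw [Finset.card_sdiff_of_subset hFK, hKs.card_eq]; omega)
        have hF' : F = K.erase v := by
          rw [Finset.erase_eq, ← hv, Finset.sdiff_sdiff_eq_self hFK]
        rw [hF']
        exact h3 v (Finset.mem_sdiff.1 (hv ▸ Finset.mem_singleton_self v)).1
      -- Conjugacy gives `p / s + 1 = p`; the additional `1` is the diameter multiplying the trace
      -- estimate.
      have e1 : (ediam K ^ (1 / s)) ^ p * ediam K = ediam K ^ p := by
        have hexp : 1 / s * p + 1 = p := by
          have := hsp.symm.sub_one_mul_conj
          have h5 := hsp.symm.mul_eq_add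
          field_simp
          linarith
        conv_rhs => rw [← hexp]
        rw [← ENNReal.rpow_mul, ENNReal.rpow_add _ _ hK0 (ediam_ne_top K), ENNReal.rpow_one]
      refine (ENNReal.mul_le_mul_iff_right hK0 (ediam_ne_top K)).1 ((h4 F hF).trans ?_)
      rw [← e1]
      calc _ = ediam K * ((ediam K ^ (1 / s)) ^ p * (C * J)) := by ring
        _ ≤ _ := by gcongr
  -- Two volume terms and `d + 1` facets make `d + 3` equal bounds.
  refine (add_le_add (add_le_add t1 t2) (Finset.sum_le_card_nsmul _ _ _ t3)).trans (le_of_eq ?_)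
  rw [Finset.card_powersetCard, hKs.card_eq, Nat.choose_succ_self_right, nsmul_eq_mul]
  push_cast
  ring

/-- The residual of a smooth field is bounded by the estimator. -/
theorem exists_residual_le (hd : 1 ≤ d) (σ : ℝ) (hsp : s.HolderConjugate p) :
    ∃ C : ℝ≥0∞, C ≠ ⊤ ∧ ∀ (Ω : Set (Vec d)), IsLipschitzDomain Ω → ∀ 𝒢 : Mesh Ω, 𝒢.ShapeRegular σ →
      ∀ (T PT : Vec d → Mat d) (b : Vec d → Vec d) (q : Vec d → ℝ),
      MemLp T (ENNReal.ofReal s) (volume.restrict Ω) →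
      MemLp b (ENNReal.ofReal s) (volume.restrict Ω) →
      MemLp q (ENNReal.ofReal s) (volume.restrict Ω) →
      (∀ K ∈ 𝒢.elems, ∀ ij, (fun x => PT x ij) =ᵐ[volume.restrict (simplex K)]
        polyOn K (fun x => PT x ij)) →
      (∀ K ∈ 𝒢.elems, q =ᵐ[volume.restrict (simplex K)] polyOn K q) →
      (∀ V c : Vec d → Vec d, Continuous V → (∀ x ∉ Ω, V x = 0) →
        (∀ K ∈ 𝒢.elems, ∀ x ∈ simplex K, V x = nodalAffine c K x) →
        (∃ M, LipschitzWith M V) ∧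
        ∫ x in Ω, resForm (T x) (b x) (q x) (weakGrad Ω V x) (V x) = 0) →
      ∀ φ : Vec d → Vec d, ContDiff ℝ ∞ φ → HasCompactSupport φ → tsupport φ ⊆ Ω →
        ‖∫ x in Ω, resForm (T x) (b x) (q x) (weakGrad Ω φ x) (φ x)‖ₑ ≤
          C * (∑ K ∈ 𝒢.elems, 𝒢.residualIndicator s T PT b q K) ^ (1 / s) *
            eLpNorm (weakGrad Ω φ) (ENNReal.ofReal p) (volume.restrict Ω) := by
  classical
  have hs0 := hsp.pos
  have hp0 := hsp.symm.pos
  obtain ⟨C, hC, hquasi⟩ := exists_quasiInterpolant hd σ hsp.symm.lt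
  obtain ⟨D, hD, hDh⟩ := exists_ediam_le_h hd σ
  set A : ℝ≥0∞ := 1 + D ^ s + D
  set B : ℝ≥0∞ := (1 + (d : ℝ≥0∞) ^ p) * C
  refine ⟨(d + 3 : ℕ) * A ^ (1 / s) * (B * C) ^ (1 / p), ?_, ?_⟩
  · have hA : A ≠ ⊤ := by finiteness
    have hB : B ≠ ⊤ := by finiteness
    finiteness
  intro Ω hΩ 𝒢 hσ T PT b q hT hb hq hPT hqK hgal φ hφ hφc hφΩ
  have hφ0 : ∀ x ∉ Ω, φ x = 0 := fun x hx => image_eq_zero_of_notMem_tsupport fun h => hx (hφΩ h)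
  have hφ1 : ContDiff ℝ 1 φ := hφ.of_le (by simp)
  obtain ⟨c, J, hc0, hJ, hcJ⟩ := hquasi Ω hΩ 𝒢 hσ φ hφ1 hφ0
  obtain ⟨V, hVc, hV0, hVK⟩ := 𝒢.exists_interpolant hΩ c hc0
  obtain ⟨⟨M, hM⟩, hVorth⟩ := hgal V c hVc hV0 hVK
  obtain ⟨N, hN⟩ := ContDiff.lipschitzWith_of_hasCompactSupport hφc hφ (by simp)
  -- Galerkin orthogonality: the interpolant contributes nothing, so `φ` may be replaced by `φ - V`.
  have hsub := integral_resForm_sub hsp hΩ.isOpen hT hb hq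
    (memSobolev_of_lipschitz hΩ.isBounded p hN) (memSobolev_of_lipschitz hΩ.isBounded p hM)
  rw [hVorth, sub_zero] at hsub
  rw [← hsub]
  refine (𝒢.enorm_integral_resForm_le hd hΩ hsp hT hb hq hPT hqK (hN.sub hM)
    (fun x hx => by simp [hφ0 x hx, hV0 x hx]) (e := interpError φ c)
    (fun K _ => contDiff_interpError hφ1 c K)
    fun K hK x hx => by simp only [interpError, nodalAffine, hVK K hK x hx]).trans ?_
  have hloc : ∀ K ∈ 𝒢.elems, _ := fun K hK =>
    local_residual_le (q := q) hd hΩ hsp hK (IsRegular.ediam_ne_zero hd (hσ K hK)) hD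
      (hDh Ω hΩ 𝒢 hσ K hK) hT hb (hPT K hK) (contDiff_interpError hφ1 c K) (hcJ K hK).1
      (hcJ K hK).2.1 (hcJ K hK).2.2
  refine (Finset.sum_le_sum hloc).trans ?_
  rw [← Finset.mul_sum]
  have hgrad : ∫⁻ x in Ω, ‖fderiv ℝ φ x‖ₑ ^ p ≤ ∫⁻ x in Ω, ‖weakGrad Ω φ x‖ₑ ^ p := by
    refine lintegral_mono_ae ?_
    filter_upwards [weakGrad_ae_eq_classicalGrad hΩ.isOpen hN] with x hx
    rw [hx]
    gcongr
    rw [← ofReal_norm, ← ofReal_norm]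
    exact ENNReal.ofReal_le_ofReal (norm_le_norm_matOf _)
  -- Discrete Hölder over the elements: the indicators sum to the estimator, and the `J K` to the
  -- gradient norm by bounded overlap.
  have hHolder := ENNReal.inner_le_Lp_mul_Lq 𝒢.elems
    (fun K => (A * 𝒢.residualIndicator s T PT b q K) ^ (1 / s))
    (fun K => ((1 + (d : ℝ≥0∞) ^ p) * (C * J K)) ^ (1 / p)) hsp
  simp only [← ENNReal.rpow_mul, one_div_mul_cancel hs0.ne', one_div_mul_cancel hp0.ne',
    ENNReal.rpow_one, ← Finset.mul_sum] at hHolder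
  have hJ' : (1 + (d : ℝ≥0∞) ^ p) * (C * ∑ K ∈ 𝒢.elems, J K) ≤
      B * C * ∫⁻ x in Ω, ‖weakGrad Ω φ x‖ₑ ^ p := by
    calc _ ≤ (1 + (d : ℝ≥0∞) ^ p) * (C * (C * ∫⁻ x in Ω, ‖weakGrad Ω φ x‖ₑ ^ p)) := by
          gcongr
          exact hJ.trans (by gcongr)
      _ = _ := by simp only [B]; ring
  calc _ ≤ ((d + 3 : ℕ) : ℝ≥0∞) * ((A * ∑ K ∈ 𝒢.elems, 𝒢.residualIndicator s T PT b q K) ^ (1 / s) *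
        (B * C * ∫⁻ x in Ω, ‖weakGrad Ω φ x‖ₑ ^ p) ^ (1 / p)) := by
        refine mul_le_mul_right (hHolder.trans ?_) _
        gcongr
    _ = _ := by
        rw [eLpNorm_eq_lintegral_rpow_enorm_toReal (by simpa using hp0) ENNReal.ofReal_ne_top,
          ENNReal.toReal_ofReal hp0.le, ENNReal.mul_rpow_of_nonneg _ _ (by positivity),
          ENNReal.mul_rpow_of_nonneg (B * C) _ (by positivity)]
        ring

end Mesh

/-! ### The residual of the momentum equation -/

theorem stress_mem_symMat (S : Vec d → SymMat d → SymMat d) (U : Vec d → Vec d) (x : Vec d) :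
    stress Ω S U x ∈ SymMat d := (S x (symGrad Ω U x)).2

theorem memLp_one_of_memLp {E : Type*} [NormedAddCommGroup E] (hΩ : IsLipschitzDomain Ω) {s : ℝ}
    (hs : 1 ≤ s) {u : Vec d → E} (hu : MemLp u (ENNReal.ofReal s) (volume.restrict Ω)) :
    MemLp u 1 (volume.restrict Ω) := by
  have : IsFiniteMeasure (volume.restrict Ω) := ⟨by simpa using hΩ.isBounded.measure_lt_top⟩
  exact hu.mono_exponent (by simpa using hs)

theorem project_ae_eq {𝒢 : Mesh Ω} {m : ℕ} {Pi : L1Mat Ω →ₗ[ℝ] L1Mat Ω}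
    (hPi : IsStressProjector 𝒢 m Pi) {T : Vec d → Mat d} (hT : MemLp T 1 (volume.restrict Ω))
    {K : Finset (Vec d)} (hK : K ∈ 𝒢.elems) (ij : Fin d × Fin d) :
    (fun x => project Pi T x ij) =ᵐ[volume.restrict (simplex K)]
      polyOn K (fun x => project Pi T x ij) := by
  refine polyOn_spec ?_
  rw [project, dif_pos hT]
  obtain ⟨q, hq, he⟩ := hPi.range (hT.toLp T) ij.1 ij.2 K hK
  exact ⟨q, ⟨m, hq⟩, he⟩

theorem indicatorPde_eq {𝒢 : Mesh Ω} (s : ℝ) (f U : Vec d → Vec d) (P : Vec d → ℝ)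
    (T PT : Vec d → Mat d) (K : Finset (Vec d)) : 𝒢.indicatorPde s f U P T PT K =
      𝒢.residualIndicator s T PT (fun x => convection Ω U x - f x) P K := by
  have : ∀ x, -divOn K PT x + convection Ω U x + gradOn K P x - f x =
      resOn K PT (fun x => convection Ω U x - f x) P x := fun x => by
    simp only [resOn]; abel
  simp only [Mesh.indicatorPde, Mesh.residualIndicator, this]

section residual
variable {T : Vec d → Mat d} {f U : Vec d → Vec d} {P : Vec d → ℝ} {s p : ℝ}

theorem resPde_eq (hT : ∀ x, T x ∈ SymMat d) (w : Vec d → Vec d) : resPde Ω f U P T w =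
    ∫ x in Ω, resForm (T x) (convection Ω U x - f x) (P x) (weakGrad Ω w x) (w x) := by
  simp only [resPde, resPdeIntegrand_eq (hT _)]

/-- A functional bounded on test functions by the gradient norm is bounded on `W^{1,p}_0`. -/
theorem enorm_integral_resForm_le_sobolevNorm (hΩ : IsLipschitzDomain Ω) (hsp : s.HolderConjugate p)
    {b : Vec d → Vec d} {q : Vec d → ℝ}
    (hT : MemLp T (ENNReal.ofReal s) (volume.restrict Ω))
    (hb : MemLp b (ENNReal.ofReal s) (volume.restrict Ω))
    (hq : MemLp q (ENNReal.ofReal s) (volume.restrict Ω)) {A : ℝ≥0∞} (hA : A ≠ ⊤)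
    (hsmooth : ∀ φ : Vec d → Vec d, ContDiff ℝ ∞ φ → HasCompactSupport φ → tsupport φ ⊆ Ω →
        ‖∫ x in Ω, resForm (T x) (b x) (q x) (weakGrad Ω φ x) (φ x)‖ₑ ≤
          A * eLpNorm (weakGrad Ω φ) (ENNReal.ofReal p) (volume.restrict Ω))
    {w : Vec d → Vec d} (hw : MemSobolevZero Ω p w) :
    ‖∫ x in Ω, resForm (T x) (b x) (q x) (weakGrad Ω w x) (w x)‖ₑ ≤ A * sobolevNorm Ω p w := by
  have hp0 := hsp.symm.pos
  have hp1 : 1 ≤ ENNReal.ofReal p := by simpa using hsp.symm.lt.le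
  set R : (Vec d → Vec d) → ℝ := fun w =>
    ∫ x in Ω, resForm (T x) (b x) (q x) (weakGrad Ω w x) (w x)
  set M : ℝ≥0∞ := eLpNorm T (ENNReal.ofReal s) (volume.restrict Ω) +
    eLpNorm b (ENNReal.ofReal s) (volume.restrict Ω) +
    d * eLpNorm q (ENNReal.ofReal s) (volume.restrict Ω)
  have hM : M ≠ ⊤ := by
    have := hT.2.ne; have := hb.2.ne; have := hq.2.ne
    finiteness
  -- A crude bound with the data-dependent constant `M`. It is applied only to the remainder `w -
  -- φ`, so it leaves no trace in the estimate.
  have hbound : ∀ u, MemSobolev Ω p u → ‖R u‖ₑ ≤ M * sobolevNorm Ω p u := by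
    intro u hu
    have hu' := hu.memLp_weakGrad hΩ.isOpen
    refine (enorm_integral_le_lintegral_enorm _).trans
      ((lintegral_enorm_resForm_le hsp hT.1 hb.1 hq.1 hu'.1 hu.1.1).trans ?_)
    have n1 := eLpNorm_weakGrad_le_sobolevNorm (Ω := Ω) hp0 u
    have n2 := eLpNorm_le_sobolevNorm (Ω := Ω) hp0 u
    rw [add_mul, add_mul, mul_assoc (d : ℝ≥0∞)]
    gcongr
  refine ENNReal.le_of_forall_pos_le_add fun δ hδ _ => ?_
  -- Chosen so that the total error `(A + M) * ε` is at most `δ`.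
  set ε : ℝ≥0∞ := δ / (A + M + 1)
  have hden : A + M + 1 ≠ ⊤ := by finiteness
  have hε : 0 < ε := ENNReal.div_pos (by simpa using hδ.ne') hden
  obtain ⟨φ, hφ, hφc, hφΩ, hφε⟩ := hw.2 ε hε
  obtain ⟨N, hN⟩ := ContDiff.lipschitzWith_of_hasCompactSupport hφc hφ (by simp)
  have hφS := memSobolev_of_lipschitz (Ω := Ω) hΩ.isBounded p hN
  have hsub : R (w - φ) = R w - R φ :=
    integral_resForm_sub hsp hΩ.isOpen hT hb hq hw.1 hφS
  have hRw : R w = R (w - φ) + R φ := by rw [hsub]; ring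
  have hgrad : eLpNorm (weakGrad Ω φ) (ENNReal.ofReal p) (volume.restrict Ω) ≤
      sobolevNorm Ω p w + ε := by
    have e : weakGrad Ω φ =ᵐ[volume.restrict Ω] weakGrad Ω w - weakGrad Ω (w - φ) := by
      filter_upwards [hw.1.weakGrad_sub hΩ.isOpen hφS] with x hx
      simp only [Pi.sub_apply, hx, sub_sub_cancel]
    rw [eLpNorm_congr_ae e]
    refine (eLpNorm_sub_le (hw.1.memLp_weakGrad hΩ.isOpen).1
      ((hw.1.sub hφS).memLp_weakGrad hΩ.isOpen).1 hp1).trans (add_le_add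
      (eLpNorm_weakGrad_le_sobolevNorm hp0 w)
      ((eLpNorm_weakGrad_le_sobolevNorm hp0 _).trans hφε.le))
  change ‖R w‖ₑ ≤ _
  calc ‖R w‖ₑ ≤ ‖R (w - φ)‖ₑ + ‖R φ‖ₑ := by rw [hRw]; exact enorm_add_le _ _
    _ ≤ M * ε + A * (sobolevNorm Ω p w + ε) := by
        refine add_le_add ((hbound _ (hw.1.sub hφS)).trans (by gcongr)) ?_
        exact (hsmooth φ hφ hφc hφΩ).trans (by gcongr)
    _ = A * sobolevNorm Ω p w + (A + M) * ε := by ring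
    _ ≤ A * sobolevNorm Ω p w + δ := by
        gcongr
        calc (A + M) * ε ≤ (A + M + 1) * ε := mul_le_mul_left le_self_add _
          _ = δ := ENNReal.mul_div_cancel (by simp) hden

end residual

/-- The residual estimate for the momentum equation. -/
theorem exists_resPde_estimate (hd : 1 ≤ d) (σ : ℝ) {s : ℝ} (hs : 1 < s) :
    ∃ C : ℝ≥0∞, C ≠ ⊤ ∧ ∀ r t : ℝ, Exponents d r t s → ∀ Ω : Set (Vec d), IsLipschitzDomain Ω →
      ∀ f : Vec d → Vec d, MemLp f (ENNReal.ofReal r.conjExponent) (volume.restrict Ω) →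
      ∀ S : ℕ → Vec d → SymMat d → SymMat d, IsStressApproximation Ω r S →
      ∀ 𝒢 : Mesh Ω, 𝒢.ShapeRegular σ → ∀ (l j : ℕ) (X : FESpaces 𝒢 l j)
        (Pi : L1Mat Ω →ₗ[ℝ] L1Mat Ω), IsStressProjector 𝒢 (l - 1) Pi →
      ∀ (n : ℕ) (U : Vec d → Vec d) (P : Vec d → ℝ), IsGalerkin X (S n) f U P →
        (∀ w, MemSobolevZero Ω s.conjExponent w →
          IntegrableOn (resPdeIntegrand Ω f U P (stress Ω (S n) U) w) Ω volume) ∧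
        𝒢.estimatorPde s f U P (stress Ω (S n) U) (project Pi (stress Ω (S n) U)) ≠ ⊤ ∧
        dualNorm Ω s.conjExponent (resPde Ω f U P (stress Ω (S n) U)) ≤
          C * 𝒢.estimatorPde s f U P (stress Ω (S n) U)
            (project Pi (stress Ω (S n) U)) ^ (1 / s) := by
  have hsp := Real.HolderConjugate.conjExponent hs
  obtain ⟨C, hC, hres⟩ := Mesh.exists_residual_le hd σ hsp
  refine ⟨C, hC, fun r t hrt Ω hΩ f hf S hS 𝒢 hσ l j X Pi hPi n U P hUP => ?_⟩
  obtain ⟨hr, -, -, hsr⟩ := hrt.bounds hd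
  have : IsFiniteMeasure (volume.restrict Ω) := ⟨by simpa using hΩ.isBounded.measure_lt_top⟩
  obtain ⟨M, hM⟩ := X.exists_lipschitzWith hΩ hUP.velocity_mem
  set T := stress Ω (S n) U
  set PT := project Pi T
  set b : Vec d → Vec d := fun x => convection Ω U x - f x
  have hTs : ∀ x, T x ∈ SymMat d := stress_mem_symMat (S n) U
  have hexp := ENNReal.ofReal_le_ofReal hsr
  have hT : MemLp T (ENNReal.ofReal s) (volume.restrict Ω) :=
    (memLp_stress hΩ hM hr hS n).mono_exponent hexp
  have hfs : MemLp f (ENNReal.ofReal s) (volume.restrict Ω) := hf.mono_exponent hexp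
  have hc : MemLp (convection Ω U) (ENNReal.ofReal s) (volume.restrict Ω) :=
    memLp_convection hΩ hM _
  have hb : MemLp b (ENNReal.ofReal s) (volume.restrict Ω) := hc.sub hfs
  have hq : MemLp P (ENNReal.ofReal s) (volume.restrict Ω) :=
    (X.QQ_bounded P hUP.pressure_mem.1).mono_exponent le_top
  have hPT : ∀ K ∈ 𝒢.elems, ∀ ij, (fun x => PT x ij) =ᵐ[volume.restrict (simplex K)]
      polyOn K (fun x => PT x ij) := fun K hK ij =>
    project_ae_eq hPi (memLp_one_of_memLp hΩ hs.le hT) hK ij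
  have hPK : ∀ K ∈ 𝒢.elems, P =ᵐ[volume.restrict (simplex K)] polyOn K P := fun K hK =>
    X.pressure_ae_eq hUP.pressure_mem hK
  have hint : ∀ w, MemSobolev Ω s.conjExponent w →
      IntegrableOn (resPdeIntegrand Ω f U P T w) Ω volume := by
    intro w hw
    refine (integrable_resForm hsp hT hb hq (hw.memLp_weakGrad hΩ.isOpen) hw.1).congr
      (ae_of_all _ fun x => ?_)
    exact (resPdeIntegrand_eq (hTs x) f U w P).symm
  have hest : 𝒢.estimatorPde s f U P T PT = ∑ K ∈ 𝒢.elems, 𝒢.residualIndicator s T PT b P K :=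
    Finset.sum_congr rfl fun K _ => indicatorPde_eq s f U P T PT K
  have hfin : 𝒢.estimatorPde s f U P T PT ≠ ⊤ := by
    rw [hest]
    exact ENNReal.sum_ne_top.2 fun K hK =>
      Mesh.residualIndicator_ne_top hd hΩ hs hK hT hb (hPT K hK)
  refine ⟨fun w hw => hint w hw.1, hfin, iSup₂_le fun w hw => ENNReal.div_le_of_le_mul ?_⟩
  -- The continuous piecewise affine fields vanishing outside `Ω` are discrete velocities, so the
  -- momentum equation may be tested with them.
  have hgal : ∀ V c : Vec d → Vec d, Continuous V → (∀ x ∉ Ω, V x = 0) →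
      (∀ K ∈ 𝒢.elems, ∀ x ∈ simplex K, V x = nodalAffine c K x) →
      (∃ M, LipschitzWith M V) ∧
      ∫ x in Ω, resForm (T x) (b x) (P x) (weakGrad Ω V x) (V x) = 0 := by
    intro V c hV hV0 hVc
    have hVX := X.mem_velocity_of_nodalAffine hV hV0 hVc
    obtain ⟨N, hN⟩ := X.exists_lipschitzWith hΩ hVX
    have hVS := memSobolev_of_lipschitz (Ω := Ω) hΩ.isBounded s.conjExponent hN
    refine ⟨⟨N, hN⟩, ?_⟩
    have hfV := integrable_inner_of_memLp hsp hfs hVS.1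
    have hmom := hUP.momentum V hVX
    rw [← resPde_eq hTs, resPde]
    have e : (fun x => (inner ℝ (T x) (symGrad Ω V x : Mat d) + inner ℝ (convection Ω U x) (V x)
        - P x * divergence Ω V x : ℝ)) = fun x => resPdeIntegrand Ω f U P T V x +
          inner ℝ (f x) (V x) := by
      ext x
      simp only [resPdeIntegrand]
      ring
    rw [e, integral_add (hint V hVS) hfV] at hmom
    linarith
  have hfin' : C * 𝒢.estimatorPde s f U P T PT ^ (1 / s) ≠ ⊤ :=
    ENNReal.mul_ne_top hC (ENNReal.rpow_ne_top_of_nonneg (by positivity) hfin)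
  have hmain := enorm_integral_resForm_le_sobolevNorm hΩ hsp hT hb hq hfin' (fun φ hφ hφc hφΩ => by
    rw [hest]
    exact hres Ω hΩ 𝒢 hσ T PT b P hT hb hq hPT hPK hgal φ hφ hφc hφΩ) hw
  refine le_trans ?_ hmain
  rw [resPde_eq hTs]
  exact Real.ofReal_le_enorm _

/-! ### The residual of the incompressibility equation -/

/-- The divergence of a Lipschitz field vanishing outside the domain has mean value zero. -/
theorem integral_divergence_eq_zero (𝒢 : Mesh Ω) (hΩ : IsLipschitzDomain Ω) {U : Vec d → Vec d}
    {M : ℝ≥0} (hU : LipschitzWith M U) (hU0 : ∀ x ∉ Ω, U x = 0) :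
    ∫ x in Ω, divergence Ω U x = 0 := by
  have : IsFiniteMeasure (volume.restrict Ω) := ⟨by simpa using hΩ.isBounded.measure_lt_top⟩
  have e : divergence Ω U =ᵐ[volume.restrict Ω] fun x => ∑ i, classicalGrad U x (i, i) := by
    filter_upwards [weakGrad_ae_eq_classicalGrad hΩ.isOpen hU] with x hx
    simp only [divergence, hx]
  have hi : ∀ i, Integrable (fun x => classicalGrad U x (i, i)) (volume.restrict Ω) := fun i =>
    (EuclideanSpace.proj (i, i) : Mat d →L[ℝ] ℝ).integrable_comp
      (memLp_one_iff_integrable.1 (memLp_classicalGrad hΩ.isBounded hU 1))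
  rw [integral_congr_ae e, integral_finsetSum _ fun i _ => hi i]
  refine Finset.sum_eq_zero fun i _ => ?_
  have hcs : HasCompactSupport fun x => U x i :=
    HasCompactSupport.intro hΩ.isBounded.isCompact_closure fun x hx => by
      rw [hU0 x fun h => hx (subset_closure h)]; rfl
  -- Integration by parts against the constant one, whose derivative vanishes; each component of `U`
  -- has compact support.
  have h := (LipschitzWith.const (1 : ℝ) : LipschitzWith 0 fun _ : Vec d => (1 : ℝ)
    ).integral_lineDeriv_mul_eq (lipschitzWith_apply hU i) hcs
    (-EuclideanSpace.single i (1 : ℝ)) (μ := volume)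
  simp only [neg_neg, mul_one] at h
  rw [integral_congr_ae (ae_lineDeriv_apply_eq hU i i)] at h
  rw [𝒢.restrict_eq_closure hΩ, setIntegral_eq_integral_of_forall_compl_eq_zero, ← h]
  · refine integral_eq_zero_of_ae (ae_of_all _ fun x => ?_)
    have : lineDeriv ℝ (fun _ : Vec d => (1 : ℝ)) x (-EuclideanSpace.single i 1) = 0 := by
      simp [lineDeriv]
    simp [this]
  · intro x hx
    have hev : U =ᶠ[𝓝 x] fun _ => 0 := by
      filter_upwards [isClosed_closure.isOpen_compl.mem_nhds hx] with y hy using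
        hU0 y fun h => hy (subset_closure h)
    rw [classicalGrad_apply, hev.fderiv_eq]
    simp

theorem estimatorIc_rpow {𝒢 : Mesh Ω} (hΩ : IsLipschitzDomain Ω) {t : ℝ} (ht : 1 < t)
    (U : Vec d → Vec d) : 𝒢.estimatorIc t U ^ (1 / t) =
      eLpNorm (divergence Ω U) (ENNReal.ofReal t) (volume.restrict Ω) := by
  rw [Mesh.estimatorIc, 𝒢.cover, ← 𝒢.restrict_eq_closure hΩ, ← ENNReal.rpow_mul,
    mul_one_div_cancel (by linarith), ENNReal.rpow_one]

/-- Duality of `L^t` modulo constants for functions of mean value zero. -/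
theorem iSup_integral_div_eq {α : Type*} [MeasurableSpace α] {μ : Measure α} [IsFiniteMeasure μ]
    {t t' : ℝ} (htt : t.HolderConjugate t') {g : α → ℝ} (hg : MemLp g (ENNReal.ofReal t) μ)
    (hg0 : ∫ x, g x ∂μ = 0) :
    (⨆ (o : α → ℝ) (_ : MemLp o (ENNReal.ofReal t') μ), ENNReal.ofReal (-∫ x, o x * g x ∂μ) /
      ⨅ c : ℝ, eLpNorm (fun x => o x - c) (ENNReal.ofReal t') μ) = eLpNorm g (ENNReal.ofReal t) μ := by
  have ht0 := htt.pos
  have ht0' := htt.symm.pos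
  have hN : ∀ {u : α → ℝ} {s : ℝ}, 0 < s →
      eLpNorm u (ENNReal.ofReal s) μ = (∫⁻ x, ‖u x‖ₑ ^ s ∂μ) ^ (1 / s) := by
    intro u s hs
    rw [eLpNorm_eq_lintegral_rpow_enorm_toReal (by simpa using hs) ENNReal.ofReal_ne_top,
      ENNReal.toReal_ofReal hs.le]
  have hmul : ∀ {o : α → ℝ}, MemLp o (ENNReal.ofReal t') μ →
      ∫⁻ x, ‖o x * g x‖ₑ ∂μ ≤
        eLpNorm g (ENNReal.ofReal t) μ * eLpNorm o (ENNReal.ofReal t') μ := by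
    intro o ho
    rw [hN ht0, hN ht0']
    simp only [enorm_mul, mul_comm ‖o _‖ₑ]
    exact ENNReal.lintegral_mul_le_Lp_mul_Lq μ htt hg.1.enorm ho.1.enorm
  have hint : ∀ {o : α → ℝ}, MemLp o (ENNReal.ofReal t') μ → Integrable (fun x => o x * g x) μ :=
    fun ho => ⟨ho.1.mul hg.1, (hmul ho).trans_lt (ENNReal.mul_lt_top hg.2 ho.2)⟩
  have hg1 : Integrable g μ :=
    memLp_one_iff_integrable.1 (hg.mono_exponent (by simpa using htt.lt.le))
  refine le_antisymm (iSup₂_le fun o ho => ENNReal.div_le_of_le_mul ?_) ?_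
  -- Since `g` has mean zero, any constant `c` may be subtracted from `o` before Hölder's inequality
  -- is applied.
  · rw [ENNReal.mul_iInf fun h => absurd h hg.2.ne]
    refine le_iInf fun c => ?_
    have ho' : MemLp (fun x => o x - c) (ENNReal.ofReal t') μ := ho.sub (memLp_const c)
    have e : ∫ x, o x * g x ∂μ = ∫ x, (o x - c) * g x ∂μ := by
      simp only [sub_mul]
      rw [integral_sub (hint ho) (hg1.const_mul c), integral_const_mul, hg0, mul_zero, sub_zero]
    rw [e]
    refine (Real.ofReal_le_enorm _).trans ?_
    rw [enorm_neg]
    exact (enorm_integral_le_lintegral_enorm _).trans (hmul ho')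
  · set X := ∫⁻ x, ‖g x‖ₑ ^ t ∂μ with hX
    rw [hN ht0, ← hX]
    have hXt : X ≠ ⊤ := by
      have := lintegral_rpow_enorm_lt_top_of_eLpNorm_lt_top (by simpa using ht0)
        ENNReal.ofReal_ne_top hg.2
      rw [ENNReal.toReal_ofReal ht0.le] at this
      exact this.ne
    -- The quotient below needs `X ≠ 0`; for `X = 0` the right-hand side is zero.
    rcases eq_or_ne X 0 with hX0 | hX0
    · rw [hX0, ENNReal.zero_rpow_of_pos (by positivity)]
      exact zero_le
    -- The extremal function of Hölder's inequality, with `|o| ^ t' = |g| ^ t`; the minus sign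
    -- matches that of the residual.
    set o : α → ℝ := fun x => -(g x * |g x| ^ (t - 2)) with ho
    have habs : ∀ x, |o x| = |g x| ^ (t - 1) := by
      intro x
      rw [ho]
      simp only [abs_neg, abs_mul]
      rcases eq_or_ne (g x) 0 with h0 | h0
      · rw [h0, abs_zero, zero_mul, Real.zero_rpow (by linarith [htt.lt])]
      · rw [abs_of_nonneg (Real.rpow_nonneg (abs_nonneg _) _), ← Real.rpow_one_add' (abs_nonneg _)]
        · congr 1; ring
        · linarith [htt.lt]
    have hog : ∀ x, -(o x * g x) = |g x| ^ t := by
      intro x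
      rcases eq_or_ne (g x) 0 with h0 | h0
      · simp [ho, h0, Real.zero_rpow ht0.ne']
      · have h1 := abs_pos.2 h0
        have h2 : |g x| ^ t = |g x| ^ (t - 2) * (|g x| * |g x|) := by
          rw [← sq, ← Real.rpow_natCast, ← Real.rpow_add h1]
          norm_num
        rw [h2, abs_mul_abs_self]
        simp only [ho]
        ring
    have hot : ∀ x, ‖o x‖ₑ ^ t' = ‖g x‖ₑ ^ t := by
      intro x
      rw [Real.enorm_eq_ofReal_abs, Real.enorm_eq_ofReal_abs, habs,
        ← ENNReal.ofReal_rpow_of_nonneg (abs_nonneg _) (by linarith [htt.lt]), ← ENNReal.rpow_mul,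
        htt.sub_one_mul_conj]
    have hom : AEStronglyMeasurable o μ :=
      (hg.1.aemeasurable.mul ((measurable_abs.comp_aemeasurable hg.1.aemeasurable).pow_const
        _)).neg.aestronglyMeasurable
    have hoN : eLpNorm o (ENNReal.ofReal t') μ = X ^ (1 / t') := by
      rw [hN ht0']
      simp only [hot, hX]
    have hoL : MemLp o (ENNReal.ofReal t') μ :=
      ⟨hom, by rw [hoN]; exact ENNReal.rpow_lt_top_of_nonneg (by positivity) hXt⟩
    have hval : ENNReal.ofReal (-∫ x, o x * g x ∂μ) = X := by
      have hi := (hint hoL).neg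
      simp only [← integral_neg, hog]
      rw [ofReal_integral_eq_lintegral_ofReal (hi.congr (ae_of_all _ hog))
        (ae_of_all _ fun x => Real.rpow_nonneg (abs_nonneg _) _), hX]
      refine lintegral_congr fun x => ?_
      rw [Real.enorm_eq_ofReal_abs, ENNReal.ofReal_rpow_of_nonneg (abs_nonneg _) ht0.le]
    refine le_trans ?_ (le_iSup₂ (f := fun (o : α → ℝ) (_ : MemLp o (ENNReal.ofReal t') μ) =>
      ENNReal.ofReal (-∫ x, o x * g x ∂μ) /
        ⨅ c : ℝ, eLpNorm (fun x => o x - c) (ENNReal.ofReal t') μ) o hoL)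
    rw [hval]
    -- The numerator is `X`, and the choice `c = 0` bounds the denominator by `X ^ (1 / t')`.
    calc X ^ (1 / t) = X / X ^ (1 / t') := by
          have : 1 / t = 1 - 1 / t' := by
            have := htt.inv_add_inv_eq_one
            simp only [one_div]; linarith
          rw [this, ENNReal.rpow_sub _ _ hX0 hXt, ENNReal.rpow_one]
      _ ≤ _ := by
          refine ENNReal.div_le_div_left ((iInf_le _ 0).trans ?_) _
          simp only [sub_zero]
          exact hoN.le

end PowerLawFEM

/-! ### Assembly of the main theorem -/

theorem mainTheorem5 (d : ℕ) (hd : 1 ≤ d) (tt σ : ℝ) :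
    ∃ C₁ : ℝ, 0 < C₁ ∧
      ∀ r t : ℝ, PowerLawFEM.Exponents d r t tt →
      ∀ Ω : Set (PowerLawFEM.Vec d), PowerLawFEM.IsLipschitzDomain Ω →
      ∀ f : PowerLawFEM.Vec d → PowerLawFEM.Vec d,
        MemLp f (ENNReal.ofReal r.conjExponent) (volume.restrict Ω) →
      ∀ S : ℕ → PowerLawFEM.Vec d → PowerLawFEM.SymMat d → PowerLawFEM.SymMat d,
        PowerLawFEM.IsStressApproximation Ω r S →
      ∀ 𝒢 : PowerLawFEM.Mesh Ω, 𝒢.ShapeRegular σ →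
      ∀ (l j : ℕ) (X : PowerLawFEM.FESpaces 𝒢 l j)
        (Pi : PowerLawFEM.L1Mat Ω →ₗ[ℝ] PowerLawFEM.L1Mat Ω),
        PowerLawFEM.IsStressProjector 𝒢 (l - 1) Pi →
      ∀ (n : ℕ) (U : PowerLawFEM.Vec d → PowerLawFEM.Vec d) (P : PowerLawFEM.Vec d → ℝ),
        PowerLawFEM.IsGalerkin X (S n) f U P →
        -- the residual of the momentum equation is defined on all of `W^{1,t̃'}_0(Ω)^d`
        (∀ w, PowerLawFEM.MemSobolevZero Ω tt.conjExponent w →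
          IntegrableOn (PowerLawFEM.resPdeIntegrand Ω f U P
            (PowerLawFEM.stress Ω (S n) U) w) Ω volume) ∧
        -- the estimator is finite and bounds the residual
        𝒢.estimatorPde tt f U P (PowerLawFEM.stress Ω (S n) U)
          (PowerLawFEM.project Pi (PowerLawFEM.stress Ω (S n) U)) ≠ ⊤ ∧
        PowerLawFEM.dualNorm Ω tt.conjExponent
            (PowerLawFEM.resPde Ω f U P (PowerLawFEM.stress Ω (S n) U))
          ≤ ENNReal.ofReal C₁ * 𝒢.estimatorPde tt f U P (PowerLawFEM.stress Ω (S n) U)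
            (PowerLawFEM.project Pi (PowerLawFEM.stress Ω (S n) U)) ^ (1 / tt) ∧
        -- the incompressibility residual
        𝒢.estimatorIc t U ≠ ⊤ ∧
        (⨆ (o : PowerLawFEM.Vec d → ℝ)
            (_ : MemLp o (ENNReal.ofReal t.conjExponent) (volume.restrict Ω)),
          ENNReal.ofReal (PowerLawFEM.resIc Ω U o) /
            ⨅ c : ℝ, eLpNorm (fun x => o x - c) (ENNReal.ofReal t.conjExponent)
              (volume.restrict Ω))
          = 𝒢.estimatorIc t U ^ (1 / t) ∧
        𝒢.estimatorIc t U ^ (1 / t)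
          = eLpNorm (PowerLawFEM.divergence Ω U) (ENNReal.ofReal t) (volume.restrict Ω) := by
  -- Admissible exponents force `tt > 1`; otherwise the claim is vacuous and any positive constant
  -- will do.
  by_cases htt : 1 < tt
  swap
  · exact ⟨1, one_pos, fun r t hrt => absurd (hrt.bounds hd).2.2.1 htt⟩
  obtain ⟨C, hC, hpde⟩ := PowerLawFEM.exists_resPde_estimate hd σ htt
  -- The added one only ensures positivity.
  refine ⟨C.toReal + 1, by positivity,
    fun r t hrt Ω hΩ f hf S hS 𝒢 hσ l j X Pi hPi n U P hUP => ?_⟩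
  obtain ⟨h1, h2, h3⟩ := hpde r t hrt Ω hΩ f hf S hS 𝒢 hσ l j X Pi hPi n U P hUP
  have ht : 1 < t := (hrt.bounds hd).2.1
  obtain ⟨M, hM⟩ := X.exists_lipschitzWith hΩ hUP.velocity_mem
  have hdiv := PowerLawFEM.memLp_divergence hΩ hM (ENNReal.ofReal t)
  have hic := PowerLawFEM.estimatorIc_rpow (𝒢 := 𝒢) hΩ ht U
  have : IsFiniteMeasure (volume.restrict Ω) := ⟨by simpa using hΩ.isBounded.measure_lt_top⟩
  refine ⟨h1, h2, h3.trans ?_, ?_, ?_, hic⟩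
  · gcongr
    refine (ENNReal.ofReal_toReal hC).symm.le.trans (ENNReal.ofReal_le_ofReal (by linarith))
  · intro h
    rw [h, ENNReal.top_rpow_of_pos (by positivity)] at hic
    exact hdiv.2.ne hic.symm
  · rw [hic]
    exact PowerLawFEM.iSup_integral_div_eq (Real.HolderConjugate.conjExponent ht) hdiv
      (PowerLawFEM.integral_divergence_eq_zero 𝒢 hΩ hM hUP.velocity_mem.2.2)
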